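/- Let $0<\beta<1$, $0<\alpha<1$, $\sigma>0$, and suppose that $(\alpha,\beta)$ lies strictly below the signed $\ell_1$-characterization, i.e. $\alpha>\alpha_w^+$, where $\alpha_w^+\in(\beta,1)$ solves $$(1-\beta)\,\frac{\sqrt{\tfrac{1}{2\pi}}\;e^{-\left(\mathrm{erfinv}\left(2\frac{1-\alpha_w^+}{1-\beta}-1\right)\right)^2}}{\alpha_w^+}-\sqrt2\,\mathrm{erfinv}\Big(2\frac{1-\alpha_w^+}{1-\beta}-1\Big)=0 .$$ Let $m=\alpha n$ and $k=\beta n$ be integers. Let $A$ be an $m\times n$ matrix with i.i.d. standard normal entries and let $v\in\mathbb R^m$, independent of $A$, have i.i.d. $N(0,\sigma^2)$ entries. For $\tilde x\in\mathbb R^n$ with $\tilde x_1=\dots=\tilde x_{n-k}=0$ and $\tilde x_{n-k+1},\dots,\tilde x_n\ge 0$ put $y=A\tilde x+v$, let $\hat x^+$ be a solution of the signed LASSO $$\min_x\ \|y-Ax\|_2\quad\text{subject to}\quad \|x\|_1\le\|\tilde x\|_1,\quad x_i\ge 0\ (1\le i\le n),$$ and call $w_{lasso+}=\hat x^+-\tilde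 x$ an error vector for $\tilde x$. Let $g\in\mathbb R^m$ and $h\in\mathbb R^n$ be independent vectors with i.i.d. standard normal entries, let $$\xi(h)=\min_{\nu,\lambda}\ \|h+\nu\mathbf 1-\lambda\|_2\quad\text{subject to}\quad \nu\ge 0,\ \ \lambda_i=0\ (n-k+1\le i\le n),\ \ \lambda_i\ge 0\ (1\le i\le n-k),$$ and set $$\|w_{gen+}\|_2=\sigma\,\frac{\xi(h)}{\sqrt{\|g\|_2^2-\xi(h)^2}}$$ when $\xi(h)<\|g\|_2$, and $\|w_{gen+}\|_2=0$ on the event $\xi(h)\ge\|g\|_2$, where the quotient is not defined. Then for every $\varepsilon>0$ there are constants $c_2,c_3>0$ and $N$, depending only on $\alpha,\beta,\sigma,\varepsilon$ (not on $n$ or $\tilde x$), such that for all such $n\ge N$ the expectation $E\|w_{gen+}\|_2$ is finite and: 1. there is an $\tilde x$ as above (not depending on $A$ and $v$) such that $$P\Big(\exists\,\text{an error vector } w_{lasso+} \text{ for } \tilde x:\ \|w_{lasso+}\|_2\in\big((1-\varepsilon)E\|w_{gen+}\|_2,\ (1+\varepsilon)E\|w_{gen+}\|_2\big)\Big)\ \ge\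 1-e^{-c_2 n};$$ 2. for every $\tilde x$ as above, $$P\Big(\text{every error vector } w_{lasso+} \text{ for } \tilde x \text{ satisfies } \|w_{lasso+}\|_2\le(1+\varepsilon)E\|w_{gen+}\|_2\Big)\ \ge\ 1-e^{-c_3 n}.$$ -/

import Mathlib

open MeasureTheory ProbabilityTheory
open scoped Matrix

noncomputable section

namespace SignedLasso

/-- The Euclidean norm `‖v‖₂` of a real vector. -/
def l2norm {ι : Type*} [Fintype ι] (v : ι → ℝ) : ℝ :=
  ‖(WithLp.toLp 2 v : EuclideanSpace ℝ ι)‖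

/-- The norm `‖v‖₁` of a real vector. -/
def l1norm {ι : Type*} [Fintype ι] (v : ι → ℝ) : ℝ :=
  ∑ i, |v i|

/-- The error function `erf x = (2 / √π) ∫₀ˣ exp (-t²) dt`. -/
def erf (x : ℝ) : ℝ :=
  2 / √Real.pi * ∫ t in (0 : ℝ)..x, Real.exp (-t ^ 2)

/-- The inverse of the error function (used only at arguments in `(-1, 1)`, the range of the
injective function `erf`). -/
def erfinv : ℝ → ℝ :=
  Function.invFun erf

/-- The equation of the characteristic curve of `ℓ₁`-optimization for nonnegative vectors. -/
def SignedCurve (αw β : ℝ) : Prop :=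
  (1 - β) * (√(1 / (2 * Real.pi)) *
      Real.exp (-(erfinv (2 * ((1 - αw) / (1 - β)) - 1)) ^ 2)) / αw
    - √2 * erfinv (2 * ((1 - αw) / (1 - β)) - 1) = 0

/-- The pair `(α, β)` lies strictly below the characteristic curve: the ratio `αw` that the curve
assigns to the sparsity `β` is smaller than `α`. The condition `β < αw` (together with `αw < 1`)
puts the argument of `erfinv` into `(-1, 1)`. -/
def BelowSignedCurve (α β : ℝ) : Prop :=
  ∃ αw : ℝ, β < αw ∧ αw < 1 ∧ SignedCurve αw β ∧ αw < α

/-- `xt` vanishes in its first `n - k` coordinates and is nonnegative in its last `k` ones. -/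
def IsSparsePos {n : ℕ} (k : ℕ) (xt : Fin n → ℝ) : Prop :=
  ∀ i : Fin n, ((i : ℕ) < n - k → xt i = 0) ∧ (n - k ≤ (i : ℕ) → 0 ≤ xt i)

/-- The feasible set of the signed LASSO. -/
def feasible {n : ℕ} (xt : Fin n → ℝ) : Set (Fin n → ℝ) :=
  {x | l1norm x ≤ l1norm xt ∧ ∀ i, 0 ≤ x i}

/-- `x` solves the signed LASSO: minimize `‖y - A x‖₂` over `‖x‖₁ ≤ ‖xt‖₁`, `x ≥ 0`. -/
def IsLassoSolution {m n : ℕ} (A : Matrix (Fin m) (Fin n) ℝ) (y : Fin m → ℝ)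
    (xt x : Fin n → ℝ) : Prop :=
  x ∈ feasible xt ∧ IsMinOn (fun x' => l2norm (y - A *ᵥ x')) (feasible xt) x

/-- `w` is an error vector of the signed LASSO run on `y = A xt + v`, that is, `xt + w` is a
solution. -/
def IsErrorVector {m n : ℕ} (A : Matrix (Fin m) (Fin n) ℝ) (v : Fin m → ℝ)
    (xt w : Fin n → ℝ) : Prop :=
  IsLassoSolution A (A *ᵥ xt + v) xt (xt + w)

/-- The joint law of the `m × n` matrix `A` with i.i.d. standard normal entries and of the
independent noise vector `v` with i.i.d. `N(0, σ²)` entries. -/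
def dataLaw (m n : ℕ) (σ : ℝ) : Measure ((Fin m → Fin n → ℝ) × (Fin m → ℝ)) :=
  (Measure.pi fun _ : Fin m => Measure.pi fun _ : Fin n => gaussianReal 0 1).prod
    (Measure.pi fun _ : Fin m => gaussianReal 0 (Real.toNNReal (σ ^ 2)))

/-- The joint law of the independent standard normal vectors `g` (length `m`), `h` (length `n`). -/
def ghLaw (m n : ℕ) : Measure ((Fin m → ℝ) × (Fin n → ℝ)) :=
  (Measure.pi fun _ : Fin m => gaussianReal 0 1).prod
    (Measure.pi fun _ : Fin n => gaussianReal 0 1)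

/-- The feasible pairs `(ν, lam)`: `ν ≥ 0`, `lam` vanishes in the last `k` coordinates and is
nonnegative in the first `n - k` ones. -/
def dualFeasible (n k : ℕ) : Set (ℝ × (Fin n → ℝ)) :=
  {p | 0 ≤ p.1 ∧ ∀ i : Fin n,
    (n - k ≤ (i : ℕ) → p.2 i = 0) ∧ ((i : ℕ) < n - k → 0 ≤ p.2 i)}

/-- The value of `min ‖h + ν 1 - lam‖₂` over the feasible pairs `(ν, lam)`. -/
def xiGen {n : ℕ} (k : ℕ) (h : Fin n → ℝ) : ℝ :=
  sInf ((fun p : ℝ × (Fin n → ℝ) => l2norm (fun i => h i + p.1 - p.2 i)) '' dualFeasible n k)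

/-- The quantity `‖w_gen+‖₂ = σ ξ / √(‖g‖₂² - ξ²)`, where `ξ` is the value of the minimization
problem. Where `ξ ≥ ‖g‖₂` the quotient has no meaning and the value is set to `0`. -/
def wGenNorm {m n : ℕ} (k : ℕ) (σ : ℝ) (g : Fin m → ℝ) (h : Fin n → ℝ) : ℝ :=
  if xiGen k h < l2norm g then
    σ * (xiGen k h / √(l2norm g ^ 2 - xiGen k h ^ 2))
  else 0

/-- The expectation `E ‖w_gen+‖₂`. -/
def meanWGen (m n k : ℕ) (σ : ℝ) : ℝ :=
  ∫ gh, wGenNorm k σ gh.1 gh.2 ∂(ghLaw m n)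

end SignedLasso

end

/-! With `w = x - xt` the residual is `‖v - A w‖`, minimised over the convex set `errSet xt`, a part
of the cone `errCone`. Writing it as the maximum of `uᵀ(A w - v)` over unit vectors `u` makes the
LASSO a min-max of a Gaussian bilinear form. Gordon's comparison replaces it by the minimisation of
`√(σ² + ‖w‖²) ‖g‖ + wᵀh - σ h₀` (`auxVal`). By duality the least value of `wᵀh` over cone vectors of
a given norm is `-ξ(h) ‖w‖`. As `‖g‖ ≈ √(α n)` and `ξ(h) ≈ √(D n)`, the auxiliary objective is
bounded below by about `√n φ(‖w‖)` with `φ(x) = √α √(σ² + x²) - √D x` (`auxLimit`), a convex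
function with minimiser `σ √D / √(α - D)` (`wLimit`).

The number `D` is the `α_w^+` of the curve. By the law of large numbers `ξ(h)² / n` tends to the
minimum over `ν ≥ 0` of `(1 - β) E (z + ν)₋² + β (1 + ν²)`. The curve equation is the stationarity
condition in `ν`, and the minimal value is `α_w^+` (`exists_threshold`).

Gordon's comparison enters as an exponential-moment bound for the difference of the min-max values
of two independent families, proved by interpolation (`integral_expDiff_le`). It bounds a product of
two opposite tail probabilities, one for each family, by `exp (-(a - b)² / (8 V))` (`gordon_tail`).
Hence the auxiliary events need only constant probability, which Chebyshev's inequality gives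
(`ghzLaw_not_typical_le`), and the exponential rate comes for free (`two_set_separation`).

Upper bound, any `xt`: a long error vector yields a point of a sphere of radius `ρ` that beats a
smaller ball of radius `ρ' > wLimit`. Radial shrinking stays in `errSet xt` and lowers the auxiliary
value, so ball and sphere are separated at a level depending on `xt` (`errorVector_upper`). Lower
bound: if the last `k` entries of `xt` all equal some `x` slightly below `wLimit`, then `errSet xt`
contains the cone vectors of norm `x`, and these beat all shorter vectors (`errorVector_lower`).

Finally `E ‖w_gen+‖₂` tends to `wLimit` (`meanWGen_approx`). Typical behaviour alone does not
suffice, since the quotient is singular where `ξ(h)` approaches `‖g‖`. A negative moment of `‖g‖² -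
c`, bounded uniformly in `c`, and an exponentially small exceptional event control that
contribution. -/

namespace SignedLasso

/-! ### Gaussian integrability and integration by parts. -/

/-- The standard Gaussian measure on `ι → ℝ`. -/
noncomputable abbrev stdG (ι : Type*) [Fintype ι] : Measure (ι → ℝ) :=
  Measure.pi fun _ : ι => gaussianReal 0 1

lemma integrable_exp_abs_gaussian (c : ℝ) :
    Integrable (fun t => Real.exp (c * |t|)) (gaussianReal 0 1) := by
  refine Integrable.mono' ((integrable_exp_mul_gaussianReal (μ := 0) (v := 1) c).add
    (integrable_exp_mul_gaussianReal (μ := 0) (v := 1) (-c))) (by fun_prop) ?_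
  filter_upwards with t
  rw [Real.norm_eq_abs, Real.abs_exp]
  simp only [Pi.add_apply]
  rcases abs_cases t with ⟨h, _⟩ | ⟨h, _⟩ <;> rw [h]
  · linarith [Real.exp_pos (-c * t)]
  · have : c * -t = -c * t := by ring
    rw [this]; linarith [Real.exp_pos (c * t)]

/-- The common dominating function: growth conditions in the Gaussian calculus below have the form
`C * exp (c * ∑ |z i|)`, a class stable under linear maps and under multiplication by coordinates.
-/
lemma integrable_exp_sum {ι : Type*} [Fintype ι] (c : ℝ) :
    Integrable (fun z : ι → ℝ => Real.exp (c * ∑ i, |z i|)) (stdG ι) := by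
  have := Integrable.fintype_prod (μ := fun _ : ι => gaussianReal 0 1)
    (f := fun (_ : ι) t => Real.exp (c * |t|)) (fun _ => integrable_exp_abs_gaussian c)
  simpa [Finset.mul_sum, Real.exp_sum] using this

lemma integrable_of_le_exp_sum {ι : Type*} [Fintype ι] {f : (ι → ℝ) → ℝ} (hf : Measurable f)
    {C c : ℝ} (h : ∀ z, |f z| ≤ C * Real.exp (c * ∑ i, |z i|)) : Integrable f (stdG ι) :=
  ((integrable_exp_sum c).const_mul C).mono' hf.aestronglyMeasurable (Filter.Eventually.of_forall h)

lemma integrable_of_le_exp_abs {f : ℝ → ℝ} (hf : Measurable f)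
    {C c : ℝ} (h : ∀ z, |f z| ≤ C * Real.exp (c * |z|)) : Integrable f (gaussianReal 0 1) :=
  ((integrable_exp_abs_gaussian c).const_mul C).mono' hf.aestronglyMeasurable (Filter.Eventually.of_forall h)

lemma abs_le_exp_abs (t : ℝ) : |t| ≤ Real.exp |t| := by
  linarith [Real.add_one_le_exp |t|]

lemma gaussianPDFReal_std (x : ℝ) :
    gaussianPDFReal 0 1 x = (√(2 * Real.pi))⁻¹ * Real.exp (-x ^ 2 / 2) := by
  simp [gaussianPDFReal]

lemma hasDerivAt_gaussianPDFReal_std (x : ℝ) :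
    HasDerivAt (gaussianPDFReal 0 1) (-(x * gaussianPDFReal 0 1 x)) x := by
  have h1 : gaussianPDFReal 0 1 = fun x => (√(2 * Real.pi))⁻¹ * Real.exp (-x ^ 2 / 2) :=
    funext gaussianPDFReal_std
  rw [h1]
  have h2 : HasDerivAt (fun x : ℝ => -x ^ 2 / 2) (-x) x := by
    have := ((hasDerivAt_pow 2 x).neg).div_const 2
    convert! this using 1
    simp
    ring
  convert! (h2.exp.const_mul (√(2 * Real.pi))⁻¹) using 1
  ring

lemma integrable_pdf_mul_iff {f : ℝ → ℝ} (h : Integrable f (gaussianReal 0 1)) :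
    Integrable (fun x => gaussianPDFReal 0 1 x * f x) := by
  rw [gaussianReal_of_var_ne_zero _ one_ne_zero] at h
  have := (integrable_withDensity_iff_integrable_smul' (measurable_gaussianPDF 0 1)
    (by filter_upwards with x using gaussianPDF_lt_top)).1 h
  simpa using this

/-- Gaussian integration by parts on the line. -/
lemma gaussian_ibp {f f' : ℝ → ℝ} (hd : ∀ t, HasDerivAt f (f' t) t) (hf' : Measurable f')
    {C c : ℝ} (h : ∀ t, |f t| ≤ C * Real.exp (c * |t|))
    (h' : ∀ t, |f' t| ≤ C * Real.exp (c * |t|)) :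
    ∫ t, t * f t ∂(gaussianReal 0 1) = ∫ t, f' t ∂(gaussianReal 0 1) := by
  have hfm : Measurable f :=
    (continuous_iff_continuousAt.2 fun t => (hd t).continuousAt).measurable
  have i1 : Integrable (fun t => t * f t) (gaussianReal 0 1) := by
    refine integrable_of_le_exp_abs (by fun_prop) (C := C) (c := c + 1) fun t => ?_
    rw [abs_mul, add_mul, Real.exp_add, one_mul]
    calc |t| * |f t| ≤ Real.exp |t| * (C * Real.exp (c * |t|)) :=
          mul_le_mul (abs_le_exp_abs t) (h t) (abs_nonneg _) (Real.exp_pos _).le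
      _ = _ := by ring
  have i2 := integrable_of_le_exp_abs hf' h'
  have i3 := integrable_of_le_exp_abs hfm h
  rw [integral_gaussianReal_eq_integral_smul one_ne_zero,
    integral_gaussianReal_eq_integral_smul one_ne_zero]
  have j1 := integrable_pdf_mul_iff i1
  have j2 := integrable_pdf_mul_iff i2
  have j3 := integrable_pdf_mul_iff i3
  -- The density satisfies `φ' = -x φ`, so `-φ` is an antiderivative of `x φ`. Integrability of the
  -- products removes the boundary terms.
  have key := integral_mul_deriv_eq_deriv_mul_of_integrable (u := f) (u' := f')
    (v := fun x => -gaussianPDFReal 0 1 x) (v' := fun x => x * gaussianPDFReal 0 1 x)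
    (fun x _ => hd x) (fun x _ => by simpa using! (hasDerivAt_gaussianPDFReal_std x).neg)
    (j1.congr (by filter_upwards with x; simp only [Pi.mul_apply]; ring))
    (j2.neg.congr (by filter_upwards with x; simp only [Pi.mul_apply, Pi.neg_apply]; ring))
    (j3.neg.congr (by filter_upwards with x; simp only [Pi.mul_apply, Pi.neg_apply]; ring))
  calc ∫ x, gaussianPDFReal 0 1 x • (x * f x) = ∫ x, f x * (x * gaussianPDFReal 0 1 x) := by
        congr 1; ext x; simp only [smul_eq_mul]; ring
    _ = _ := key
    _ = _ := by
        rw [← integral_neg]; congr 1; ext x; simp only [smul_eq_mul]; ring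

/-- Resampling one coordinate preserves the standard Gaussian measure. -/
lemma measurePreserving_update {ι : Type*} [Fintype ι] [DecidableEq ι] (k : ι) :
    MeasurePreserving (fun p : (ι → ℝ) × ℝ => Function.update p.1 k p.2)
      ((stdG ι).prod (gaussianReal 0 1)) (stdG ι) := by
  have hm : Measurable (fun p : (ι → ℝ) × ℝ => Function.update p.1 k p.2) := by
    refine measurable_pi_lambda _ fun i => ?_
    by_cases h : i = k
    · subst h; simpa using measurable_snd
    · simp only [Function.update_of_ne h]; fun_prop
  refine ⟨hm, (Measure.pi_eq fun s hs => ?_).symm⟩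
  rw [Measure.map_apply hm (MeasurableSet.univ_pi hs)]
  -- A box pulls back to a product: the box with its `k`-th side freed, times that side.
  have : (fun p : (ι → ℝ) × ℝ => Function.update p.1 k p.2) ⁻¹' (Set.univ.pi s)
      = (Set.univ.pi (Function.update s k Set.univ)) ×ˢ (s k) := by
    ext p
    simp only [Set.mem_preimage, Set.mem_univ_pi, Set.mem_prod]
    constructor
    · intro h
      refine ⟨fun i => ?_, by simpa using h k⟩
      by_cases hi : i = k
      · subst hi; simp
      · simpa [Function.update_of_ne hi] using h i
    · rintro ⟨h1, h2⟩ i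
      by_cases hi : i = k
      · subst hi; simpa using h2
      · simpa [Function.update_of_ne hi] using h1 i
  rw [this, Measure.prod_prod, Measure.pi_pi, ← Finset.mul_prod_erase _ _ (Finset.mem_univ k),
    ← Finset.mul_prod_erase _ (fun i => gaussianReal 0 1 (s i)) (Finset.mem_univ k)]
  simp only [Function.update_self, measure_univ, one_mul]
  rw [mul_comm]
  congr 1
  refine Finset.prod_congr rfl fun i hi => ?_
  rw [Function.update_of_ne (Finset.ne_of_mem_erase hi)]

lemma sum_abs_update_le {ι : Type*} [Fintype ι] [DecidableEq ι] (z : ι → ℝ) (k : ι) (t : ℝ) :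
    ∑ i, |Function.update z k t i| ≤ ∑ i, |z i| + |t| := by
  rw [← Finset.add_sum_erase _ _ (Finset.mem_univ k),
    ← Finset.add_sum_erase _ (fun i => |z i|) (Finset.mem_univ k), Function.update_self]
  have : ∑ x ∈ Finset.univ.erase k, |Function.update z k t x|
      = ∑ x ∈ Finset.univ.erase k, |z x| :=
    Finset.sum_congr rfl fun i hi => by rw [Function.update_of_ne (Finset.ne_of_mem_erase hi)]
  rw [this]; linarith [abs_nonneg (z k)]

/-- Gaussian integration by parts in one coordinate. -/
lemma gaussian_ibp_pi {ι : Type*} [Fintype ι] [DecidableEq ι] {f f' : (ι → ℝ) → ℝ} (k : ι)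
    (hd : ∀ z t, HasDerivAt (fun t => f (Function.update z k t)) (f' (Function.update z k t)) t)
    (hf : Measurable f) (hf' : Measurable f') {C c : ℝ} (hC : 0 ≤ C) (hc : 0 ≤ c)
    (h : ∀ z, |f z| ≤ C * Real.exp (c * ∑ i, |z i|))
    (h' : ∀ z, |f' z| ≤ C * Real.exp (c * ∑ i, |z i|)) :
    ∫ z, z k * f z ∂(stdG ι) = ∫ z, f' z ∂(stdG ι) := by
  have mp := measurePreserving_update k
  have i1 : Integrable (fun z => z k * f z) (stdG ι) := by
    refine integrable_of_le_exp_sum (by fun_prop) (C := C) (c := c + 1) fun z => ?_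
    rw [abs_mul, add_mul, Real.exp_add, one_mul]
    have hk : |z k| ≤ ∑ i, |z i| :=
      Finset.single_le_sum (f := fun i => |z i|) (fun i _ => abs_nonneg _) (Finset.mem_univ k)
    calc |z k| * |f z| ≤ Real.exp (∑ i, |z i|) * (C * Real.exp (c * ∑ i, |z i|)) :=
          mul_le_mul ((abs_le_exp_abs _).trans (Real.exp_le_exp.2 hk)) (h z) (abs_nonneg _)
            (Real.exp_pos _).le
      _ = _ := by ring
  have i2 := integrable_of_le_exp_sum hf' h'
  have hup : ∀ (F : (ι → ℝ) → ℝ), (∀ z, |F z| ≤ C * Real.exp (c * ∑ i, |z i|)) → ∀ z t,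
      |F (Function.update z k t)| ≤ (C * Real.exp (c * ∑ i, |z i|)) * Real.exp (c * |t|) := by
    intro F hF z t
    refine (hF _).trans ?_
    rw [mul_assoc, ← Real.exp_add, ← mul_add]
    gcongr
    exact sum_abs_update_le z k t
  -- Resampling coordinate `k` and Fubini reduce the claim to the line, the other coordinates being
  -- frozen.
  calc ∫ z, z k * f z ∂(stdG ι)
      = ∫ p : (ι → ℝ) × ℝ, (Function.update p.1 k p.2) k * f (Function.update p.1 k p.2)
        ∂((stdG ι).prod (gaussianReal 0 1)) := by
        conv_lhs => rw [← mp.map_eq]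
        exact integral_map mp.measurable.aemeasurable
          (by rw [mp.map_eq]; exact i1.aestronglyMeasurable)
    _ = ∫ z, ∫ t, t * f (Function.update z k t) ∂(gaussianReal 0 1) ∂(stdG ι) := by
        rw [integral_prod]
        · simp
        · exact (mp.integrable_comp i1.aestronglyMeasurable).2 i1
    _ = ∫ z, ∫ t, f' (Function.update z k t) ∂(gaussianReal 0 1) ∂(stdG ι) := by
        congr 1; ext z
        exact gaussian_ibp (hd z) (hf'.comp (measurable_update z)) (hup f h z) (hup f' h' z)
    _ = ∫ p : (ι → ℝ) × ℝ, f' (Function.update p.1 k p.2)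
        ∂((stdG ι).prod (gaussianReal 0 1)) := by
        rw [integral_prod]
        exact (mp.integrable_comp i2.aestronglyMeasurable).2 i2
    _ = _ := by
        conv_rhs => rw [← mp.map_eq]
        exact (integral_map mp.measurable.aemeasurable
          (by rw [mp.map_eq]; exact i2.aestronglyMeasurable)).symm

/-! ### Differentiation of Gaussian expectations along a path of linear images. -/

/-- The linear image of `z` under the coefficient matrix `M`. -/
def lin {A ι : Type*} [Fintype ι] (M : A → ι → ℝ) (z : ι → ℝ) : A → ℝ :=
  fun a => ∑ k, M a k * z k

lemma sum_abs_lin_le {A ι : Type*} [Fintype ι] [Fintype A] {M : A → ι → ℝ} {B : ℝ}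
    (hM : ∀ a k, |M a k| ≤ B) (z : ι → ℝ) :
    ∑ a, |lin M z a| ≤ Fintype.card A * B * ∑ k, |z k| := by
  have : ∀ a ∈ (Finset.univ : Finset A), |lin M z a| ≤ B * ∑ k, |z k| := by
    intro a _
    rw [Finset.mul_sum]
    refine (Finset.abs_sum_le_sum_abs _ _).trans (Finset.sum_le_sum fun k _ => ?_)
    rw [abs_mul]
    exact mul_le_mul_of_nonneg_right (hM a k) (abs_nonneg _)
  refine (Finset.sum_le_sum this).trans (le_of_eq ?_)
  simp [mul_assoc]

lemma measurable_lin {A ι : Type*} [Fintype ι] (M : A → ι → ℝ) : Measurable (lin M) := by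
  unfold lin; fun_prop

/-- The derivative of a Gaussian expectation along a path of linear images. -/
lemma hasDerivAt_integral_lin {A ι : Type*} [Fintype ι] [Fintype A] {Φ : (A → ℝ) → ℝ}
    {Φ₁ : A → (A → ℝ) → ℝ} {Φ₂ : A → A → (A → ℝ) → ℝ}
    (h₁ : ∀ x, HasFDerivAt Φ (∑ a, Φ₁ a x • ContinuousLinearMap.proj (R := ℝ) (φ := fun _ : A => ℝ) a) x)
    (h₂ : ∀ a x, HasFDerivAt (Φ₁ a)
      (∑ b, Φ₂ a b x • ContinuousLinearMap.proj (R := ℝ) (φ := fun _ : A => ℝ) b) x)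
    (hm : ∀ a b, Measurable (Φ₂ a b)) {C c : ℝ} (hC : 0 ≤ C) (hc : 0 ≤ c)
    (g₀ : ∀ x, |Φ x| ≤ C * Real.exp (c * ∑ a, |x a|))
    (g₁ : ∀ a x, |Φ₁ a x| ≤ C * Real.exp (c * ∑ a, |x a|))
    (g₂ : ∀ a b x, |Φ₂ a b x| ≤ C * Real.exp (c * ∑ a, |x a|))
    {L L' : ℝ → A → ι → ℝ} (hL : ∀ θ a k, HasDerivAt (fun θ => L θ a k) (L' θ a k) θ)
    {B : ℝ} (hB : 0 ≤ B) (hLB : ∀ θ a k, |L θ a k| ≤ B) (hLB' : ∀ θ a k, |L' θ a k| ≤ B) (θ : ℝ) :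
    HasDerivAt (fun θ => ∫ z, Φ (lin (L θ) z) ∂(stdG ι))
      (∑ a, ∑ b, (∑ k, L' θ a k * L θ b k) * ∫ z, Φ₂ a b (lin (L θ) z) ∂(stdG ι)) θ := by
  classical
  set D := c * (Fintype.card A * B) with hD
  have hD0 : 0 ≤ D := by positivity
  have grow : ∀ (F : (A → ℝ) → ℝ), (∀ x, |F x| ≤ C * Real.exp (c * ∑ a, |x a|)) → ∀ θ z,
      |F (lin (L θ) z)| ≤ C * Real.exp (D * ∑ k, |z k|) := by
    intro F hF θ z
    refine (hF _).trans ?_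
    refine mul_le_mul_of_nonneg_left (Real.exp_le_exp.2 ?_) hC
    rw [hD, mul_assoc]
    exact mul_le_mul_of_nonneg_left (sum_abs_lin_le (hLB θ) z) hc
  have cΦ : Continuous Φ := continuous_iff_continuousAt.2 fun x => (h₁ x).continuousAt
  have cΦ₁ : ∀ a, Continuous (Φ₁ a) :=
    fun a => continuous_iff_continuousAt.2 fun x => (h₂ a x).continuousAt
  have hlin : ∀ z θ, HasDerivAt (fun θ => lin (L θ) z) (lin (L' θ) z) θ := by
    intro z θ
    refine hasDerivAt_pi.2 fun a => ?_
    exact HasDerivAt.fun_sum fun k _ => (hL θ a k).mul_const (z k)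
  have hd : ∀ z θ, HasDerivAt (fun θ => Φ (lin (L θ) z))
      (∑ a, Φ₁ a (lin (L θ) z) * lin (L' θ) z a) θ := by
    intro z θ
    have := (h₁ (lin (L θ) z)).comp_hasDerivAt θ (hlin z θ)
    convert! this using 1
    simp
  -- The coefficients and their derivatives are bounded by `B` for every `θ`, so one dominating
  -- function serves all `θ`. The `+ 1` in its exponent absorbs the linear factor `lin (L' θ) z`.
  have key := hasDerivAt_integral_of_dominated_loc_of_deriv_le (μ := stdG ι) (𝕜 := ℝ)
    (F := fun θ z => Φ (lin (L θ) z))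
    (F' := fun θ z => ∑ a, Φ₁ a (lin (L θ) z) * lin (L' θ) z a) (x₀ := θ) (s := Set.univ)
    (bound := fun z => (C * (Fintype.card A * B)) * Real.exp ((D + 1) * ∑ k, |z k|))
    Filter.univ_mem
    (Filter.Eventually.of_forall fun θ =>
      (cΦ.measurable.comp (measurable_lin _)).aestronglyMeasurable)
    (integrable_of_le_exp_sum (cΦ.measurable.comp (measurable_lin _)) (grow Φ g₀ θ))
    (by
      refine (Finset.measurable_fun_sum _ fun a _ => ?_).aestronglyMeasurable
      exact ((cΦ₁ a).measurable.comp (measurable_lin _)).mul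
        ((measurable_pi_apply a).comp (measurable_lin _)))
    (Filter.Eventually.of_forall fun z θ _ => by
      rw [Real.norm_eq_abs]
      calc |∑ a, Φ₁ a (lin (L θ) z) * lin (L' θ) z a|
          ≤ ∑ a, |Φ₁ a (lin (L θ) z) * lin (L' θ) z a| := Finset.abs_sum_le_sum_abs _ _
        _ ≤ ∑ a, C * Real.exp (D * ∑ k, |z k|) * |lin (L' θ) z a| := by
            refine Finset.sum_le_sum fun a _ => ?_
            rw [abs_mul]
            exact mul_le_mul_of_nonneg_right (grow _ (g₁ a) θ z) (abs_nonneg _)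
        _ = C * Real.exp (D * ∑ k, |z k|) * ∑ a, |lin (L' θ) z a| := (Finset.mul_sum _ _ _).symm
        _ ≤ C * Real.exp (D * ∑ k, |z k|) * (Fintype.card A * B * Real.exp (∑ k, |z k|)) := by
            gcongr
            refine (sum_abs_lin_le (hLB' θ) z).trans ?_
            gcongr
            linarith [Real.add_one_le_exp (∑ k, |z k|)]
        _ = _ := by rw [add_mul, Real.exp_add, one_mul]; ring)
    ((integrable_exp_sum _).const_mul _)
    (Filter.Eventually.of_forall fun z θ _ => hd z θ)
  refine key.2.congr_deriv ?_
  -- Integration by parts trades the factor `z k` for second derivatives. Afterwards the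
  -- coefficients enter only through the inner products of `L'` with `L`.
  have ibp : ∀ a k, ∫ z, z k * Φ₁ a (lin (L θ) z) ∂(stdG ι)
      = ∑ b, L θ b k * ∫ z, Φ₂ a b (lin (L θ) z) ∂(stdG ι) := by
    intro a k
    have i2 : ∀ b, Integrable (fun z => Φ₂ a b (lin (L θ) z)) (stdG ι) := fun b =>
      integrable_of_le_exp_sum ((hm a b).comp (measurable_lin _)) (grow _ (g₂ a b) θ)
    rw [gaussian_ibp_pi k (f := fun z => Φ₁ a (lin (L θ) z))
      (f' := fun z => ∑ b, L θ b k * Φ₂ a b (lin (L θ) z)) (C := C * (1 + Fintype.card A * B))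
      (c := D) ?_ ((cΦ₁ a).measurable.comp (measurable_lin _)) ?_ (by positivity) hD0 ?_ ?_]
    · rw [integral_finsetSum _ fun b _ => (i2 b).const_mul _]
      simp_rw [integral_const_mul]
    · intro z t
      have hl : HasDerivAt (fun t => lin (L θ) (Function.update z k t)) (fun b => L θ b k) t := by
        refine hasDerivAt_pi.2 fun b => ?_
        have e : (fun t => lin (L θ) (Function.update z k t) b)
            = fun t => L θ b k * t + ∑ i ∈ Finset.univ.erase k, L θ b i * z i := by
          ext t
          rw [lin, ← Finset.add_sum_erase _ _ (Finset.mem_univ k), Function.update_self]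
          congr 1
          refine Finset.sum_congr rfl fun i hi => ?_
          rw [Function.update_of_ne (Finset.ne_of_mem_erase hi)]
        rw [e]
        simpa using ((hasDerivAt_id t).const_mul (L θ b k)).add_const
          (∑ i ∈ Finset.univ.erase k, L θ b i * z i)
      have := (h₂ a _).comp_hasDerivAt t hl
      convert! this using 1
      simp [mul_comm]
    · exact Finset.measurable_fun_sum _ fun b _ =>
        ((hm a b).comp (measurable_lin _)).const_mul _
    · intro z
      refine (grow _ (g₁ a) θ z).trans ?_
      gcongr
      have : 0 ≤ Fintype.card A * B := by positivity
      nlinarith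
    · intro z
      calc |∑ b, L θ b k * Φ₂ a b (lin (L θ) z)|
          ≤ ∑ b, |L θ b k * Φ₂ a b (lin (L θ) z)| := Finset.abs_sum_le_sum_abs _ _
        _ ≤ ∑ _b : A, B * (C * Real.exp (D * ∑ k, |z k|)) := by
            refine Finset.sum_le_sum fun b _ => ?_
            rw [abs_mul]
            exact mul_le_mul (hLB θ b k) (grow _ (g₂ a b) θ z) (abs_nonneg _) hB
        _ = C * (Fintype.card A * B) * Real.exp (D * ∑ k, |z k|) := by
            simp; ring
        _ ≤ _ := by
            gcongr
            linarith
  have i1 : ∀ a k, Integrable (fun z => z k * Φ₁ a (lin (L θ) z)) (stdG ι) := by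
    intro a k
    refine integrable_of_le_exp_sum (C := C) (c := D + 1)
      ((measurable_pi_apply k).mul ((cΦ₁ a).measurable.comp (measurable_lin _))) fun z => ?_
    rw [abs_mul, add_mul, Real.exp_add, one_mul]
    have hk : |z k| ≤ ∑ i, |z i| :=
      Finset.single_le_sum (f := fun i => |z i|) (fun i _ => abs_nonneg _) (Finset.mem_univ k)
    calc |z k| * |Φ₁ a (lin (L θ) z)|
        ≤ Real.exp (∑ i, |z i|) * (C * Real.exp (D * ∑ i, |z i|)) :=
          mul_le_mul ((abs_le_exp_abs _).trans (Real.exp_le_exp.2 hk)) (grow _ (g₁ a) θ z)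
            (abs_nonneg _) (Real.exp_pos _).le
      _ = _ := by ring
  have e1 : ∀ z, ∑ a, Φ₁ a (lin (L θ) z) * lin (L' θ) z a
      = ∑ a, ∑ k, L' θ a k * (z k * Φ₁ a (lin (L θ) z)) := by
    intro z
    refine Finset.sum_congr rfl fun a _ => ?_
    rw [lin, Finset.mul_sum]
    refine Finset.sum_congr rfl fun k _ => by ring
  simp_rw [e1]
  rw [integral_finsetSum _ fun a _ => integrable_finsetSum _ fun k _ => (i1 a k).const_mul _]
  refine Finset.sum_congr rfl fun a _ => ?_
  rw [integral_finsetSum _ fun k _ => (i1 a k).const_mul _]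
  simp_rw [integral_const_mul, ibp, Finset.mul_sum, Finset.sum_mul]
  rw [Finset.sum_comm]
  refine Finset.sum_congr rfl fun b _ => Finset.sum_congr rfl fun k _ => by ring

/-! ### The soft min-max and its derivatives. -/

/-- The reciprocal row sums of the soft min-max. -/
noncomputable def smR {I J : Type*} [Fintype J] (β : ℝ) (x : I × J → ℝ) (i : I) : ℝ :=
  (∑ j, Real.exp (β * x (i, j)))⁻¹

/-- The total of the reciprocal row sums. -/
noncomputable def smT {I J : Type*} [Fintype I] [Fintype J] (β : ℝ) (x : I × J → ℝ) : ℝ :=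
  ∑ i, smR β x i

/-- A smooth approximation of `min_i max_j x (i, j)`. -/
noncomputable def softMinMax {I J : Type*} [Fintype I] [Fintype J] (β : ℝ) (x : I × J → ℝ) : ℝ :=
  -(β⁻¹ * Real.log (smT β x))

/-- The partial derivatives of `softMinMax`. -/
noncomputable def smW {I J : Type*} [Fintype I] [Fintype J] (β : ℝ) (a : I × J)
    (x : I × J → ℝ) : ℝ :=
  smR β x a.1 ^ 2 * Real.exp (β * x a) * (smT β x)⁻¹

/-- The second partial derivatives of `softMinMax`. -/
noncomputable def smW₂ {I J : Type*} [Fintype I] [Fintype J] [DecidableEq I] [DecidableEq J]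
    (β : ℝ) (a b : I × J) (x : I × J → ℝ) : ℝ :=
  β * smW β a x * (smW β b x + if a.1 = b.1 then
    (if a.2 = b.2 then 1 else 0) - 2 * (smR β x b.1 * Real.exp (β * x b)) else 0)

section soft
variable {I J : Type*} [Fintype I] [Fintype J] [Nonempty I] [Nonempty J]

lemma smS_pos {I J : Type*} [Fintype J] [Nonempty J] (β : ℝ) (x : I × J → ℝ) (i : I) :
    0 < ∑ j, Real.exp (β * x (i, j)) :=
  Finset.sum_pos (fun _ _ => Real.exp_pos _) Finset.univ_nonempty

lemma smR_pos {I J : Type*} [Fintype J] [Nonempty J] (β : ℝ) (x : I × J → ℝ) (i : I) :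
    0 < smR β x i := inv_pos.2 (smS_pos β x i)

lemma smT_pos (β : ℝ) (x : I × J → ℝ) : 0 < smT β x :=
  Finset.sum_pos (fun i _ => smR_pos β x i) Finset.univ_nonempty

lemma smW_nonneg (β : ℝ) (a : I × J) (x : I × J → ℝ) : 0 ≤ smW β a x := by
  have := smT_pos β x
  unfold smW; positivity

/-- The weight at `(i, j)` is the soft-min weight `R i / T` of row `i` times the soft-max weight `R
i * exp (β * x (i, j))` within that row. -/
lemma sum_smW (β : ℝ) (x : I × J → ℝ) : ∑ a, smW β a x = 1 := by
  have hT := smT_pos β x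
  unfold smW
  rw [← Finset.sum_mul, Fintype.sum_prod_type]
  have : ∀ i, ∑ j, smR β x i ^ 2 * Real.exp (β * x (i, j)) = smR β x i := by
    intro i
    have h := smS_pos β x i
    rw [← Finset.mul_sum, smR]
    field_simp
  simp_rw [this]
  exact mul_inv_cancel₀ hT.ne'

lemma smW_le_one (β : ℝ) (a : I × J) (x : I × J → ℝ) : smW β a x ≤ 1 := by
  rw [← sum_smW β x]
  exact Finset.single_le_sum (f := fun a => smW β a x) (fun a _ => smW_nonneg β a x)
    (Finset.mem_univ a)

lemma smR_mul_exp_le_one {I J : Type*} [Fintype J] [Nonempty J] (β : ℝ) (a : I × J)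
    (x : I × J → ℝ) : smR β x a.1 * Real.exp (β * x a) ≤ 1 := by
  have h := smS_pos β x a.1
  rw [smR, inv_mul_le_one₀ h]
  exact Finset.single_le_sum (f := fun j => Real.exp (β * x (a.1, j)))
    (fun _ _ => (Real.exp_pos _).le) (Finset.mem_univ a.2)

/-- Needed only as a growth bound. The dependence on `β` is harmless, since the final comparison
uses the sign of the second derivatives between different rows instead. -/
lemma abs_smW₂_le [DecidableEq I] [DecidableEq J] {β : ℝ} (hβ : 0 ≤ β) (a b : I × J)
    (x : I × J → ℝ) : |smW₂ β a b x| ≤ 4 * β := by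
  have h1 := smW_nonneg β a x
  have h2 := smW_le_one β a x
  have h3 := smW_nonneg β b x
  have h4 := smW_le_one β b x
  have h5 := smR_mul_exp_le_one β b x
  have h6 : 0 ≤ smR β x b.1 * Real.exp (β * x b) := by
    have := smR_pos β x b.1
    positivity
  rw [smW₂, abs_mul, abs_of_nonneg (mul_nonneg hβ h1)]
  have : |smW β b x + if a.1 = b.1 then
    (if a.2 = b.2 then 1 else 0) - 2 * (smR β x b.1 * Real.exp (β * x b)) else 0| ≤ 4 := by
    rw [abs_le]
    split_ifs <;> constructor <;> linarith
  calc _ ≤ (β * 1) * 4 := by gcongr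
    _ = _ := by ring

/-- The coordinate functional. -/
noncomputable abbrev pr {A : Type*} (a : A) : (A → ℝ) →L[ℝ] ℝ :=
  ContinuousLinearMap.proj (R := ℝ) (φ := fun _ : A => ℝ) a

lemma hasFDerivAt_smR {I J : Type*} [Fintype I] [Fintype J] [Nonempty J] (β : ℝ) (i : I)
    (x : I × J → ℝ) :
    HasFDerivAt (fun x => smR β x i)
      (-(smR β x i ^ 2) • ∑ j, (Real.exp (β * x (i, j))) • (β • pr (i, j))) x := by
  have h1 : HasFDerivAt (fun x : I × J → ℝ => ∑ j, Real.exp (β * x (i, j)))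
      (∑ j, (Real.exp (β * x (i, j))) • (β • pr (i, j))) x :=
    HasFDerivAt.fun_sum fun j _ => (((pr (i, j)).hasFDerivAt).const_mul β).exp
  have := (hasDerivAt_inv (smS_pos β x i).ne').comp_hasFDerivAt x h1
  refine this.congr_fderiv ?_
  rw [smR, inv_pow]

lemma hasFDerivAt_smT (β : ℝ) (x : I × J → ℝ) :
    HasFDerivAt (smT β) (-(β * smT β x) • ∑ b, smW β b x • pr b) x := by
  have h : HasFDerivAt (smT β)
      (∑ i, (-(smR β x i ^ 2) • ∑ j, (Real.exp (β * x (i, j))) • (β • pr (i, j)))) x :=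
    HasFDerivAt.fun_sum fun i _ => hasFDerivAt_smR β i x
  convert! h using 1
  have hT := smT_pos β x
  rw [Fintype.sum_prod_type, Finset.smul_sum]
  refine Finset.sum_congr rfl fun i _ => ?_
  rw [Finset.smul_sum, Finset.smul_sum]
  refine Finset.sum_congr rfl fun j _ => ?_
  simp only [smul_smul]
  congr 1
  rw [smW]
  field_simp

lemma hasFDerivAt_softMinMax {β : ℝ} (hβ : β ≠ 0) (x : I × J → ℝ) :
    HasFDerivAt (softMinMax β) (∑ b, smW β b x • pr b) x := by
  have h := (((hasFDerivAt_smT β x).log (smT_pos β x).ne').const_mul β⁻¹).neg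
  convert! h using 1
  have hT := smT_pos β x
  rw [smul_smul, smul_smul, ← neg_smul]
  have : -(β⁻¹ * (smT β x)⁻¹ * -(β * smT β x)) = 1 := by field_simp
  rw [this, one_smul]

lemma hasFDerivAt_smW [DecidableEq I] [DecidableEq J] (β : ℝ) (a : I × J) (x : I × J → ℝ) :
    HasFDerivAt (smW β a) (∑ b, smW₂ β a b x • pr b) x := by
  have hT := smT_pos β x
  have hR := smR_pos β x a.1
  have h1 := (hasFDerivAt_smR β a.1 x).pow 2
  have h2 : HasFDerivAt (fun x : I × J → ℝ => Real.exp (β * x a))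
      (Real.exp (β * x a) • (β • pr a)) x := (((pr a).hasFDerivAt).const_mul β).exp
  have h3 := (hasDerivAt_inv hT.ne').comp_hasFDerivAt x (hasFDerivAt_smT β x)
  have h := (h1.mul h2).mul h3
  refine h.congr_fderiv ?_
  ext v
  have e1 : ∀ i, ∑ j, Real.exp (β * x (i, j)) * (β * v (i, j))
      = β * ∑ j, Real.exp (β * x (i, j)) * v (i, j) := by
    intro i; rw [Finset.mul_sum]; exact Finset.sum_congr rfl fun j _ => by ring
  have e2 : ∑ b, smW₂ β a b x * v b = β * smW β a x * (∑ b, smW β b x * v b) +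
      β * smW β a x * (v a - 2 * (smR β x a.1 * ∑ j, Real.exp (β * x (a.1, j)) * v (a.1, j))) := by
    have e3 : ∑ b : I × J, (if a.1 = b.1 then
        (if a.2 = b.2 then 1 else 0) - 2 * (smR β x b.1 * Real.exp (β * x b)) else 0) * v b
        = v a - 2 * (smR β x a.1 * ∑ j, Real.exp (β * x (a.1, j)) * v (a.1, j)) := by
      rw [Fintype.sum_prod_type, Finset.sum_eq_single a.1]
      · simp only [if_true, sub_mul, Finset.sum_sub_distrib, ite_mul, one_mul, zero_mul,
          Finset.sum_ite_eq, Finset.mem_univ]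
        congr 1
        rw [Finset.mul_sum, Finset.mul_sum]
        exact Finset.sum_congr rfl fun j _ => by ring
      · intro i _ hi
        simp [hi.symm]
      · simp
    rw [← mul_add, ← e3, ← Finset.sum_add_distrib, Finset.mul_sum]
    exact Finset.sum_congr rfl fun b _ => by rw [smW₂]; ring
  simp only [add_apply, smul_apply,
    sum_apply, ContinuousLinearMap.proj_apply, smul_eq_mul, e1, e2,
    Function.comp_apply]
  simp only [smW, pow_one, Nat.cast_ofNat, Nat.add_one_sub_one, nsmul_eq_mul, Pi.mul_apply]
  field_simp
  ring

/-- Every reciprocal row sum is at most `exp (-β a)`. Adding up `card I` of them costs `β⁻¹ log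
(card I)`, which vanishes as `β → ∞`. -/
lemma le_softMinMax {β a : ℝ} (hβ : 0 < β) {x : I × J → ℝ} (h : ∀ i, ∃ j, a ≤ x (i, j)) :
    a - β⁻¹ * Real.log (Fintype.card I) ≤ softMinMax β x := by
  have hT : smT β x ≤ Fintype.card I * Real.exp (-(β * a)) := by
    have : ∀ i ∈ (Finset.univ : Finset I), smR β x i ≤ Real.exp (-(β * a)) := by
      intro i _
      obtain ⟨j, hj⟩ := h i
      rw [smR, Real.exp_neg]
      refine inv_anti₀ (Real.exp_pos _) ?_
      refine le_trans ?_ (Finset.single_le_sum (f := fun j => Real.exp (β * x (i, j)))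
        (fun _ _ => (Real.exp_pos _).le) (Finset.mem_univ j))
      exact Real.exp_le_exp.2 (mul_le_mul_of_nonneg_left hj hβ.le)
    simpa [smT] using Finset.sum_le_sum this
  have h1 := Real.log_le_log (smT_pos β x) hT
  have hc : (0 : ℝ) < Fintype.card I := by exact_mod_cast Fintype.card_pos
  rw [Real.log_mul hc.ne' (Real.exp_pos _).ne', Real.log_exp] at h1
  have h2 := mul_le_mul_of_nonneg_left h1 (inv_pos.2 hβ).le
  rw [softMinMax]
  have : β⁻¹ * (Real.log (Fintype.card I) + -(β * a)) = β⁻¹ * Real.log (Fintype.card I) - a := by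
    field_simp; ring
  linarith

end soft

/-- Only the good row is kept in the sum `smT`. Its row sum has `card J` terms of size at most `exp
(β b)`. -/
lemma softMinMax_le {I J : Type*} [Fintype I] [Fintype J] [Nonempty J] {β b : ℝ} (hβ : 0 < β) {x : I × J → ℝ} (h : ∃ i, ∀ j, x (i, j) ≤ b) :
    softMinMax β x ≤ b + β⁻¹ * Real.log (Fintype.card J) := by
  obtain ⟨i, hi⟩ := h
  have hc : (0 : ℝ) < Fintype.card J := by exact_mod_cast Fintype.card_pos
  have hT : (Fintype.card J * Real.exp (β * b))⁻¹ ≤ smT β x := by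
    refine le_trans ?_ (Finset.single_le_sum (f := fun i => smR β x i)
      (fun i _ => (smR_pos β x i).le) (Finset.mem_univ i))
    refine inv_anti₀ (smS_pos β x i) ?_
    have : ∀ j ∈ (Finset.univ : Finset J), Real.exp (β * x (i, j)) ≤ Real.exp (β * b) :=
      fun j _ => Real.exp_le_exp.2 (mul_le_mul_of_nonneg_left (hi j) hβ.le)
    simpa using Finset.sum_le_sum this
  have h1 := Real.log_le_log (by positivity) hT
  rw [Real.log_inv, Real.log_mul hc.ne' (Real.exp_pos _).ne', Real.log_exp] at h1
  have h2 := mul_le_mul_of_nonneg_left h1 (inv_pos.2 hβ).le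
  rw [softMinMax]
  have : β⁻¹ * -(Real.log (Fintype.card J) + β * b) = -(β⁻¹ * Real.log (Fintype.card J)) - b := by
    field_simp; ring
  linarith

/-! ### The exponential of a difference of soft min-max values. -/

section mgf
variable {A : Type*} [Fintype A]

/-- The left half of a vector indexed by `A ⊕ A`. -/
def lhalf {A : Type*} (d : A → ℝ) (x : A ⊕ A → ℝ) : A → ℝ := fun a => x (Sum.inl a) + d a

/-- The right half of a vector indexed by `A ⊕ A`. -/
def rhalf {A : Type*} (d : A → ℝ) (x : A ⊕ A → ℝ) : A → ℝ := fun a => x (Sum.inr a) + d a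

lemma hasFDerivAt_comp_lhalf {f : (A → ℝ) → ℝ} {f₁ : A → ℝ} {d : A → ℝ} {x : A ⊕ A → ℝ}
    (h : HasFDerivAt f (∑ b, f₁ b • pr b) (lhalf d x)) :
    HasFDerivAt (fun x => f (lhalf d x)) (∑ b, f₁ b • pr (Sum.inl b)) x := by
  have h2 : HasFDerivAt (lhalf d) (ContinuousLinearMap.pi fun a => pr (Sum.inl a)) x :=
    hasFDerivAt_pi.2 fun a => ((pr (Sum.inl a)).hasFDerivAt).add_const (d a)
  refine (h.comp x h2).congr_fderiv ?_
  ext v; simp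

lemma hasFDerivAt_comp_rhalf {f : (A → ℝ) → ℝ} {f₁ : A → ℝ} {d : A → ℝ} {x : A ⊕ A → ℝ}
    (h : HasFDerivAt f (∑ b, f₁ b • pr b) (rhalf d x)) :
    HasFDerivAt (fun x => f (rhalf d x)) (∑ b, f₁ b • pr (Sum.inr b)) x := by
  have h2 : HasFDerivAt (rhalf d) (ContinuousLinearMap.pi fun a => pr (Sum.inr a)) x :=
    hasFDerivAt_pi.2 fun a => ((pr (Sum.inr a)).hasFDerivAt).add_const (d a)
  refine (h.comp x h2).congr_fderiv ?_
  ext v; simp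

end mgf

section mgf
variable {I J : Type*} [Fintype I] [Fintype J]

/-- `exp (lam (F (p + d) - F (q + d)))` for `F` the soft min-max and `x = (p, q)`. -/
noncomputable def expDiff (β lam : ℝ) (d : I × J → ℝ) (x : (I × J) ⊕ (I × J) → ℝ) : ℝ :=
  Real.exp (lam * (softMinMax β (lhalf d x) - softMinMax β (rhalf d x)))

/-- The coefficients in the partial derivatives of `expDiff`. -/
noncomputable def edW (β lam : ℝ) (d : I × J → ℝ) :
    (I × J) ⊕ (I × J) → ((I × J) ⊕ (I × J) → ℝ) → ℝ
  | Sum.inl a, x => lam * smW β a (lhalf d x)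
  | Sum.inr a, x => -(lam * smW β a (rhalf d x))

/-- The partial derivatives of `edW`. -/
noncomputable def edW₂ [DecidableEq I] [DecidableEq J] (β lam : ℝ) (d : I × J → ℝ) :
    (I × J) ⊕ (I × J) → (I × J) ⊕ (I × J) → ((I × J) ⊕ (I × J) → ℝ) → ℝ
  | Sum.inl a, Sum.inl b, x => lam * smW₂ β a b (lhalf d x)
  | Sum.inr a, Sum.inr b, x => -(lam * smW₂ β a b (rhalf d x))
  | Sum.inl _, Sum.inr _, _ => 0
  | Sum.inr _, Sum.inl _, _ => 0

lemma hasFDerivAt_expDiff [Nonempty I] [Nonempty J] {β lam : ℝ} (hβ : β ≠ 0) (d : I × J → ℝ)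
    (x : (I × J) ⊕ (I × J) → ℝ) :
    HasFDerivAt (expDiff β lam d) (∑ b, (edW β lam d b x * expDiff β lam d x) • pr b) x := by
  have h := (((hasFDerivAt_comp_lhalf (hasFDerivAt_softMinMax hβ (lhalf d x))).sub
    (hasFDerivAt_comp_rhalf (hasFDerivAt_softMinMax hβ (rhalf d x)))).const_mul lam).exp
  refine h.congr_fderiv ?_
  ext v
  simp only [sum_apply, smul_apply, ContinuousLinearMap.proj_apply, smul_eq_mul,
    sub_apply, expDiff, Pi.sub_apply]
  simp only [Fintype.sum_sum_type, edW]
  generalize Real.exp _ = e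
  rw [mul_sub, mul_sub, Finset.mul_sum, Finset.mul_sum, Finset.mul_sum, Finset.mul_sum, sub_eq_add_neg,
    ← Finset.sum_neg_distrib]
  congr 1 <;> exact Finset.sum_congr rfl fun b _ => by ring

lemma hasFDerivAt_edW [Nonempty I] [Nonempty J] [DecidableEq I] [DecidableEq J] {β lam : ℝ}
    (d : I × J → ℝ) (a : (I × J) ⊕ (I × J)) (x : (I × J) ⊕ (I × J) → ℝ) :
    HasFDerivAt (edW β lam d a) (∑ b, edW₂ β lam d a b x • pr b) x := by
  rcases a with a | a
  · refine ((hasFDerivAt_comp_lhalf (hasFDerivAt_smW β a (lhalf d x))).const_mul lam).congr_fderiv ?_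
    ext v
    simp [edW₂, Finset.mul_sum, mul_assoc]
  · refine ((hasFDerivAt_comp_rhalf (hasFDerivAt_smW β a (rhalf d x))).const_mul lam).neg.congr_fderiv ?_
    ext v
    simp [edW₂, Finset.mul_sum, mul_assoc]

lemma hasFDerivAt_edW_mul_expDiff [Nonempty I] [Nonempty J] [DecidableEq I] [DecidableEq J]
    {β lam : ℝ} (hβ : β ≠ 0) (d : I × J → ℝ) (a : (I × J) ⊕ (I × J))
    (x : (I × J) ⊕ (I × J) → ℝ) :
    HasFDerivAt (fun x => edW β lam d a x * expDiff β lam d x)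
      (∑ b, ((edW₂ β lam d a b x + edW β lam d a x * edW β lam d b x) * expDiff β lam d x) • pr b)
      x := by
  refine ((hasFDerivAt_edW d a x).mul (hasFDerivAt_expDiff hβ d x)).congr_fderiv ?_
  ext v
  simp only [sum_apply, smul_apply, ContinuousLinearMap.proj_apply, smul_eq_mul, add_apply,
    Finset.mul_sum, ← Finset.sum_add_distrib]
  exact Finset.sum_congr rfl fun b _ => by ring

lemma abs_edW_le [Nonempty I] [Nonempty J] {β lam : ℝ} (hl : 0 ≤ lam) (d : I × J → ℝ)
    (a : (I × J) ⊕ (I × J)) (x : (I × J) ⊕ (I × J) → ℝ) : |edW β lam d a x| ≤ lam := by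
  rcases a with a | a <;> simp only [edW, abs_neg, abs_mul, abs_of_nonneg hl,
    abs_of_nonneg (smW_nonneg _ _ _)]
  · exact mul_le_of_le_one_right hl (smW_le_one _ _ _)
  · exact mul_le_of_le_one_right hl (smW_le_one _ _ _)

lemma abs_edW₂_le [Nonempty I] [Nonempty J] [DecidableEq I] [DecidableEq J] {β lam : ℝ}
    (hβ : 0 ≤ β) (hl : 0 ≤ lam) (d : I × J → ℝ)
    (a b : (I × J) ⊕ (I × J)) (x : (I × J) ⊕ (I × J) → ℝ) :
    |edW₂ β lam d a b x| ≤ lam * (4 * β) := by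
  have h0 : 0 ≤ lam * (4 * β) := by positivity
  rcases a with a | a <;> rcases b with b | b <;>
    simp only [edW₂, abs_neg, abs_mul, abs_of_nonneg hl, abs_zero, h0]
  · exact mul_le_mul_of_nonneg_left (abs_smW₂_le hβ a b _) hl
  · exact mul_le_mul_of_nonneg_left (abs_smW₂_le hβ a b _) hl

lemma abs_softMinMax_le [Nonempty I] [Nonempty J] {β : ℝ} (hβ : 0 < β) (x : I × J → ℝ) :
    |softMinMax β x| ≤ ∑ a, |x a| +
      β⁻¹ * (Real.log (Fintype.card I) + Real.log (Fintype.card J)) := by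
  have hI : 0 ≤ β⁻¹ * Real.log (Fintype.card I) := by
    refine mul_nonneg (inv_pos.2 hβ).le (Real.log_nonneg ?_)
    exact_mod_cast Fintype.card_pos
  have hJ : 0 ≤ β⁻¹ * Real.log (Fintype.card J) := by
    refine mul_nonneg (inv_pos.2 hβ).le (Real.log_nonneg ?_)
    exact_mod_cast Fintype.card_pos
  have hx : ∀ a, |x a| ≤ ∑ a, |x a| := fun a =>
    Finset.single_le_sum (f := fun i => |x i|) (fun i _ => abs_nonneg _) (Finset.mem_univ a)
  obtain ⟨i⟩ := ‹Nonempty I›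
  obtain ⟨j⟩ := ‹Nonempty J›
  have h1 := le_softMinMax hβ (x := x) (a := -∑ a, |x a|)
    fun i => ⟨j, (abs_le.1 (hx (i, j))).1⟩
  have h2 := softMinMax_le hβ (x := x) (b := ∑ a, |x a|) ⟨i, fun j => (abs_le.1 (hx (i, j))).2⟩
  rw [abs_le, mul_add]
  constructor <;> linarith

lemma expDiff_le [Nonempty I] [Nonempty J] {β lam : ℝ} (hβ : 0 < β) (hl : 0 ≤ lam)
    (d : I × J → ℝ) (x : (I × J) ⊕ (I × J) → ℝ) :
    expDiff β lam d x ≤ Real.exp (lam * (2 * (∑ a, |d a| +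
      β⁻¹ * (Real.log (Fintype.card I) + Real.log (Fintype.card J))))) *
      Real.exp (lam * ∑ a, |x a|) := by
  rw [expDiff, ← Real.exp_add, ← mul_add]
  refine Real.exp_le_exp.2 (mul_le_mul_of_nonneg_left ?_ hl)
  have h1 := (abs_le.1 (abs_softMinMax_le hβ (lhalf d x))).2
  have h2 := (abs_le.1 (abs_softMinMax_le hβ (rhalf d x))).1
  have h3 : ∑ a, |lhalf d x a| ≤ ∑ a, |x (Sum.inl a)| + ∑ a, |d a| := by
    rw [← Finset.sum_add_distrib]
    exact Finset.sum_le_sum fun a _ => abs_add_le _ _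
  have h4 : ∑ a, |rhalf d x a| ≤ ∑ a, |x (Sum.inr a)| + ∑ a, |d a| := by
    rw [← Finset.sum_add_distrib]
    exact Finset.sum_le_sum fun a _ => abs_add_le _ _
  rw [Fintype.sum_sum_type]
  linarith

end mgf

/-! ### The interpolation path and the comparison of exponential moments. -/

section path
variable {A κ₁ κ₂ : Type*} [Fintype κ₁] [Fintype κ₂]

/-- The path of Gaussian families from `(Y, Y)` at `θ = 0` to `(Y', X)` at `θ = π / 2`. -/
noncomputable def gPath (x : A → κ₁ → ℝ) (y : A → κ₂ → ℝ) (θ : ℝ) :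
    A ⊕ A → κ₁ ⊕ (κ₂ ⊕ κ₂) → ℝ
  | Sum.inl _, Sum.inl _ => 0
  | Sum.inl a, Sum.inr (Sum.inl k) => Real.cos θ * y a k
  | Sum.inl a, Sum.inr (Sum.inr k) => Real.sin θ * y a k
  | Sum.inr a, Sum.inl k => Real.sin θ * x a k
  | Sum.inr a, Sum.inr (Sum.inl k) => Real.cos θ * y a k
  | Sum.inr _, Sum.inr (Sum.inr _) => 0

/-- The derivative of `gPath`. -/
noncomputable def gPath' (x : A → κ₁ → ℝ) (y : A → κ₂ → ℝ) (θ : ℝ) :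
    A ⊕ A → κ₁ ⊕ (κ₂ ⊕ κ₂) → ℝ
  | Sum.inl _, Sum.inl _ => 0
  | Sum.inl a, Sum.inr (Sum.inl k) => -Real.sin θ * y a k
  | Sum.inl a, Sum.inr (Sum.inr k) => Real.cos θ * y a k
  | Sum.inr a, Sum.inl k => Real.cos θ * x a k
  | Sum.inr a, Sum.inr (Sum.inl k) => -Real.sin θ * y a k
  | Sum.inr _, Sum.inr (Sum.inr _) => 0

lemma hasDerivAt_gPath {A κ₁ κ₂ : Type*} (x : A → κ₁ → ℝ) (y : A → κ₂ → ℝ) (θ : ℝ) (a : A ⊕ A)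
    (k : κ₁ ⊕ (κ₂ ⊕ κ₂)) :
    HasDerivAt (fun θ => gPath x y θ a k) (gPath' x y θ a k) θ := by
  rcases a with a | a <;> rcases k with k | k | k <;> simp only [gPath, gPath']
  all_goals first
    | exact hasDerivAt_const _ _
    | exact (Real.hasDerivAt_cos θ).mul_const _
    | exact (Real.hasDerivAt_sin θ).mul_const _

/-- The Gram matrix of a family of coefficient vectors. -/
def gram {A κ : Type*} [Fintype κ] (x : A → κ → ℝ) (a b : A) : ℝ := ∑ k, x a k * x b k

/-- The left half is `cos θ Y + sin θ Y'` with independent copies, so its covariance does not depend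
on `θ` and this block contributes nothing. -/
lemma gPath_gram_ll (x : A → κ₁ → ℝ) (y : A → κ₂ → ℝ) (θ : ℝ) (a b : A) :
    ∑ k, gPath' x y θ (Sum.inl a) k * gPath x y θ (Sum.inl b) k = 0 := by
  simp only [Fintype.sum_sum_type, gPath, gPath', mul_zero, Finset.sum_const_zero, zero_add,
    ← Finset.sum_add_distrib]
  exact Finset.sum_eq_zero fun k _ => by ring

lemma gPath_gram_lr (x : A → κ₁ → ℝ) (y : A → κ₂ → ℝ) (θ : ℝ) (a b : A) :
    ∑ k, gPath' x y θ (Sum.inl a) k * gPath x y θ (Sum.inr b) k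
      = -(Real.sin θ * Real.cos θ * gram y a b) := by
  simp only [Fintype.sum_sum_type, gPath, gPath', zero_mul, mul_zero, Finset.sum_const_zero,
    zero_add, add_zero, gram, Finset.mul_sum, ← Finset.sum_neg_distrib]
  exact Finset.sum_congr rfl fun k _ => by ring

lemma gPath_gram_rl (x : A → κ₁ → ℝ) (y : A → κ₂ → ℝ) (θ : ℝ) (a b : A) :
    ∑ k, gPath' x y θ (Sum.inr a) k * gPath x y θ (Sum.inl b) k
      = -(Real.sin θ * Real.cos θ * gram y a b) := by
  simp only [Fintype.sum_sum_type, gPath, gPath', zero_mul, mul_zero, Finset.sum_const_zero,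
    zero_add, add_zero, gram, Finset.mul_sum, ← Finset.sum_neg_distrib]
  exact Finset.sum_congr rfl fun k _ => by ring

lemma gPath_gram_rr (x : A → κ₁ → ℝ) (y : A → κ₂ → ℝ) (θ : ℝ) (a b : A) :
    ∑ k, gPath' x y θ (Sum.inr a) k * gPath x y θ (Sum.inr b) k
      = Real.sin θ * Real.cos θ * (gram x a b - gram y a b) := by
  simp only [Fintype.sum_sum_type, gPath, gPath', mul_zero, Finset.sum_const_zero,
    add_zero, gram, mul_sub, Finset.mul_sum]
  rw [sub_eq_add_neg, ← Finset.sum_neg_distrib]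
  congr 1 <;> exact Finset.sum_congr rfl fun k _ => by ring

lemma abs_gPath_le [Fintype A] (x : A → κ₁ → ℝ) (y : A → κ₂ → ℝ) (θ : ℝ) (a : A ⊕ A)
    (k : κ₁ ⊕ (κ₂ ⊕ κ₂)) :
    |gPath x y θ a k| ≤ ∑ a, ∑ k, |x a k| + ∑ a, ∑ k, |y a k| ∧
    |gPath' x y θ a k| ≤ ∑ a, ∑ k, |x a k| + ∑ a, ∑ k, |y a k| := by
  have hx0 : 0 ≤ ∑ a, ∑ k, |x a k| := by positivity
  have hy0 : 0 ≤ ∑ a, ∑ k, |y a k| := by positivity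
  have hx : ∀ a k, |x a k| ≤ ∑ a, ∑ k, |x a k| := fun a k =>
    (Finset.single_le_sum (f := fun k => |x a k|) (fun i _ => abs_nonneg _)
      (Finset.mem_univ k)).trans (Finset.single_le_sum (f := fun a => ∑ k, |x a k|)
        (fun i _ => Finset.sum_nonneg fun _ _ => abs_nonneg _) (Finset.mem_univ a))
  have hy : ∀ a k, |y a k| ≤ ∑ a, ∑ k, |y a k| := fun a k =>
    (Finset.single_le_sum (f := fun k => |y a k|) (fun i _ => abs_nonneg _)
      (Finset.mem_univ k)).trans (Finset.single_le_sum (f := fun a => ∑ k, |y a k|)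
        (fun i _ => Finset.sum_nonneg fun _ _ => abs_nonneg _) (Finset.mem_univ a))
  have key : ∀ (c t S : ℝ), |c| ≤ 1 → |t| ≤ S → |c * t| ≤ S := fun c t S hc ht => by
    rw [abs_mul]
    exact (mul_le_of_le_one_left (abs_nonneg _) hc).trans ht
  have hs := Real.abs_sin_le_one θ
  have hs' : |-Real.sin θ| ≤ 1 := by rwa [abs_neg]
  have hc := Real.abs_cos_le_one θ
  rcases a with a | a <;> rcases k with k | k | k <;> simp only [gPath, gPath', abs_zero] <;>
    constructor <;> first
    | positivity
    | exact (key _ _ _ hs (hx _ _)).trans (by linarith)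
    | exact (key _ _ _ hs (hy _ _)).trans (by linarith)
    | exact (key _ _ _ hs' (hy _ _)).trans (by linarith)
    | exact (key _ _ _ hc (hx _ _)).trans (by linarith)
    | exact (key _ _ _ hc (hy _ _)).trans (by linarith)

end path

section mgf
variable {I J κ₁ κ₂ : Type*} [Fintype I] [Fintype J] [Nonempty I] [Nonempty J]
  [Fintype κ₁] [Fintype κ₂]

/-- The three sums are the cross blocks and the right block of the interpolation derivative. In the
right block, entries of one row vanish because the covariances agree there. Between different rows
the second derivative is `β` times a product of weights, and it enters with a negative sign against
`CX - CY ≥ 0`, so it may be dropped. What remains is quadratic in the weights, whose products sum to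
one. The cross blocks give `2 V`, the right block another `2 V`, with no trace of `β`. -/
lemma sum_gram_le [DecidableEq I] [DecidableEq J] {β lam V s : ℝ} (hβ : 0 ≤ β) (hl : 0 ≤ lam)
    (hs : 0 ≤ s) {CX CY : I × J → I × J → ℝ} (hX : ∀ a b, |CX a b| ≤ V)
    (hY : ∀ a b, |CY a b| ≤ V) (hrow : ∀ a b, a.1 = b.1 → CX a b = CY a b)
    (hdiff : ∀ a b, CY a b ≤ CX a b) (p q : I × J → ℝ) :
    (∑ a, ∑ b, -(s * CY a b) * (lam * smW β a p * -(lam * smW β b q))) +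
      (∑ a, ∑ b, -(s * CY a b) * (-(lam * smW β a q) * (lam * smW β b p))) +
      (∑ a, ∑ b, (s * (CX a b - CY a b)) *
        (-(lam * smW₂ β a b q) + -(lam * smW β a q) * -(lam * smW β b q)))
      ≤ 4 * V * lam ^ 2 * s := by
  have hprod : ∀ x y : I × J → ℝ, ∑ a, ∑ b, smW β a x * smW β b y = 1 := by
    intro x y
    rw [← Finset.sum_mul_sum, sum_smW, sum_smW, one_mul]
  have h1 : ∀ x y : I × J → ℝ,
      ∑ a, ∑ b, s * CY a b * lam ^ 2 * (smW β a x * smW β b y) ≤ s * V * lam ^ 2 := by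
    intro x y
    rw [← mul_one (s * V * lam ^ 2), ← hprod x y, Finset.mul_sum]
    refine Finset.sum_le_sum fun a _ => ?_
    rw [Finset.mul_sum]
    refine Finset.sum_le_sum fun b _ => ?_
    have := smW_nonneg β a x
    have := smW_nonneg β b y
    have := (abs_le.1 (hY a b)).2
    gcongr
  have h2 : ∑ a, ∑ b, (s * (CX a b - CY a b)) *
        (-(lam * smW₂ β a b q) + -(lam * smW β a q) * -(lam * smW β b q))
      ≤ s * (2 * V) * lam ^ 2 := by
    rw [← mul_one (s * (2 * V) * lam ^ 2), ← hprod q q, Finset.mul_sum]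
    refine Finset.sum_le_sum fun a _ => ?_
    rw [Finset.mul_sum]
    refine Finset.sum_le_sum fun b _ => ?_
    have ha := smW_nonneg β a q
    have hb := smW_nonneg β b q
    have hV : 0 ≤ V := (abs_nonneg _).trans (hX a b)
    have h3 := (abs_le.1 (hX a b)).2
    have h4 := (abs_le.1 (hY a b)).1
    by_cases hab : a.1 = b.1
    · rw [hrow a b hab, sub_self, mul_zero, zero_mul]
      positivity
    · have hd : 0 ≤ CX a b - CY a b := sub_nonneg.2 (hdiff a b)
      have e : smW₂ β a b q = β * (smW β a q * smW β b q) := by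
        rw [smW₂, if_neg hab]; ring
      have : -(lam * smW₂ β a b q) + -(lam * smW β a q) * -(lam * smW β b q)
          ≤ lam ^ 2 * (smW β a q * smW β b q) := by
        rw [e]
        have : 0 ≤ lam * (β * (smW β a q * smW β b q)) := by positivity
        nlinarith
      calc _ ≤ (s * (CX a b - CY a b)) * (lam ^ 2 * (smW β a q * smW β b q)) := by gcongr
        _ ≤ (s * (2 * V)) * (lam ^ 2 * (smW β a q * smW β b q)) := by
            gcongr; linarith
        _ = _ := by ring
  have e1 : (∑ a, ∑ b, -(s * CY a b) * (lam * smW β a p * -(lam * smW β b q)))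
      = ∑ a, ∑ b, s * CY a b * lam ^ 2 * (smW β a p * smW β b q) :=
    Finset.sum_congr rfl fun a _ => Finset.sum_congr rfl fun b _ => by ring
  have e2 : (∑ a, ∑ b, -(s * CY a b) * (-(lam * smW β a q) * (lam * smW β b p)))
      = ∑ a, ∑ b, s * CY a b * lam ^ 2 * (smW β a q * smW β b p) :=
    Finset.sum_congr rfl fun a _ => Finset.sum_congr rfl fun b _ => by ring
  rw [e1, e2]
  have := h1 p q
  have := h1 q p
  linarith

/-- Comparison of the exponential moments of soft min-max values of two Gaussian families. -/
theorem integral_expDiff_le {β lam V : ℝ} (hβ : 0 < β) (hl : 0 ≤ lam) {x : I × J → κ₁ → ℝ}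
    {y : I × J → κ₂ → ℝ} (d : I × J → ℝ) (hX : ∀ a b, |gram x a b| ≤ V)
    (hY : ∀ a b, |gram y a b| ≤ V) (hrow : ∀ a b, a.1 = b.1 → gram x a b = gram y a b)
    (hdiff : ∀ a b, gram y a b ≤ gram x a b) :
    ∫ z, expDiff β lam d (lin (gPath x y (Real.pi / 2)) z) ∂(stdG (κ₁ ⊕ (κ₂ ⊕ κ₂)))
      ≤ Real.exp (2 * V * lam ^ 2) := by
  classical
  set E : ℝ → ℝ := fun θ => ∫ z, expDiff β lam d (lin (gPath x y θ) z) ∂(stdG (κ₁ ⊕ (κ₂ ⊕ κ₂)))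
    with hE
  set K := Real.exp (lam * (2 * (∑ a, |d a| +
      β⁻¹ * (Real.log (Fintype.card I) + Real.log (Fintype.card J))))) with hK
  have g₀ : ∀ x, |expDiff β lam d x| ≤ K * Real.exp (lam * ∑ a, |x a|) := fun x => by
    rw [expDiff, Real.abs_exp]; exact expDiff_le hβ hl d x
  have hpos : ∀ x, 0 ≤ expDiff β lam d x := fun x => (Real.exp_pos _).le
  have hcE : Continuous (expDiff β lam d) :=
    continuous_iff_continuousAt.2 fun x => (hasFDerivAt_expDiff hβ.ne' d x).continuousAt
  have hcW : ∀ a, Continuous (edW β lam d a) := fun a =>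
    continuous_iff_continuousAt.2 fun x => (hasFDerivAt_edW d a x).continuousAt
  have hcS : ∀ i, Continuous fun x : I × J → ℝ => smR β x i := fun i =>
    continuous_iff_continuousAt.2 fun x => (hasFDerivAt_smR β i x).continuousAt
  have hcw : ∀ a : I × J, Continuous (smW β a) := fun a =>
    continuous_iff_continuousAt.2 fun x => (hasFDerivAt_smW β a x).continuousAt
  have hcw₂ : ∀ a b : I × J, Continuous (smW₂ β a b) := by
    intro a b
    unfold smW₂
    have := hcw a
    have := hcw b
    have := hcS b.1
    split_ifs <;> fun_prop
  have hcl : Continuous (lhalf d) := by unfold lhalf; fun_prop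
  have hcr : Continuous (rhalf d) := by unfold rhalf; fun_prop
  have hcW₂ : ∀ a b, Continuous (edW₂ β lam d a b) := by
    rintro (a | a) (b | b)
    · exact ((hcw₂ a b).comp hcl).const_mul lam
    · exact continuous_const
    · exact continuous_const
    · exact (((hcw₂ a b).comp hcr).const_mul lam).neg
  set C := (1 + lam + (lam * (4 * β) + lam * lam)) * K with hC
  have hK0 : 0 ≤ K := (Real.exp_pos _).le
  have hgen : ∀ (w : ℝ) (x : (I × J) ⊕ (I × J) → ℝ), |w| ≤ 1 + lam + (lam * (4 * β) + lam * lam) →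
      |w * expDiff β lam d x| ≤ C * Real.exp (lam * ∑ a, |x a|) := by
    intro w x hw
    rw [abs_mul, hC, mul_assoc]
    exact mul_le_mul hw (g₀ x) (abs_nonneg _) ((abs_nonneg _).trans hw)
  have g₂ : ∀ a b x, |(edW₂ β lam d a b x + edW β lam d a x * edW β lam d b x) *
      expDiff β lam d x| ≤ C * Real.exp (lam * ∑ a, |x a|) := by
    intro a b x
    refine hgen _ x ((abs_add_le _ _).trans ?_)
    have h1 := abs_edW₂_le hβ.le hl d a b x
    have h2 : |edW β lam d a x * edW β lam d b x| ≤ lam * lam := by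
      rw [abs_mul]
      exact mul_le_mul (abs_edW_le hl d a x) (abs_edW_le hl d b x) (abs_nonneg _) hl
    linarith
  have hm₂ : ∀ a b, Measurable fun x => (edW₂ β lam d a b x + edW β lam d a x * edW β lam d b x) *
      expDiff β lam d x := fun a b =>
    (((hcW₂ a b).add ((hcW a).mul (hcW b))).mul hcE).measurable
  set Bd := ∑ a, ∑ k, |x a k| + ∑ a, ∑ k, |y a k| with hBd
  have hder := fun θ => hasDerivAt_integral_lin (hasFDerivAt_expDiff hβ.ne' d)
    (hasFDerivAt_edW_mul_expDiff hβ.ne' d) hm₂ (by positivity : 0 ≤ C) hl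
    (fun x => by
      have := hgen 1 x (by rw [abs_one]; nlinarith [mul_nonneg hl hβ.le])
      rwa [one_mul] at this)
    (fun a x => hgen _ x ((abs_edW_le hl d a x).trans (by nlinarith [mul_nonneg hl hβ.le]))) g₂
    (hasDerivAt_gPath x y) (by positivity : 0 ≤ Bd) (fun θ a k => (abs_gPath_le x y θ a k).1)
    (fun θ a k => (abs_gPath_le x y θ a k).2) θ
  set E' : ℝ → ℝ := fun θ => ∑ a, ∑ b, (∑ k, gPath' x y θ a k * gPath x y θ b k) *
    ∫ z, (edW₂ β lam d a b (lin (gPath x y θ) z) +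
      edW β lam d a (lin (gPath x y θ) z) * edW β lam d b (lin (gPath x y θ) z)) *
      expDiff β lam d (lin (gPath x y θ) z) ∂(stdG (κ₁ ⊕ (κ₂ ⊕ κ₂))) with hE'
  have grow : ∀ (F : ((I × J) ⊕ (I × J) → ℝ) → ℝ) (C : ℝ), Measurable F → 0 ≤ C →
      (∀ x, |F x| ≤ C * Real.exp (lam * ∑ a, |x a|)) → ∀ θ,
      Integrable (fun z => F (lin (gPath x y θ) z)) (stdG (κ₁ ⊕ (κ₂ ⊕ κ₂))) := by
    intro F C hFm hC hF θ
    refine integrable_of_le_exp_sum (hFm.comp (measurable_lin _)) (C := C)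
      (c := lam * (Fintype.card ((I × J) ⊕ (I × J)) * Bd)) fun z => (hF _).trans ?_
    refine mul_le_mul_of_nonneg_left (Real.exp_le_exp.2 ?_) hC
    rw [mul_assoc]
    exact mul_le_mul_of_nonneg_left
      (sum_abs_lin_le (fun a k => (abs_gPath_le x y θ a k).1) z) hl
  have iE := grow _ K hcE.measurable hK0 g₀
  -- The pointwise bound `sum_gram_le`, integrated against the positive weight `expDiff`, is a
  -- Grönwall inequality.
  have hE'le : ∀ θ, 0 ≤ Real.sin θ * Real.cos θ →
      E' θ ≤ 4 * V * lam ^ 2 * (Real.sin θ * Real.cos θ) * E θ := by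
    intro θ hθ
    have i2 := fun a b => grow _ C (hm₂ a b) (by positivity) (g₂ a b) θ
    have e1 : E' θ = ∫ z, ∑ a, ∑ b, (∑ k, gPath' x y θ a k * gPath x y θ b k) *
        ((edW₂ β lam d a b (lin (gPath x y θ) z) +
      edW β lam d a (lin (gPath x y θ) z) * edW β lam d b (lin (gPath x y θ) z)) *
      expDiff β lam d (lin (gPath x y θ) z)) ∂(stdG (κ₁ ⊕ (κ₂ ⊕ κ₂))) := by
      rw [integral_finsetSum _ fun a _ => integrable_finsetSum _ fun b _ => (i2 a b).const_mul _]
      refine Finset.sum_congr rfl fun a _ => ?_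
      rw [integral_finsetSum _ fun b _ => (i2 a b).const_mul _]
      exact Finset.sum_congr rfl fun b _ => (integral_const_mul _ _).symm
    rw [e1, hE, ← integral_const_mul]
    refine integral_mono (integrable_finsetSum _ fun a _ => integrable_finsetSum _ fun b _ =>
      (i2 a b).const_mul _) ((iE θ).const_mul _) fun z => ?_
    have := sum_gram_le hβ.le hl hθ hX hY hrow hdiff (lhalf d (lin (gPath x y θ) z))
      (rhalf d (lin (gPath x y θ) z))
    refine le_trans (le_of_eq ?_) (mul_le_mul_of_nonneg_right this (hpos _))
    obtain ⟨D, hD⟩ : ∃ D : (I × J) ⊕ (I × J) → (I × J) ⊕ (I × J) → ℝ,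
        ∀ a b, D a b = ∑ k, gPath' x y θ a k * gPath x y θ b k := ⟨_, fun _ _ => rfl⟩
    have hll : ∀ a b, D (Sum.inl a) (Sum.inl b) = 0 := fun a b =>
      (hD _ _).trans (gPath_gram_ll x y θ a b)
    have hlr := fun a b => (hD _ _).trans (gPath_gram_lr x y θ a b)
    have hrl := fun a b => (hD _ _).trans (gPath_gram_rl x y θ a b)
    have hrr := fun a b => (hD _ _).trans (gPath_gram_rr x y θ a b)
    simp only [← hD, ← mul_assoc, ← Finset.sum_mul]
    congr 1
    simp only [Fintype.sum_sum_type, hll, hlr, hrl, hrr, edW, edW₂, zero_mul, zero_add,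
      Finset.sum_add_distrib, Finset.sum_const_zero, mul_assoc]
    ring
  -- Integrating factor: `4 V lam² sin θ cos θ` is the derivative of `2 V lam² sin² θ`.
  have hM : ∀ θ, HasDerivAt (fun θ => Real.exp (-(2 * V * lam ^ 2) * Real.sin θ ^ 2) * E θ)
      (Real.exp (-(2 * V * lam ^ 2) * Real.sin θ ^ 2) *
        (E' θ - 4 * V * lam ^ 2 * (Real.sin θ * Real.cos θ) * E θ)) θ := by
    intro θ
    have h1 := ((((Real.hasDerivAt_sin θ).pow 2).const_mul (-(2 * V * lam ^ 2))).exp).mul (hder θ)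
    refine h1.congr_deriv ?_
    simp only [hE', hE, Pi.pow_apply]
    push_cast
    ring
  have anti : AntitoneOn (fun θ => Real.exp (-(2 * V * lam ^ 2) * Real.sin θ ^ 2) * E θ)
      (Set.Icc 0 (Real.pi / 2)) := by
    refine antitoneOn_of_deriv_nonpos (convex_Icc _ _)
      (fun θ _ => (hM θ).continuousAt.continuousWithinAt)
      (fun θ _ => (hM θ).differentiableAt.differentiableWithinAt) fun θ hθ => ?_
    rw [interior_Icc] at hθ
    rw [(hM θ).deriv]
    have hs : 0 ≤ Real.sin θ := Real.sin_nonneg_of_nonneg_of_le_pi hθ.1.le (by linarith [hθ.2, hθ.1])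
    have hc : 0 ≤ Real.cos θ := Real.cos_nonneg_of_neg_pi_div_two_le_of_le
      (by linarith [hθ.1, hθ.2]) hθ.2.le
    have := hE'le θ (mul_nonneg hs hc)
    exact mul_nonpos_of_nonneg_of_nonpos (Real.exp_pos _).le (by linarith)
  have h0 := anti (Set.left_mem_Icc.2 (by positivity)) (Set.right_mem_Icc.2 (by positivity))
    (by positivity : (0 : ℝ) ≤ Real.pi / 2)
  -- At `θ = 0` both halves are the same family, so the difference in the exponent is zero.
  have hE0 : E 0 = 1 := by
    have : ∀ z, expDiff β lam d (lin (gPath x y 0) z) = 1 := by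
      intro z
      have : lhalf d (lin (gPath x y 0) z) = rhalf d (lin (gPath x y 0) z) := by
        ext a
        simp [lhalf, rhalf, lin, gPath, Fintype.sum_sum_type]
      rw [expDiff, this, sub_self, mul_zero, Real.exp_zero]
    simp [hE, this]
  simp only [Real.sin_pi_div_two, Real.sin_zero, hE0] at h0
  have h1 : Real.exp (-(2 * V * lam ^ 2)) * E (Real.pi / 2) ≤ 1 := by simpa using h0
  rw [Real.exp_neg, inv_mul_le_one₀ (Real.exp_pos _)] at h1
  exact h1

end mgf

/-! ### Gordon's comparison as a bound on a product of tail probabilities. -/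

/-- At `θ = π / 2` the left half of the path depends only on the last block and the right half only
on the first. The two tail events are then independent, and the middle block is free. -/
lemma stdG_sum_apply {κ₁ κ₂ : Type*} [Fintype κ₁] [Fintype κ₂] {S : Set (κ₂ → ℝ)}
    {T : Set (κ₁ → ℝ)} (hS : MeasurableSet S) (hT : MeasurableSet T) :
    stdG (κ₁ ⊕ (κ₂ ⊕ κ₂)) {z | (fun k => z (Sum.inr (Sum.inr k))) ∈ S ∧
      (fun k => z (Sum.inl k)) ∈ T} = stdG κ₂ S * stdG κ₁ T := by
  have mp1 := measurePreserving_sumPiEquivProdPi (ι := κ₁) (ι' := κ₂ ⊕ κ₂)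
    (fun _ => gaussianReal 0 1)
  have mp2 := measurePreserving_sumPiEquivProdPi (ι := κ₂) (ι' := κ₂)
    (fun _ => gaussianReal 0 1)
  have h2 : MeasurableSet ((MeasurableEquiv.sumPiEquivProdPi fun _ : κ₂ ⊕ κ₂ => ℝ) ⁻¹'
      (Set.univ ×ˢ S)) := (MeasurableSet.univ.prod hS).preimage (MeasurableEquiv.measurable _)
  have := mp1.measure_preimage (hT.prod h2).nullMeasurableSet
  rw [Measure.prod_prod, mp2.measure_preimage (MeasurableSet.univ.prod hS).nullMeasurableSet,
    Measure.prod_prod, measure_univ, one_mul, mul_comm] at this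
  rw [← this]
  congr 1
  ext z
  simp only [Set.mem_ofPred_eq, Set.mem_preimage, Set.mem_prod, Set.mem_univ, true_and]
  exact and_comm

lemma measurable_lin_apply {A ι : Type*} [Fintype ι] (M : A → ι → ℝ) (a : A) :
    Measurable fun z => lin M z a := by
  unfold lin; fun_prop

/-- Gordon's comparison of min-max values, as a bound on a product of tail probabilities, for
finite families. -/
lemma gordon_tail_finite {I J κ₁ κ₂ : Type*} [Fintype I] [Fintype J] [Nonempty I] [Nonempty J]
    [Fintype κ₁] [Fintype κ₂] {V : ℝ} (hV : 0 < V) {x : I × J → κ₁ → ℝ} {y : I × J → κ₂ → ℝ}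
    (d : I × J → ℝ) (hX : ∀ a b, |gram x a b| ≤ V)
    (hY : ∀ a b, |gram y a b| ≤ V) (hrow : ∀ a b, a.1 = b.1 → gram x a b = gram y a b)
    (hdiff : ∀ a b, gram y a b ≤ gram x a b) {a b : ℝ} (hab : b ≤ a) :
    stdG κ₂ {z | ∀ i, ∃ j, a ≤ lin y z (i, j) + d (i, j)} *
      stdG κ₁ {z | ∃ i, ∀ j, lin x z (i, j) + d (i, j) ≤ b}
      ≤ ENNReal.ofReal (Real.exp (-(a - b) ^ 2 / (8 * V))) := by
  set S := {z | ∀ i, ∃ j, a ≤ lin y z (i, j) + d (i, j)} with hSd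
  set T := {z | ∃ i, ∀ j, lin x z (i, j) + d (i, j) ≤ b} with hTd
  have hS : MeasurableSet S := by
    have : S = ⋂ i, ⋃ j, {z | a ≤ lin y z (i, j) + d (i, j)} := by ext; simp [hSd]
    rw [this]
    exact MeasurableSet.iInter fun i => MeasurableSet.iUnion fun j =>
      measurableSet_le measurable_const ((measurable_lin_apply y _).add_const _)
  have hT : MeasurableSet T := by
    have : T = ⋃ i, ⋂ j, {z | lin x z (i, j) + d (i, j) ≤ b} := by ext; simp [hTd]
    rw [this]
    exact MeasurableSet.iUnion fun i => MeasurableSet.iInter fun j =>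
      measurableSet_le ((measurable_lin_apply x _).add_const _) measurable_const
  rw [← stdG_sum_apply hS hT]
  set U : Set (κ₁ ⊕ (κ₂ ⊕ κ₂) → ℝ) := {z | (fun k => z (Sum.inr (Sum.inr k))) ∈ S ∧
      (fun k => z (Sum.inl k)) ∈ T} with hU
  -- This value minimises the exponent `-lam (a - b) + 2 V lam²`; the minimum is `-(a - b)² / (8
  -- V)`.
  set lam := (a - b) / (4 * V) with hlam
  have hl : 0 ≤ lam := div_nonneg (by linarith) (by positivity)
  set c := Real.log (Fintype.card I) + Real.log (Fintype.card J) with hc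
  have key : ∀ β : ℝ, 0 < β → (stdG (κ₁ ⊕ (κ₂ ⊕ κ₂))).real U ≤
      Real.exp (-(lam * (a - b - β⁻¹ * c)) + 2 * V * lam ^ 2) := by
    intro β hβ
    have h1 := integral_expDiff_le hβ hl d hX hY hrow hdiff
    have hint : Integrable (fun z => expDiff β lam d (lin (gPath x y (Real.pi / 2)) z))
        (stdG (κ₁ ⊕ (κ₂ ⊕ κ₂))) := by
      refine integrable_of_le_exp_sum (C := Real.exp (lam * (2 * (∑ a, |d a| +
        β⁻¹ * (Real.log (Fintype.card I) + Real.log (Fintype.card J))))))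
        (c := lam * (Fintype.card ((I × J) ⊕ (I × J)) *
          (∑ a, ∑ k, |x a k| + ∑ a, ∑ k, |y a k|)))
        ((continuous_iff_continuousAt.2 fun x =>
          (hasFDerivAt_expDiff hβ.ne' d x).continuousAt).measurable.comp (measurable_lin _))
        fun z => ?_
      refine (abs_of_nonneg (Real.exp_pos _).le).le.trans ?_
      refine (expDiff_le hβ hl d _).trans ?_
      refine mul_le_mul_of_nonneg_left (Real.exp_le_exp.2 ?_) (Real.exp_pos _).le
      rw [mul_assoc]
      exact mul_le_mul_of_nonneg_left
        (sum_abs_lin_le (fun a k => (abs_gPath_le x y _ a k).1) z) hl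
    have h2 := mul_meas_ge_le_integral_of_nonneg (μ := stdG (κ₁ ⊕ (κ₂ ⊕ κ₂)))
      (Filter.Eventually.of_forall fun z => (Real.exp_pos _).le) hint
      (Real.exp (lam * (a - b - β⁻¹ * c)))
    have hsub : U ⊆ {z | Real.exp (lam * (a - b - β⁻¹ * c)) ≤
        expDiff β lam d (lin (gPath x y (Real.pi / 2)) z)} := by
      rintro z ⟨hz1, hz2⟩
      have e1 : ∀ p, lhalf d (lin (gPath x y (Real.pi / 2)) z) p
          = lin y (fun k => z (Sum.inr (Sum.inr k))) p + d p := by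
        intro p; simp [lhalf, lin, gPath, Fintype.sum_sum_type]
      have e2 : ∀ p, rhalf d (lin (gPath x y (Real.pi / 2)) z) p
          = lin x (fun k => z (Sum.inl k)) p + d p := by
        intro p; simp [rhalf, lin, gPath, Fintype.sum_sum_type]
      have h3 := le_softMinMax hβ (x := lhalf d (lin (gPath x y (Real.pi / 2)) z)) (a := a)
        fun i => by simpa only [e1] using hz1 i
      have h4 := softMinMax_le hβ (x := rhalf d (lin (gPath x y (Real.pi / 2)) z)) (b := b)
        (by obtain ⟨i, hi⟩ := hz2; exact ⟨i, fun j => by rw [e2]; exact hi j⟩)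
      refine Real.exp_le_exp.2 (mul_le_mul_of_nonneg_left ?_ hl)
      rw [hc, mul_add]
      linarith
    have h3 : Real.exp (lam * (a - b - β⁻¹ * c)) * (stdG (κ₁ ⊕ (κ₂ ⊕ κ₂))).real U
        ≤ Real.exp (2 * V * lam ^ 2) :=
      (mul_le_mul_of_nonneg_left (measureReal_mono hsub) (Real.exp_pos _).le).trans (h2.trans h1)
    rw [Real.exp_add, Real.exp_neg, ← div_eq_inv_mul, le_div_iff₀ (Real.exp_pos _), mul_comm]
    exact h3
  -- The event does not depend on `β`, so `β → ∞` removes the logarithms of the cardinalities. This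
  -- is what makes the passage to infinite families possible.
  have lim : Filter.Tendsto (fun β : ℝ => Real.exp (-(lam * (a - b - β⁻¹ * c)) + 2 * V * lam ^ 2))
      Filter.atTop (nhds (Real.exp (-(lam * (a - b - 0 * c)) + 2 * V * lam ^ 2))) := by
    refine (Real.continuous_exp.tendsto _).comp (Filter.Tendsto.add_const _ ?_)
    exact (((tendsto_inv_atTop_zero.mul_const c).const_sub (a - b)).const_mul lam).neg
  have h5 := ge_of_tendsto lim (by
    filter_upwards [Filter.eventually_gt_atTop 0] with β hβ using key β hβ)
  have e : -(lam * (a - b - 0 * c)) + 2 * V * lam ^ 2 = -(a - b) ^ 2 / (8 * V) := by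
    rw [hlam]; field_simp; ring
  rw [e] at h5
  rw [← ofReal_measureReal]
  exact ENNReal.ofReal_le_ofReal h5

/-- Gordon's comparison of inf-sup values, as a bound on a product of tail probabilities, for
families indexed by two sequences. -/
theorem gordon_tail {κ₁ κ₂ : Type*} [Fintype κ₁] [Fintype κ₂] {V : ℝ} (hV : 0 < V)
    {x : ℕ × ℕ → κ₁ → ℝ} {y : ℕ × ℕ → κ₂ → ℝ}
    (d : ℕ × ℕ → ℝ) (hX : ∀ a b, |gram x a b| ≤ V)
    (hY : ∀ a b, |gram y a b| ≤ V) (hrow : ∀ a b, a.1 = b.1 → gram x a b = gram y a b)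
    (hdiff : ∀ a b, gram y a b ≤ gram x a b) {a b : ℝ} (hab : b ≤ a) :
    stdG κ₂ {z | ∀ i, ∃ j, a ≤ lin y z (i, j) + d (i, j)} *
      stdG κ₁ {z | ∃ i, ∀ j, lin x z (i, j) + d (i, j) ≤ b}
      ≤ ENNReal.ofReal (Real.exp (-(a - b) ^ 2 / (8 * V))) := by
  set ε := ENNReal.ofReal (Real.exp (-(a - b) ^ 2 / (8 * V)))
  have fin : ∀ N M : ℕ, stdG κ₂ {z | ∀ i ≤ N, ∃ j ≤ M, a ≤ lin y z (i, j) + d (i, j)} *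
      stdG κ₁ {z | ∃ i ≤ N, ∀ j ≤ M, lin x z (i, j) + d (i, j) ≤ b} ≤ ε := by
    intro N M
    let f : Fin (N + 1) × Fin (M + 1) → ℕ × ℕ := fun p => (p.1, p.2)
    have := gordon_tail_finite hV (x := fun p => x (f p)) (y := fun p => y (f p))
      (fun p => d (f p)) (fun a b => hX _ _) (fun a b => hY _ _)
      (fun a b h => hrow _ _ (congrArg Fin.val h)) (fun a b => hdiff _ _) hab
    refine le_trans (le_of_eq ?_) this
    congr 2
    · ext z
      constructor
      · intro h i
        obtain ⟨j, hj, h2⟩ := h i (Nat.lt_succ_iff.1 i.2)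
        exact ⟨⟨j, Nat.lt_succ_of_le hj⟩, h2⟩
      · intro h i hi
        obtain ⟨j, hj⟩ := h ⟨i, Nat.lt_succ_of_le hi⟩
        exact ⟨j, Nat.lt_succ_iff.1 j.2, hj⟩
    · ext z
      constructor
      · rintro ⟨i, hi, h⟩
        exact ⟨⟨i, Nat.lt_succ_of_le hi⟩, fun j => h j (Nat.lt_succ_iff.1 j.2)⟩
      · rintro ⟨i, h⟩
        exact ⟨i, Nat.lt_succ_iff.1 i.2, fun j hj => h ⟨j, Nat.lt_succ_of_le hj⟩⟩
  -- With the rows truncated at `N`, finitely many witnesses `j` are needed, so the first event is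
  -- covered by the increasing union over `M`. The limit in `N` follows for the second event.
  have step1 : ∀ N : ℕ, stdG κ₂ {z | ∀ i, ∃ j, a ≤ lin y z (i, j) + d (i, j)} *
      stdG κ₁ {z | ∃ i ≤ N, ∀ j, lin x z (i, j) + d (i, j) ≤ b} ≤ ε := by
    intro N
    have hsub : {z | ∀ i, ∃ j, a ≤ lin y z (i, j) + d (i, j)} ⊆
        ⋃ M : ℕ, {z | ∀ i ≤ N, ∃ j ≤ M, a ≤ lin y z (i, j) + d (i, j)} := by
      intro z hz
      choose j hj using hz
      refine Set.mem_iUnion.2 ⟨(Finset.range (N + 1)).sup j, fun i hi => ⟨j i, ?_, hj i⟩⟩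
      exact Finset.le_sup (f := j) (Finset.mem_range.2 (Nat.lt_succ_of_le hi))
    have hmono : Monotone fun M : ℕ =>
        {z : κ₂ → ℝ | ∀ i ≤ N, ∃ j ≤ M, a ≤ lin y z (i, j) + d (i, j)} := by
      intro M M' h z hz i hi
      obtain ⟨j, hj, h2⟩ := hz i hi
      exact ⟨j, hj.trans h, h2⟩
    refine (mul_le_mul_left (measure_mono hsub) _).trans ?_
    rw [hmono.measure_iUnion, ENNReal.iSup_mul]
    refine iSup_le fun M => le_trans ?_ (fin N M)
    refine mul_le_mul_right (measure_mono ?_) _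
    rintro z ⟨i, hi, h⟩
    exact ⟨i, hi, fun j _ => h j⟩
  have hsub : {z | ∃ i, ∀ j, lin x z (i, j) + d (i, j) ≤ b} ⊆
      ⋃ N : ℕ, {z | ∃ i ≤ N, ∀ j, lin x z (i, j) + d (i, j) ≤ b} := by
    rintro z ⟨i, hi⟩
    exact Set.mem_iUnion.2 ⟨i, i, le_rfl, hi⟩
  have hmono : Monotone fun N : ℕ =>
      {z : κ₁ → ℝ | ∃ i ≤ N, ∀ j, lin x z (i, j) + d (i, j) ≤ b} := by
    rintro N N' h z ⟨i, hi, h2⟩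
    exact ⟨i, hi.trans h, h2⟩
  refine (mul_le_mul_right (measure_mono hsub) _).trans ?_
  rw [hmono.measure_iUnion, ENNReal.mul_iSup]
  exact iSup_le step1

/-! ### The Euclidean norm and the Gaussian families of the bilinear form. -/

section l2
variable {ι : Type*} [Fintype ι]

lemma l2norm_nonneg (v : ι → ℝ) : 0 ≤ l2norm v := norm_nonneg _

lemma l2norm_sq (v : ι → ℝ) : l2norm v ^ 2 = ∑ i, v i ^ 2 := EuclideanSpace.real_norm_sq_eq _

lemma l2norm_sq_eq_dotProduct (v : ι → ℝ) : l2norm v ^ 2 = v ⬝ᵥ v := by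
  rw [l2norm_sq, dotProduct]; exact Finset.sum_congr rfl fun i _ => sq _

lemma l2norm_add_le (u v : ι → ℝ) : l2norm (u + v) ≤ l2norm u + l2norm v := norm_add_le _ _

lemma l2norm_sub_le (u v : ι → ℝ) : l2norm (u - v) ≤ l2norm u + l2norm v := norm_sub_le _ _

lemma l2norm_smul (c : ℝ) (v : ι → ℝ) : l2norm (c • v) = |c| * l2norm v := by
  rw [l2norm, WithLp.toLp_smul, norm_smul, Real.norm_eq_abs, l2norm]

lemma l2norm_neg (v : ι → ℝ) : l2norm (-v) = l2norm v := norm_neg (WithLp.toLp 2 v)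

lemma l2norm_sub_comm (u v : ι → ℝ) : l2norm (u - v) = l2norm (v - u) := norm_sub_rev _ _

lemma l2norm_zero : l2norm (0 : ι → ℝ) = 0 := norm_zero

lemma l2norm_eq_zero {v : ι → ℝ} : l2norm v = 0 ↔ v = 0 := by
  rw [l2norm, norm_eq_zero, WithLp.toLp_eq_zero]

lemma continuous_l2norm : Continuous (l2norm : (ι → ℝ) → ℝ) := by
  unfold l2norm
  exact continuous_norm.comp (PiLp.continuous_toLp 2 _)

lemma abs_dotProduct_le (u v : ι → ℝ) : |u ⬝ᵥ v| ≤ l2norm u * l2norm v := by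
  refine abs_le_of_sq_le_sq ?_ (mul_nonneg (l2norm_nonneg _) (l2norm_nonneg _))
  rw [mul_pow, l2norm_sq, l2norm_sq]
  exact Finset.sum_mul_sq_le_sq_mul_sq Finset.univ u v

lemma dotProduct_le_l2norm (u v : ι → ℝ) : u ⬝ᵥ v ≤ l2norm u * l2norm v :=
  (le_abs_self _).trans (abs_dotProduct_le u v)

lemma neg_l2norm_le_dotProduct (u v : ι → ℝ) : -(l2norm u * l2norm v) ≤ u ⬝ᵥ v :=
  (abs_le.1 (abs_dotProduct_le u v)).1

lemma abs_apply_le_l2norm (v : ι → ℝ) (i : ι) : |v i| ≤ l2norm v := by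
  refine abs_le_of_sq_le_sq ?_ (l2norm_nonneg _)
  rw [l2norm_sq]
  exact Finset.single_le_sum (f := fun i => v i ^ 2) (fun i _ => sq_nonneg _) (Finset.mem_univ i)

lemma exists_unit_dotProduct_eq [Nonempty ι] (v : ι → ℝ) :
    ∃ u : ι → ℝ, l2norm u = 1 ∧ u ⬝ᵥ v = l2norm v := by
  classical
  by_cases hv : v = 0
  · obtain ⟨i⟩ := ‹Nonempty ι›
    refine ⟨Pi.single i 1, ?_, by simp [hv, l2norm_zero]⟩
    have h := l2norm_sq_eq_dotProduct (Pi.single i (1 : ℝ))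
    simp only [single_dotProduct, Pi.single_eq_same, mul_one] at h
    exact (pow_eq_one_iff_of_nonneg (l2norm_nonneg _) two_ne_zero).1 h
  · have h0 : l2norm v ≠ 0 := fun h => hv (l2norm_eq_zero.1 h)
    refine ⟨(l2norm v)⁻¹ • v, ?_, ?_⟩
    · rw [l2norm_smul, abs_of_nonneg (inv_nonneg.2 (l2norm_nonneg _)), inv_mul_cancel₀ h0]
    · rw [smul_dotProduct, ← l2norm_sq_eq_dotProduct, smul_eq_mul]
      field_simp

end l2

section bilinear
variable {m n : ℕ}

/-- The norm `√(‖p‖² + τ²)` of the vector `(p, τ)`. -/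
noncomputable def extNorm (p : Fin n → ℝ) (τ : ℝ) : ℝ := l2norm (Sum.elim p fun _ : Unit => τ)

lemma extNorm_nonneg (p : Fin n → ℝ) (τ : ℝ) : 0 ≤ extNorm p τ := l2norm_nonneg _

lemma extNorm_sq (p : Fin n → ℝ) (τ : ℝ) : extNorm p τ ^ 2 = l2norm p ^ 2 + τ ^ 2 := by
  rw [extNorm, l2norm_sq, l2norm_sq]; simp

lemma extNorm_eq (p : Fin n → ℝ) (τ : ℝ) : extNorm p τ = √(τ ^ 2 + l2norm p ^ 2) := by
  rw [add_comm, ← extNorm_sq, Real.sqrt_sq (extNorm_nonneg _ _)]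

/-- Coefficients of `uᵀ A p + τ uᵀ z + ‖(p, τ)‖ γ`. -/
noncomputable def xv (p : Fin n → ℝ) (τ : ℝ) (u : Fin m → ℝ) :
    (Fin m × Fin n) ⊕ (Fin m ⊕ Unit) → ℝ
  | Sum.inl q => u q.1 * p q.2
  | Sum.inr (Sum.inl i) => τ * u i
  | Sum.inr (Sum.inr _) => extNorm p τ

/-- Coefficients of `‖(p, τ)‖ gᵀ u + hᵀ p + τ h₀`. -/
noncomputable def yv (p : Fin n → ℝ) (τ : ℝ) (u : Fin m → ℝ) : Fin m ⊕ (Fin n ⊕ Unit) → ℝ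
  | Sum.inl i => extNorm p τ * u i
  | Sum.inr (Sum.inl j) => p j
  | Sum.inr (Sum.inr _) => τ

lemma xv_gram (p p' : Fin n → ℝ) (τ τ' : ℝ) (u u' : Fin m → ℝ) :
    ∑ k, xv p τ u k * xv p' τ' u' k
      = (u ⬝ᵥ u') * (p ⬝ᵥ p' + τ * τ') + extNorm p τ * extNorm p' τ' := by
  simp only [Fintype.sum_sum_type, xv, Fintype.sum_prod_type, dotProduct, mul_add,
    Finset.univ_unique, Finset.sum_const, Finset.card_singleton, one_smul]
  rw [Finset.sum_mul_sum, Finset.sum_mul, ← add_assoc]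
  congr 2
  · exact Finset.sum_congr rfl fun i _ => Finset.sum_congr rfl fun j _ => by ring
  · exact Finset.sum_congr rfl fun i _ => by ring

lemma yv_gram (p p' : Fin n → ℝ) (τ τ' : ℝ) (u u' : Fin m → ℝ) :
    ∑ k, yv p τ u k * yv p' τ' u' k
      = extNorm p τ * extNorm p' τ' * (u ⬝ᵥ u') + (p ⬝ᵥ p' + τ * τ') := by
  simp only [Fintype.sum_sum_type, yv, dotProduct,
    Finset.univ_unique, Finset.sum_const, Finset.card_singleton, one_smul]
  rw [Finset.mul_sum]
  congr 1
  exact Finset.sum_congr rfl fun i _ => by ring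

lemma abs_ext_dot_le (p p' : Fin n → ℝ) (τ τ' : ℝ) :
    |p ⬝ᵥ p' + τ * τ'| ≤ extNorm p τ * extNorm p' τ' := by
  have := abs_dotProduct_le (Sum.elim p fun _ : Unit => τ) (Sum.elim p' fun _ : Unit => τ')
  simpa [dotProduct, extNorm] using this

/-- The difference of covariances is a product of two factors, both nonnegative for unit `u`, `u'`
by Cauchy–Schwarz. It vanishes when either the `(p, τ)` or the unit `u` agree, so rows may be
indexed by either variable. The term `extNorm * γ` in `xv` is there to produce this factorisation.
-/
lemma xv_yv_gram_sub (p p' : Fin n → ℝ) (τ τ' : ℝ) (u u' : Fin m → ℝ) :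
    ∑ k, xv p τ u k * xv p' τ' u' k - ∑ k, yv p τ u k * yv p' τ' u' k
      = (1 - u ⬝ᵥ u') * (extNorm p τ * extNorm p' τ' - (p ⬝ᵥ p' + τ * τ')) := by
  rw [xv_gram, yv_gram]; ring

lemma abs_dot_le_one {u u' : Fin m → ℝ} (hu : l2norm u = 1) (hu' : l2norm u' = 1) :
    |u ⬝ᵥ u'| ≤ 1 := by
  have := abs_dotProduct_le u u'
  rwa [hu, hu', one_mul] at this

lemma yv_gram_le_xv_gram (p p' : Fin n → ℝ) (τ τ' : ℝ) {u u' : Fin m → ℝ}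
    (hu : l2norm u = 1) (hu' : l2norm u' = 1) :
    ∑ k, yv p τ u k * yv p' τ' u' k ≤ ∑ k, xv p τ u k * xv p' τ' u' k := by
  rw [← sub_nonneg, xv_yv_gram_sub]
  exact mul_nonneg (by linarith [(abs_le.1 (abs_dot_le_one hu hu')).2])
    (by linarith [(abs_le.1 (abs_ext_dot_le p p' τ τ')).2])

lemma xv_gram_eq_of_left (p : Fin n → ℝ) (τ : ℝ) (u u' : Fin m → ℝ) :
    ∑ k, xv p τ u k * xv p τ u' k = ∑ k, yv p τ u k * yv p τ u' k := by
  have h := extNorm_sq p τ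
  rw [l2norm_sq_eq_dotProduct] at h
  rw [← sub_eq_zero, xv_yv_gram_sub, ← sq, h]
  ring

lemma xv_gram_eq_of_right (p p' : Fin n → ℝ) (τ τ' : ℝ) {u : Fin m → ℝ} (hu : l2norm u = 1) :
    ∑ k, xv p τ u k * xv p' τ' u k = ∑ k, yv p τ u k * yv p' τ' u k := by
  rw [← sub_eq_zero, xv_yv_gram_sub, ← l2norm_sq_eq_dotProduct, hu]
  ring

lemma abs_xv_gram_le {p p' : Fin n → ℝ} {τ τ' : ℝ} {u u' : Fin m → ℝ}
    (hu : l2norm u = 1) (hu' : l2norm u' = 1) {ρ : ℝ} (h : extNorm p τ ≤ ρ)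
    (h' : extNorm p' τ' ≤ ρ) :
    |∑ k, xv p τ u k * xv p' τ' u' k| ≤ 2 * ρ ^ 2 ∧
    |∑ k, yv p τ u k * yv p' τ' u' k| ≤ 2 * ρ ^ 2 := by
  have e0 : 0 ≤ extNorm p τ * extNorm p' τ' := mul_nonneg (extNorm_nonneg _ _) (extNorm_nonneg _ _)
  have e1 : extNorm p τ * extNorm p' τ' ≤ ρ ^ 2 := by
    rw [sq]; exact mul_le_mul h h' (extNorm_nonneg _ _) ((extNorm_nonneg _ _).trans h)
  have e2 := abs_ext_dot_le p p' τ τ'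
  have e3 := abs_dot_le_one hu hu'
  rw [xv_gram, yv_gram]
  constructor
  · refine (abs_add_le _ _).trans ?_
    rw [abs_mul, abs_of_nonneg e0]
    nlinarith [mul_le_mul e3 e2 (abs_nonneg _) zero_le_one]
  · refine (abs_add_le _ _).trans ?_
    rw [abs_mul, abs_of_nonneg e0]
    nlinarith [mul_le_mul_of_nonneg_left e3 e0]

/-- The bilinear form `uᵀ (A p + τ z)` plus the compensating term, as a linear form. -/
lemma sum_xv (p : Fin n → ℝ) (τ : ℝ) (u : Fin m → ℝ) (z : (Fin m × Fin n) ⊕ (Fin m ⊕ Unit) → ℝ) :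
    ∑ k, xv p τ u k * z k
      = u ⬝ᵥ ((Matrix.of fun i j => z (Sum.inl (i, j))) *ᵥ p
          + τ • fun i => z (Sum.inr (Sum.inl i))) + extNorm p τ * z (Sum.inr (Sum.inr ())) := by
  simp only [Fintype.sum_sum_type, xv, Fintype.sum_prod_type,
    Finset.univ_unique, Finset.sum_singleton, PUnit.default_eq_unit, dotProduct_add,
    dotProduct_smul, smul_eq_mul]
  rw [← add_assoc]
  congr 2
  · simp only [dotProduct, Matrix.mulVec, Finset.mul_sum, Matrix.of_apply]
    exact Finset.sum_congr rfl fun i _ => Finset.sum_congr rfl fun j _ => by ring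
  · simp only [dotProduct, Finset.mul_sum]
    exact Finset.sum_congr rfl fun i _ => by ring

lemma sum_yv (p : Fin n → ℝ) (τ : ℝ) (u : Fin m → ℝ) (z : Fin m ⊕ (Fin n ⊕ Unit) → ℝ) :
    ∑ k, yv p τ u k * z k
      = extNorm p τ * (u ⬝ᵥ fun i => z (Sum.inl i)) + ((p ⬝ᵥ fun j => z (Sum.inr (Sum.inl j)))
          + τ * z (Sum.inr (Sum.inr ()))) := by
  simp only [Fintype.sum_sum_type, yv,
    Finset.univ_unique, Finset.sum_singleton, PUnit.default_eq_unit]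
  congr 1
  simp only [dotProduct, Finset.mul_sum]
  exact Finset.sum_congr rfl fun i _ => by ring

end bilinear

/-! ### The laws of the data and of `(g, h, h₀)` as images of one Gaussian vector. -/

section laws

lemma measurePreserving_uncurry_gaussian (m n : ℕ) :
    MeasurePreserving (fun (A : Fin m → Fin n → ℝ) (q : Fin m × Fin n) => A q.1 q.2)
      (Measure.pi fun _ : Fin m => Measure.pi fun _ : Fin n => gaussianReal 0 1)
      (stdG (Fin m × Fin n)) := by
  have hm : Measurable (fun (A : Fin m → Fin n → ℝ) (q : Fin m × Fin n) => A q.1 q.2) := by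
    fun_prop
  refine ⟨hm, (Measure.pi_eq fun s hs => ?_).symm⟩
  rw [Measure.map_apply hm (MeasurableSet.univ_pi hs)]
  have : (fun (A : Fin m → Fin n → ℝ) (q : Fin m × Fin n) => A q.1 q.2) ⁻¹' (Set.univ.pi s)
      = Set.univ.pi fun i => Set.univ.pi fun j => s (i, j) := by
    ext A; simp
  rw [this, Measure.pi_pi, Fintype.prod_prod_type]
  exact Finset.prod_congr rfl fun i _ => Measure.pi_pi _ _

/-- The matrix, the noise vector and the compensating variable as functions of one standard
Gaussian vector. -/
noncomputable def dataMap (m n : ℕ) (σ : ℝ) (z : (Fin m × Fin n) ⊕ (Fin m ⊕ Unit) → ℝ) :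
    ((Fin m → Fin n → ℝ) × (Fin m → ℝ)) × ℝ :=
  ((fun i j => z (Sum.inl (i, j)), fun i => σ * z (Sum.inr (Sum.inl i))),
    z (Sum.inr (Sum.inr ())))

lemma measurePreserving_const_mul_gaussian (σ : ℝ) :
    MeasurePreserving (fun t => σ * t) (gaussianReal 0 1)
      (gaussianReal 0 (Real.toNNReal (σ ^ 2))) := by
  refine ⟨by fun_prop, ?_⟩
  rw [gaussianReal_map_const_mul]
  congr 1
  · simp
  · ext; simp [Real.coe_toNNReal _ (sq_nonneg σ)]

lemma measurePreserving_dataMap (m n : ℕ) (σ : ℝ) :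
    MeasurePreserving (dataMap m n σ) (stdG ((Fin m × Fin n) ⊕ (Fin m ⊕ Unit)))
      ((dataLaw m n σ).prod (gaussianReal 0 1)) := by
  have h1 := measurePreserving_sumPiEquivProdPi (ι := Fin m × Fin n) (ι' := Fin m ⊕ Unit)
    (fun _ => gaussianReal 0 1)
  have h2 := measurePreserving_sumPiEquivProdPi (ι := Fin m) (ι' := Unit)
    (fun _ => gaussianReal 0 1)
  have h3 := (MeasurePreserving.symm (e := MeasurableEquiv.curry (Fin m) (Fin n) ℝ |>.symm)
    (measurePreserving_uncurry_gaussian m n))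
  have h4 := measurePreserving_pi (fun _ : Fin m => gaussianReal 0 1)
    (fun _ : Fin m => gaussianReal 0 (Real.toNNReal (σ ^ 2)))
    (fun _ => measurePreserving_const_mul_gaussian σ)
  have h5 := measurePreserving_eval (fun _ : Unit => gaussianReal 0 1) ()
  exact (measurePreserving_prodAssoc _ _ _).symm.comp
    ((h3.prod ((h4.prod h5).comp h2)).comp h1)

/-- The joint law of `g`, `h` and one further standard normal variable. -/
noncomputable def ghzLaw (m n : ℕ) : Measure ((Fin m → ℝ) × (Fin n → ℝ) × ℝ) :=
  (stdG (Fin m)).prod ((stdG (Fin n)).prod (gaussianReal 0 1))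

/-- Splitting a standard Gaussian vector into three blocks. -/
def ghzMap (m n : ℕ) (z : Fin m ⊕ (Fin n ⊕ Unit) → ℝ) : (Fin m → ℝ) × (Fin n → ℝ) × ℝ :=
  (fun i => z (Sum.inl i), fun i => z (Sum.inr (Sum.inl i)), z (Sum.inr (Sum.inr ())))

lemma measurePreserving_ghzMap (m n : ℕ) :
    MeasurePreserving (ghzMap m n) (stdG (Fin m ⊕ (Fin n ⊕ Unit))) (ghzLaw m n) := by
  have h1 := measurePreserving_sumPiEquivProdPi (ι := Fin m) (ι' := Fin n ⊕ Unit)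
    (fun _ => gaussianReal 0 1)
  have h2 := measurePreserving_sumPiEquivProdPi (ι := Fin n) (ι' := Unit)
    (fun _ => gaussianReal 0 1)
  have h5 := measurePreserving_eval (fun _ : Unit => gaussianReal 0 1) ()
  exact ((MeasurePreserving.id _).prod (((MeasurePreserving.id _).prod h5).comp h2)).comp h1

end laws

/-- The compensating variable in `xv` is nonpositive with probability at least one half. On that
event the term can be dropped, at the price of a factor two in `gordon_data`. -/
lemma half_le_gaussian_Iic : (2 : ENNReal)⁻¹ ≤ gaussianReal 0 1 (Set.Iic 0) := by
  have h1 : gaussianReal 0 1 (Set.Ici 0) = gaussianReal 0 1 (Set.Iic 0) := by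
    have h := gaussianReal_map_neg (μ := 0) (v := 1)
    rw [neg_zero] at h
    conv_lhs => rw [← h]
    rw [Measure.map_apply measurable_neg measurableSet_Ici]
    congr 1
    ext x; simp
  have h2 : (1 : ENNReal) ≤ gaussianReal 0 1 (Set.Iic 0) + gaussianReal 0 1 (Set.Ici 0) := by
    rw [← measure_univ (μ := gaussianReal 0 1), ← Set.Iic_union_Ici (a := (0 : ℝ))]
    exact measure_union_le _ _
  rw [h1, ← two_mul] at h2
  rwa [ENNReal.inv_le_iff_le_mul (by simp) (by simp)]

/-! ### Tail bounds for the residual and separation of two sets. -/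

lemma measurableSet_forall_exists {Ω : Type*} [MeasurableSpace Ω] {p : ℕ → ℕ → Ω → Prop}
    (h : ∀ i j, MeasurableSet {ω | p i j ω}) : MeasurableSet {ω | ∀ i, ∃ j, p i j ω} := by
  have : {ω | ∀ i, ∃ j, p i j ω} = ⋂ i, ⋃ j, {ω | p i j ω} := by ext; simp
  rw [this]
  exact MeasurableSet.iInter fun i => MeasurableSet.iUnion fun j => h i j

lemma measurableSet_exists_forall {Ω : Type*} [MeasurableSpace Ω] {p : ℕ → ℕ → Ω → Prop}
    (h : ∀ i j, MeasurableSet {ω | p i j ω}) : MeasurableSet {ω | ∃ i, ∀ j, p i j ω} := by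
  have : {ω | ∃ i, ∀ j, p i j ω} = ⋃ i, ⋂ j, {ω | p i j ω} := by ext; simp
  rw [this]
  exact MeasurableSet.iUnion fun i => MeasurableSet.iInter fun j => h i j

/-- Gordon's comparison for the bilinear form `uᵀ (A p + s v)` of the data. -/
lemma gordon_data {m n : ℕ} {σ s ρ : ℝ} (hρ : 0 < ρ) {P : ℕ × ℕ → Fin n → ℝ}
    {U : ℕ × ℕ → Fin m → ℝ} (hU : ∀ q, l2norm (U q) = 1) (hP : ∀ q, extNorm (P q) (s * σ) ≤ ρ)
    (hrow : ∀ q q', q.1 = q'.1 → P q = P q' ∨ U q = U q') {a b : ℝ} (hab : b ≤ a) :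
    ghzLaw m n {t | ∀ i, ∃ j, a ≤ extNorm (P (i, j)) (s * σ) * (U (i, j) ⬝ᵥ t.1) +
        (P (i, j) ⬝ᵥ t.2.1 + s * σ * t.2.2)} *
      dataLaw m n σ {Av | ∃ i, ∀ j, U (i, j) ⬝ᵥ (Matrix.of Av.1 *ᵥ P (i, j) + s • Av.2) ≤ b}
      ≤ 2 * ENNReal.ofReal (Real.exp (-(a - b) ^ 2 / (16 * ρ ^ 2))) := by
  set EY : Set ((Fin m → ℝ) × (Fin n → ℝ) × ℝ) :=
    {t | ∀ i, ∃ j, a ≤ extNorm (P (i, j)) (s * σ) * (U (i, j) ⬝ᵥ t.1) +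
        (P (i, j) ⬝ᵥ t.2.1 + s * σ * t.2.2)} with hEY
  set EX : Set ((Fin m → Fin n → ℝ) × (Fin m → ℝ)) :=
    {Av | ∃ i, ∀ j, U (i, j) ⬝ᵥ (Matrix.of Av.1 *ᵥ P (i, j) + s • Av.2) ≤ b} with hEX
  have mY : MeasurableSet EY := by
    refine measurableSet_forall_exists fun i j => measurableSet_le measurable_const ?_
    unfold dotProduct
    fun_prop
  have mX : MeasurableSet EX := by
    refine measurableSet_exists_forall fun i j => measurableSet_le ?_ measurable_const
    simp only [dotProduct, Matrix.mulVec, Pi.add_apply, Matrix.of_apply, Pi.smul_apply]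
    fun_prop
  have key := gordon_tail (V := 2 * ρ ^ 2) (by positivity)
    (x := fun q => xv (P q) (s * σ) (U q)) (y := fun q => yv (P q) (s * σ) (U q)) (fun _ => 0)
    (fun q q' => (abs_xv_gram_le (hU q) (hU q') (hP q) (hP q')).1)
    (fun q q' => (abs_xv_gram_le (hU q) (hU q') (hP q) (hP q')).2)
    (fun q q' h => by
      rcases hrow q q' h with h | h
      · simp only [gram, h]; exact xv_gram_eq_of_left _ _ _ _
      · simp only [gram, h]; exact xv_gram_eq_of_right _ _ _ _ (hU q'))
    (fun q q' => yv_gram_le_xv_gram _ _ _ _ (hU q) (hU q')) hab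
  have hY : ghzLaw m n EY = stdG (Fin m ⊕ (Fin n ⊕ Unit))
      {z | ∀ i, ∃ j, a ≤ lin (fun q => yv (P q) (s * σ) (U q)) z (i, j) + 0} := by
    rw [← (measurePreserving_ghzMap m n).measure_preimage mY.nullMeasurableSet]
    congr 1
    ext z
    refine forall_congr' fun i => exists_congr fun j => ?_
    rw [lin, sum_yv, add_zero]
    rfl
  -- The compensating variable is independent of the data, and its coefficient `extNorm` is
  -- nonnegative.
  have hX : dataLaw m n σ EX * 2⁻¹ ≤ stdG ((Fin m × Fin n) ⊕ (Fin m ⊕ Unit))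
      {z | ∃ i, ∀ j, lin (fun q => xv (P q) (s * σ) (U q)) z (i, j) + 0 ≤ b} := by
    calc dataLaw m n σ EX * 2⁻¹ ≤ dataLaw m n σ EX * gaussianReal 0 1 (Set.Iic 0) := by
          gcongr; exact half_le_gaussian_Iic
      _ = ((dataLaw m n σ).prod (gaussianReal 0 1)) (EX ×ˢ Set.Iic 0) :=
          (Measure.prod_prod _ _).symm
      _ = stdG ((Fin m × Fin n) ⊕ (Fin m ⊕ Unit)) (dataMap m n σ ⁻¹' (EX ×ˢ Set.Iic 0)) :=
          ((measurePreserving_dataMap m n σ).measure_preimage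
            (mX.prod measurableSet_Iic).nullMeasurableSet).symm
      _ ≤ _ := by
          refine measure_mono ?_
          rintro z ⟨⟨i, hi⟩, hz⟩
          refine ⟨i, fun j => ?_⟩
          rw [lin, sum_xv, add_zero]
          have h1 := hi j
          have h2 : extNorm (P (i, j)) (s * σ) * z (Sum.inr (Sum.inr ())) ≤ 0 :=
            mul_nonpos_of_nonneg_of_nonpos (extNorm_nonneg _ _) hz
          have h3 : (s * σ) • (fun i => z (Sum.inr (Sum.inl i)))
              = s • (dataMap m n σ z).1.2 := by
            ext i; simp [dataMap, mul_assoc]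
          rw [h3]
          exact (add_le_add h1 h2).trans (by linarith)
  have e : (8 * (2 * ρ ^ 2)) = 16 * ρ ^ 2 := by ring
  rw [e] at key
  rw [hY]
  calc _ = 2 * (stdG (Fin m ⊕ (Fin n ⊕ Unit))
      {z | ∀ i, ∃ j, a ≤ lin (fun q => yv (P q) (s * σ) (U q)) z (i, j) + 0} *
      (dataLaw m n σ EX * 2⁻¹)) := by
        rw [mul_comm (dataLaw m n σ EX), ← mul_assoc, ← mul_assoc, mul_comm (2 : ENNReal),
          mul_assoc _ (2 : ENNReal), ENNReal.mul_inv_cancel (by simp) (by simp), mul_one]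
    _ ≤ _ := by
        gcongr
        exact (mul_le_mul_right hX _).trans key

/-- The objective of the auxiliary problem, at the sample `t = (g, h, h₀)`. -/
noncomputable def auxVal {m n : ℕ} (σ : ℝ) (w : Fin n → ℝ)
    (t : (Fin m → ℝ) × (Fin n → ℝ) × ℝ) : ℝ :=
  √(σ ^ 2 + l2norm w ^ 2) * l2norm t.1 + w ⬝ᵥ t.2.1 - σ * t.2.2

lemma continuous_auxVal {m n : ℕ} (σ : ℝ) (t : (Fin m → ℝ) × (Fin n → ℝ) × ℝ) :
    Continuous fun w : Fin n → ℝ => auxVal σ w t := by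
  have := continuous_l2norm (ι := Fin n)
  unfold auxVal dotProduct
  fun_prop

/-- `gordon_tail` compares families indexed by sequences. Strict inequalities between continuous
functions define open sets, so they pass from a set to a dense sequence in it. -/
lemma exists_dense_seq {α : Type*} [TopologicalSpace α] [SecondCountableTopology α] {S : Set α}
    (hS : S.Nonempty) :
    ∃ w : ℕ → α, (∀ i, w i ∈ S) ∧ ∀ O : Set α, IsOpen O → (S ∩ O).Nonempty → ∃ i, w i ∈ O := by
  have : Nonempty S := hS.to_subtype
  refine ⟨fun i => TopologicalSpace.denseSeq S i, fun i => Subtype.coe_prop _, ?_⟩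
  rintro O hO ⟨x, hxS, hxO⟩
  obtain ⟨i, hi⟩ := (TopologicalSpace.denseRange_denseSeq S).exists_mem_open
    (hO.preimage continuous_subtype_val) ⟨⟨x, hxS⟩, hxO⟩
  exact ⟨i, hi⟩

lemma exists_dense_sphere (m : ℕ) [NeZero m] :
    ∃ u : ℕ → Fin m → ℝ, (∀ i, l2norm (u i) = 1) ∧
      ∀ O : Set (Fin m → ℝ), IsOpen O → (∃ x ∈ O, l2norm x = 1) → ∃ i, u i ∈ O := by
  obtain ⟨u, hu, h⟩ := exists_dense_seq (S := {u : Fin m → ℝ | l2norm u = 1})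
    (by obtain ⟨u, hu, _⟩ := exists_unit_dotProduct_eq (0 : Fin m → ℝ); exact ⟨u, hu⟩)
  exact ⟨u, hu, fun O hO ⟨x, hx, hx1⟩ => h O hO ⟨x, hx1, hx⟩⟩

lemma extNorm_le {n : ℕ} {σ R : ℝ} {w : Fin n → ℝ} (hw : l2norm w ≤ R) {s : ℝ} (hs : s ^ 2 = 1) :
    extNorm w (s * σ) ≤ √(σ ^ 2 + R ^ 2) := by
  rw [extNorm_eq, mul_pow, hs, one_mul]
  have := l2norm_nonneg w
  gcongr

/-- A lower tail bound for the minimal residual over a set. -/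
lemma residual_lower_tail {m n : ℕ} [NeZero m] {σ R : ℝ} (hσ : 0 < σ) {S : Set (Fin n → ℝ)}
    (hR : ∀ w ∈ S, l2norm w ≤ R) {a b c : ℝ} (hab : b ≤ a) (hac : a < c) :
    ghzLaw m n {t | ∀ w ∈ S, c ≤ auxVal σ w t} *
      dataLaw m n σ {Av | ∃ w ∈ S, l2norm (Av.2 - Matrix.of Av.1 *ᵥ w) < b}
      ≤ 2 * ENNReal.ofReal (Real.exp (-(a - b) ^ 2 / (16 * (σ ^ 2 + R ^ 2)))) := by
  rcases S.eq_empty_or_nonempty with rfl | hS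
  · simp
  obtain ⟨w, hwS, hw⟩ := exists_dense_seq hS
  obtain ⟨u, hu1, hu⟩ := exists_dense_sphere m
  -- Rows are the vectors `w` and columns the unit vectors `u`: the maximum of `uᵀ(A w - v)` over
  -- `u` is the residual.
  have key := gordon_data (σ := σ) (s := -1) (ρ := √(σ ^ 2 + R ^ 2)) (by positivity)
    (P := fun q : ℕ × ℕ => w q.1) (U := fun q => u q.2) (fun q => hu1 _)
    (fun q => extNorm_le (hR _ (hwS _)) (by norm_num))
    (fun q q' h => Or.inl (by rw [h])) hab
  rw [Real.sq_sqrt (by positivity)] at key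
  refine le_trans (mul_le_mul' (measure_mono ?_) (measure_mono ?_)) key
  · intro t ht i
    have h1 := ht _ (hwS i)
    obtain ⟨x, hx1, hx⟩ := exists_unit_dotProduct_eq t.1
    have hop : IsOpen {x : Fin m → ℝ | a < extNorm (w i) (-1 * σ) * (x ⬝ᵥ t.1) +
        (w i ⬝ᵥ t.2.1 + -1 * σ * t.2.2)} := by
      refine isOpen_lt continuous_const ?_
      unfold dotProduct
      fun_prop
    obtain ⟨j, hj⟩ := hu _ hop ⟨x, by
      have e : extNorm (w i) (-1 * σ) = √(σ ^ 2 + l2norm (w i) ^ 2) := by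
        rw [extNorm_eq]; congr 2; ring
      change a < _
      rw [hx, e]
      rw [auxVal] at h1
      linarith, hx1⟩
    exact ⟨j, le_of_lt hj⟩
  · rintro Av ⟨x, hxS, hx⟩
    have hop : IsOpen {x : Fin n → ℝ | l2norm (Av.2 - Matrix.of Av.1 *ᵥ x) < b} := by
      refine isOpen_lt (continuous_l2norm.comp ?_) continuous_const
      exact continuous_const.sub (continuous_const.matrix_mulVec continuous_id)
    obtain ⟨i, hi⟩ := hw _ hop ⟨x, hxS, hx⟩
    refine ⟨i, fun j => ?_⟩
    have h1 : l2norm (Av.2 - Matrix.of Av.1 *ᵥ w i) < b := hi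
    have h2 := dotProduct_le_l2norm (u j) (Matrix.of Av.1 *ᵥ w i + (-1 : ℝ) • Av.2)
    rw [hu1, one_mul, neg_one_smul, ← sub_eq_add_neg, l2norm_sub_comm] at h2
    rw [neg_one_smul, ← sub_eq_add_neg]
    linarith

/-- One direction `u` serves every `w ∈ B`: take `u = -r / ‖r‖` for the smallest residual `r`.
First-order optimality over the convex set gives `rᵀ(v - A w) ≥ ‖r‖²`. This is the exchange of min
and max, and it is why the upper tail bound needs convexity and compactness while the lower one does
not. -/
lemma exists_unit_of_residual_ge {m n : ℕ} {A : Matrix (Fin m) (Fin n) ℝ} {v : Fin m → ℝ}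
    {B : Set (Fin n → ℝ)} (hne : B.Nonempty) (hconv : Convex ℝ B) (hcomp : IsCompact B) {b : ℝ}
    (hb : 0 < b) (h : ∀ w ∈ B, b ≤ l2norm (v - A *ᵥ w)) :
    ∃ u : Fin m → ℝ, l2norm u = 1 ∧ ∀ w ∈ B, u ⬝ᵥ (v - A *ᵥ w) ≤ -b := by
  have hc : Continuous fun w : Fin n → ℝ => l2norm (v - A *ᵥ w) :=
    continuous_l2norm.comp (continuous_const.sub (continuous_const.matrix_mulVec continuous_id))
  obtain ⟨w₀, hw₀, hmin⟩ := hcomp.exists_isMinOn hne hc.continuousOn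
  set r := v - A *ᵥ w₀ with hr
  have hr0 : b ≤ l2norm r := h w₀ hw₀
  have hrpos : 0 < l2norm r := hb.trans_le hr0
  have hob : ∀ w ∈ B, 0 ≤ r ⬝ᵥ (A *ᵥ w₀ - A *ᵥ w) := by
    intro w hw
    by_contra hneg
    push Not at hneg
    set q := A *ᵥ w₀ - A *ᵥ w with hq
    have hquad : ∀ t : ℝ, 0 < t → t ≤ 1 → 0 ≤ 2 * (r ⬝ᵥ q) + t * l2norm q ^ 2 := by
      intro t ht ht1
      have hmem : (1 - t) • w₀ + t • w ∈ B := hconv hw₀ hw (by linarith) ht.le (by ring)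
      have h1 : l2norm r ≤ l2norm (v - A *ᵥ ((1 - t) • w₀ + t • w)) := hmin hmem
      have e : v - A *ᵥ ((1 - t) • w₀ + t • w) = r + t • q := by
        rw [Matrix.mulVec_add, Matrix.mulVec_smul, Matrix.mulVec_smul, hr, hq]
        ext i
        simp only [Pi.sub_apply, Pi.add_apply, Pi.smul_apply, smul_eq_mul]
        ring
      rw [e] at h1
      have h2 := pow_le_pow_left₀ (l2norm_nonneg _) h1 2
      rw [l2norm_sq_eq_dotProduct, l2norm_sq_eq_dotProduct, add_dotProduct, dotProduct_add,
        dotProduct_add, smul_dotProduct, dotProduct_smul, smul_dotProduct, dotProduct_smul,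
        dotProduct_comm q r] at h2
      simp only [smul_eq_mul] at h2
      rw [l2norm_sq_eq_dotProduct]
      have h3 : 0 ≤ t * (2 * (r ⬝ᵥ q) + t * (q ⬝ᵥ q)) := by linarith
      exact nonneg_of_mul_nonneg_right h3 ht
    have hq0 := sq_nonneg (l2norm q)
    -- A step short enough that the quadratic term is at most half of the assumed decrease of the
    -- linear term.
    have h1 := hquad (min 1 (-(r ⬝ᵥ q) / (l2norm q ^ 2 + 1)))
      (lt_min one_pos (div_pos (by linarith) (by positivity))) (min_le_left _ _)
    have h2 : min 1 (-(r ⬝ᵥ q) / (l2norm q ^ 2 + 1)) * l2norm q ^ 2 ≤ -(r ⬝ᵥ q) := by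
      calc _ ≤ (-(r ⬝ᵥ q) / (l2norm q ^ 2 + 1)) * l2norm q ^ 2 := by
            gcongr; exact min_le_right _ _
        _ ≤ _ := by
            rw [div_mul_eq_mul_div, div_le_iff₀ (by positivity)]
            nlinarith
    linarith
  refine ⟨-(l2norm r)⁻¹ • r, ?_, fun w hw => ?_⟩
  · rw [l2norm_smul, abs_neg, abs_of_nonneg (inv_nonneg.2 hrpos.le), inv_mul_cancel₀ hrpos.ne']
  · have e : v - A *ᵥ w = r + (A *ᵥ w₀ - A *ᵥ w) := by rw [hr]; abel
    rw [e, smul_dotProduct, dotProduct_add, ← l2norm_sq_eq_dotProduct, smul_eq_mul]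
    have h1 := hob w hw
    have h2 : 0 ≤ (l2norm r)⁻¹ * (r ⬝ᵥ (A *ᵥ w₀ - A *ᵥ w)) :=
      mul_nonneg (inv_nonneg.2 hrpos.le) h1
    have h3 : (l2norm r)⁻¹ * l2norm r ^ 2 = l2norm r := by field_simp
    linarith

/-- An upper tail bound for the minimal residual over a compact convex set. -/
lemma residual_upper_tail {m n : ℕ} [NeZero m] {σ R : ℝ} (hσ : 0 < σ) {B : Set (Fin n → ℝ)}
    (hconv : Convex ℝ B) (hcomp : IsCompact B)
    (hR : ∀ w ∈ B, l2norm w ≤ R) {a b c : ℝ} (ha : 0 ≤ a) (hab : a ≤ b) (hbc : b < c) :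
    ghzLaw m n {t | ∃ w ∈ B, auxVal σ w t < a} *
      dataLaw m n σ {Av | ∀ w ∈ B, c ≤ l2norm (Av.2 - Matrix.of Av.1 *ᵥ w)}
      ≤ 2 * ENNReal.ofReal (Real.exp (-(b - a) ^ 2 / (16 * (σ ^ 2 + R ^ 2)))) := by
  rcases B.eq_empty_or_nonempty with rfl | hB
  · simp
  obtain ⟨w, hwS, hw⟩ := exists_dense_seq hB
  obtain ⟨u, hu1, hu⟩ := exists_dense_sphere m
  -- Here the roles are exchanged: rows are the unit vectors, columns the vectors `-w`, and the
  -- levels change sign. The term `σ h₀` also changes sign, so the same function `auxVal` appears as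
  -- in the lower tail bound.
  have key := gordon_data (σ := σ) (s := 1) (ρ := √(σ ^ 2 + R ^ 2)) (by positivity)
    (P := fun q : ℕ × ℕ => -w q.2) (U := fun q => u q.1) (fun q => hu1 _)
    (fun q => extNorm_le (by rw [l2norm_neg]; exact hR _ (hwS _)) (by norm_num))
    (fun q q' h => Or.inr (by rw [h])) (neg_le_neg hab)
  rw [Real.sq_sqrt (by positivity), neg_sub_neg] at key
  refine le_trans (mul_le_mul' (measure_mono ?_) (measure_mono ?_)) key
  · rintro t ⟨x, hxB, hx⟩ i
    obtain ⟨j, hj⟩ := hw _ (isOpen_lt (continuous_auxVal σ t) continuous_const) ⟨x, hxB, hx⟩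
    refine ⟨j, ?_⟩
    have hj' : auxVal σ (w j) t < a := hj
    rw [auxVal] at hj'
    have e : extNorm (-w j) (1 * σ) = √(σ ^ 2 + l2norm (w j) ^ 2) := by
      rw [extNorm_eq, l2norm_neg, one_mul]
    have h1 := neg_l2norm_le_dotProduct (u i) t.1
    rw [hu1, one_mul] at h1
    have h2 := mul_le_mul_of_nonneg_left h1 (Real.sqrt_nonneg (σ ^ 2 + l2norm (w j) ^ 2))
    simp only [e, neg_dotProduct]
    linarith
  · intro Av hAv
    obtain ⟨x, hx1, hx⟩ := exists_unit_of_residual_ge hB hconv hcomp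
      (by linarith : (0 : ℝ) < c) hAv
    have hc : Continuous fun w : Fin n → ℝ => l2norm (Av.2 - Matrix.of Av.1 *ᵥ w) :=
      continuous_l2norm.comp (continuous_const.sub (continuous_const.matrix_mulVec continuous_id))
    obtain ⟨K, hK⟩ := (hcomp.image hc).bddAbove
    -- Residuals on the compact set are bounded by `|K|`, so a unit vector this close to `x` changes
    -- every inner product by less than `c - b`.
    have hop : IsOpen {y : Fin m → ℝ | l2norm (y - x) * |K| < c - b} := by
      refine isOpen_lt ?_ continuous_const
      exact (continuous_l2norm.comp (continuous_id.sub continuous_const)).mul continuous_const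
    obtain ⟨i, hi⟩ := hu _ hop ⟨x, by
      change l2norm (x - x) * |K| < c - b
      rw [sub_self, l2norm_zero, zero_mul]; linarith, hx1⟩
    have hi' : l2norm (u i - x) * |K| < c - b := hi
    refine ⟨i, fun j => ?_⟩
    have e : Matrix.of Av.1 *ᵥ (-w j) + (1 : ℝ) • Av.2 = Av.2 - Matrix.of Av.1 *ᵥ w j := by
      rw [Matrix.mulVec_neg, one_smul]; abel
    have h1 := hx _ (hwS j)
    have h2 := dotProduct_le_l2norm (u i - x) (Av.2 - Matrix.of Av.1 *ᵥ w j)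
    have h3 : l2norm (Av.2 - Matrix.of Av.1 *ᵥ w j) ≤ |K| :=
      (hK ⟨_, hwS j, rfl⟩).trans (le_abs_self K)
    have h4 := mul_le_mul_of_nonneg_left h3 (l2norm_nonneg (u i - x))
    rw [sub_dotProduct] at h2
    simp only [e]
    linarith

/-- If the auxiliary problem is likely to separate `S` from `B` at the levels `b₁ < b₂`, then the
residual is unlikely to be as small on `S` as on `B`. -/
theorem two_set_separation {m n : ℕ} [NeZero m] {σ R : ℝ} (hσ : 0 < σ) {B S : Set (Fin n → ℝ)}
    (hconv : Convex ℝ B) (hcomp : IsCompact B)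
    (hBR : ∀ w ∈ B, l2norm w ≤ R) (hSR : ∀ w ∈ S, l2norm w ≤ R) {b₁ b₂ : ℝ} (h0 : 0 ≤ b₁)
    (h12 : b₁ < b₂) (hB : (4 : ENNReal)⁻¹ ≤ ghzLaw m n {t | ∃ w ∈ B, auxVal σ w t < b₁})
    (hS : (4 : ENNReal)⁻¹ ≤ ghzLaw m n {t | ∀ w ∈ S, b₂ ≤ auxVal σ w t}) :
    dataLaw m n σ {Av | ∃ w ∈ S, ∀ w' ∈ B,
        l2norm (Av.2 - Matrix.of Av.1 *ᵥ w) ≤ l2norm (Av.2 - Matrix.of Av.1 *ᵥ w')}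
      ≤ ENNReal.ofReal (16 * Real.exp (-(b₂ - b₁) ^ 2 / (256 * (σ ^ 2 + R ^ 2)))) := by
  -- Both residuals are compared with the midpoint `b₁ + Δ / 2`. Each comparison uses a gap `Δ / 4`,
  -- hence the denominator `256 = 16 * 4²`. Dividing by a probability of at least `1 / 4` makes each
  -- prefactor `8`.
  set Δ := b₂ - b₁ with hΔ
  have hΔ0 : 0 < Δ := by linarith
  have h1 := residual_upper_tail (m := m) hσ hconv hcomp hBR (a := b₁) (b := b₁ + Δ / 4)
    (c := b₁ + Δ / 2) h0 (by linarith) (by linarith)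
  have h2 := residual_lower_tail (m := m) hσ hSR (a := b₁ + 3 / 4 * Δ) (b := b₁ + Δ / 2)
    (c := b₂) (by linarith) (by linarith)
  have e1 : -(b₁ + Δ / 4 - b₁) ^ 2 / (16 * (σ ^ 2 + R ^ 2)) = -Δ ^ 2 / (256 * (σ ^ 2 + R ^ 2)) := by
    field_simp; ring
  have e2 : -(b₁ + 3 / 4 * Δ - (b₁ + Δ / 2)) ^ 2 / (16 * (σ ^ 2 + R ^ 2))
      = -Δ ^ 2 / (256 * (σ ^ 2 + R ^ 2)) := by
    field_simp; ring
  rw [e1] at h1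
  rw [e2] at h2
  have conv : ∀ {p x y : ENNReal}, (4 : ENNReal)⁻¹ ≤ p → p * x ≤ 2 * y → x ≤ 8 * y := by
    intro p x y hp h
    have h3 : (4 : ENNReal)⁻¹ * x ≤ 2 * y := (mul_le_mul_left hp x).trans h
    calc x = 4 * ((4 : ENNReal)⁻¹ * x) := by
          rw [← mul_assoc, ENNReal.mul_inv_cancel (by simp) (by simp), one_mul]
      _ ≤ 4 * (2 * y) := by gcongr
      _ = 8 * y := by rw [← mul_assoc]; norm_num
  have h3 := conv hB h1
  have h4 := conv hS h2
  have hsub : {Av : (Fin m → Fin n → ℝ) × (Fin m → ℝ) | ∃ w ∈ S, ∀ w' ∈ B,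
        l2norm (Av.2 - Matrix.of Av.1 *ᵥ w) ≤ l2norm (Av.2 - Matrix.of Av.1 *ᵥ w')} ⊆
      {Av | ∀ w ∈ B, b₁ + Δ / 2 ≤ l2norm (Av.2 - Matrix.of Av.1 *ᵥ w)} ∪
      {Av | ∃ w ∈ S, l2norm (Av.2 - Matrix.of Av.1 *ᵥ w) < b₁ + Δ / 2} := by
    rintro Av ⟨w, hw, h⟩
    by_cases hlt : l2norm (Av.2 - Matrix.of Av.1 *ᵥ w) < b₁ + Δ / 2
    · exact Or.inr ⟨w, hw, hlt⟩
    · exact Or.inl fun w' hw' => (not_lt.1 hlt).trans (h w' hw')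
  refine (measure_mono hsub).trans ((measure_union_le _ _).trans ((add_le_add h3 h4).trans ?_))
  rw [ENNReal.ofReal_mul (by norm_num), ← add_mul]
  norm_num

/-! ### The error function and the limiting dual problem. -/

section erf

lemma integrable_exp_neg_sq : Integrable fun t : ℝ => Real.exp (-t ^ 2) := by
  simpa using integrable_exp_neg_mul_sq (b := 1) one_pos

lemma continuous_erf : Continuous erf := by
  unfold erf
  exact continuous_const.mul (intervalIntegral.continuous_primitive
    (fun _ _ => integrable_exp_neg_sq.intervalIntegrable) 0)

lemma erf_neg (x : ℝ) : erf (-x) = -erf x := by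
  have h := intervalIntegral.integral_comp_neg (a := 0) (b := x) fun t : ℝ => Real.exp (-t ^ 2)
  simp only [neg_sq, neg_zero] at h
  rw [erf, erf, h, intervalIntegral.integral_symm]
  ring

lemma integral_Ioi_exp_neg_sq : ∫ t in Set.Ioi (0 : ℝ), Real.exp (-t ^ 2) = √Real.pi / 2 := by
  simpa using integral_gaussian_Ioi 1

lemma tendsto_erf_atTop : Filter.Tendsto erf Filter.atTop (nhds 1) := by
  have h := intervalIntegral_tendsto_integral_Ioi (0 : ℝ) integrable_exp_neg_sq.integrableOn
    Filter.tendsto_id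
  rw [integral_Ioi_exp_neg_sq] at h
  have h2 := h.const_mul (2 / √Real.pi)
  have e : 2 / √Real.pi * (√Real.pi / 2) = 1 := by
    have : √Real.pi ≠ 0 := (Real.sqrt_pos.2 Real.pi_pos).ne'
    field_simp
  rw [e] at h2
  exact h2

/-- `Function.invFun` is a right inverse only on the range, which contains `(-1, 1)` by oddness, the
limit at infinity and continuity. -/
lemma erf_erfinv {y : ℝ} (h1 : -1 < y) (h2 : y < 1) : erf (erfinv y) = y := by
  refine Function.invFun_eq ?_
  have hup : ∃ x, y ≤ erf x :=
    ((tendsto_erf_atTop.eventually (lt_mem_nhds h2)).exists).imp fun _ h => le_of_lt h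
  have hlow : ∃ x, erf x ≤ y := by
    obtain ⟨x, hx⟩ := (tendsto_erf_atTop.eventually (lt_mem_nhds (by linarith : -y < 1))).exists
    exact ⟨-x, by rw [erf_neg]; linarith⟩
  exact mem_range_of_exists_le_of_exists_ge continuous_erf hlow hup

lemma integral_Iic_gaussianPDF (ν : ℝ) :
    ∫ z in Set.Iic (-ν), gaussianPDFReal 0 1 z = (1 - erf (ν / √2)) / 2 := by
  have hi : Integrable (gaussianPDFReal 0 1) := integrable_gaussianPDFReal 0 1
  have h2 : (0 : ℝ) < √2 := by positivity
  have hπ : (0 : ℝ) < √Real.pi := Real.sqrt_pos.2 Real.pi_pos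
  have hs : √(2 * Real.pi) = √2 * √Real.pi := Real.sqrt_mul (by norm_num) _
  have h0 : ∫ z in Set.Iic (0 : ℝ), gaussianPDFReal 0 1 z = 1 / 2 := by
    have h3 : ∫ z in Set.Iic (0 : ℝ), gaussianPDFReal 0 1 z
        = ∫ z in Set.Ioi (0 : ℝ), gaussianPDFReal 0 1 z := by
      have := integral_comp_neg_Iic (0 : ℝ) (gaussianPDFReal 0 1)
      rw [neg_zero] at this
      rw [← this]
      refine integral_congr_ae (Filter.Eventually.of_forall fun z => ?_)
      simp [gaussianPDFReal_std]
    have h4 := integral_add_compl (measurableSet_Iic (a := (0 : ℝ))) hi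
    rw [Set.compl_Iic, ← h3, integral_gaussianPDFReal_eq_one 0 one_ne_zero] at h4
    linarith
  have h5 := intervalIntegral.integral_Iic_sub_Iic (a := -ν) (b := 0) hi.integrableOn hi.integrableOn
  have h6 : ∫ z in (-ν)..0, gaussianPDFReal 0 1 z = erf (ν / √2) / 2 := by
    have h7 := intervalIntegral.integral_comp_neg (a := 0) (b := ν) (gaussianPDFReal 0 1)
    rw [neg_zero] at h7
    rw [← h7, erf]
    have h8 := intervalIntegral.integral_comp_div (a := 0) (b := ν)
      (fun t : ℝ => Real.exp (-t ^ 2)) h2.ne'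
    rw [zero_div] at h8
    have h9 : ∀ z : ℝ, gaussianPDFReal 0 1 (-z) = (√(2 * Real.pi))⁻¹ * Real.exp (-(z / √2) ^ 2) := by
      intro z
      rw [gaussianPDFReal_std, div_pow, Real.sq_sqrt (by norm_num)]
      congr 2; ring
    simp_rw [h9]
    rw [intervalIntegral.integral_const_mul, h8, smul_eq_mul, hs]
    field_simp
  rw [h0, h6] at h5
  linarith

end erf

/-- The negative part of `z + ν`. -/
noncomputable def np (ν z : ℝ) : ℝ := max (-(z + ν)) 0

lemma np_nonneg (ν z : ℝ) : 0 ≤ np ν z := le_max_right _ _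

lemma continuous_np (ν : ℝ) : Continuous (np ν) := by
  unfold np; fun_prop

lemma abs_le_mul_exp (z : ℝ) : |z| ≤ 1 * Real.exp (1 * |z|) := by
  rw [one_mul, one_mul]; exact abs_le_exp_abs z

lemma sq_le_mul_exp (z : ℝ) : |z ^ 2| ≤ 2 * Real.exp (1 * |z|) := by
  have := Real.quadratic_le_exp_of_nonneg (abs_nonneg z)
  rw [sq_abs] at this
  rw [abs_of_nonneg (sq_nonneg z), one_mul]
  linarith [abs_nonneg z]

lemma integrable_gaussian_id : Integrable (fun z : ℝ => z) (gaussianReal 0 1) :=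
  integrable_of_le_exp_abs measurable_id abs_le_mul_exp

lemma integrable_gaussian_sq : Integrable (fun z : ℝ => z ^ 2) (gaussianReal 0 1) :=
  integrable_of_le_exp_abs (by fun_prop) sq_le_mul_exp

lemma integral_gaussian_sq : ∫ z, z ^ 2 ∂(gaussianReal 0 1) = 1 := by
  have := gaussian_ibp (f := fun t => t) (f' := fun _ => 1) (fun t => hasDerivAt_id t) (by fun_prop)
    abs_le_mul_exp (fun t => by
      rw [abs_one, one_mul, one_mul]; exact Real.one_le_exp (abs_nonneg t))
  simpa [sq] using this

lemma integrable_pdf_mul_id : Integrable fun z => gaussianPDFReal 0 1 z * z :=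
  integrable_pdf_mul_iff integrable_gaussian_id

lemma integrable_pdf_mul_sq : Integrable fun z => gaussianPDFReal 0 1 z * z ^ 2 :=
  integrable_pdf_mul_iff integrable_gaussian_sq

lemma integral_Iic_pdf_mul_id (a : ℝ) :
    ∫ z in Set.Iic a, gaussianPDFReal 0 1 z * z = -gaussianPDFReal 0 1 a := by
  have hd : ∀ z ∈ Set.Iic a, HasDerivAt (fun z => -gaussianPDFReal 0 1 z)
      (gaussianPDFReal 0 1 z * z) z := fun z _ => by
    refine (hasDerivAt_gaussianPDFReal_std z).neg.congr_deriv ?_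
    ring
  rw [integral_Iic_of_hasDerivAt_of_tendsto' hd integrable_pdf_mul_id.integrableOn
    (tendsto_zero_of_hasDerivAt_of_integrableOn_Iic hd integrable_pdf_mul_id.integrableOn
      (integrable_gaussianPDFReal 0 1).neg.integrableOn), sub_zero]

lemma integral_Iic_pdf_mul_sq (a : ℝ) :
    ∫ z in Set.Iic a, gaussianPDFReal 0 1 z * z ^ 2
      = (∫ z in Set.Iic a, gaussianPDFReal 0 1 z) - a * gaussianPDFReal 0 1 a := by
  have hi : Integrable (gaussianPDFReal 0 1) := integrable_gaussianPDFReal 0 1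
  have hd : ∀ z ∈ Set.Iic a, HasDerivAt (fun z => -(gaussianPDFReal 0 1 z * z))
      (gaussianPDFReal 0 1 z * z ^ 2 - gaussianPDFReal 0 1 z) z := fun z _ => by
    refine ((hasDerivAt_gaussianPDFReal_std z).mul (hasDerivAt_id z)).neg.congr_deriv ?_
    simp only [id]
    ring
  have hint := (integrable_pdf_mul_sq.sub hi).integrableOn (s := Set.Iic a)
  have h := integral_Iic_of_hasDerivAt_of_tendsto' hd hint
    (tendsto_zero_of_hasDerivAt_of_integrableOn_Iic hd hint
      integrable_pdf_mul_id.neg.integrableOn)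
  rw [integral_sub integrable_pdf_mul_sq.integrableOn hi.integrableOn] at h
  linarith

lemma np_eq_indicator (ν z : ℝ) : np ν z = (Set.Iic (-ν)).indicator (fun z => -(z + ν)) z := by
  by_cases h : z ≤ -ν
  · rw [Set.indicator_of_mem (by exact h), np, max_eq_left (by linarith)]
  · rw [Set.indicator_of_notMem (by exact h), np, max_eq_right (by linarith)]

lemma integral_np (ν : ℝ) : ∫ z, np ν z ∂(gaussianReal 0 1)
    = gaussianPDFReal 0 1 ν - ν * ∫ z in Set.Iic (-ν), gaussianPDFReal 0 1 z := by
  have hi : Integrable (gaussianPDFReal 0 1) := integrable_gaussianPDFReal 0 1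
  rw [integral_gaussianReal_eq_integral_smul one_ne_zero]
  have e : ∀ z, gaussianPDFReal 0 1 z • np ν z = (Set.Iic (-ν)).indicator
      (fun z => -(gaussianPDFReal 0 1 z * z) - ν * gaussianPDFReal 0 1 z) z := by
    intro z
    rw [np_eq_indicator, smul_eq_mul]
    by_cases h : z ∈ Set.Iic (-ν)
    · rw [Set.indicator_of_mem h, Set.indicator_of_mem h]; ring
    · rw [Set.indicator_of_notMem h, Set.indicator_of_notMem h]; ring
  have i1 : Integrable fun z => -(gaussianPDFReal 0 1 z * z) := integrable_pdf_mul_id.neg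
  simp_rw [e]
  rw [integral_indicator measurableSet_Iic, integral_sub i1.integrableOn
    (hi.const_mul ν).integrableOn, integral_neg, integral_const_mul, integral_Iic_pdf_mul_id]
  simp [gaussianPDFReal_std]

lemma integral_np_sq (ν : ℝ) : ∫ z, np ν z ^ 2 ∂(gaussianReal 0 1)
    = (1 + ν ^ 2) * (∫ z in Set.Iic (-ν), gaussianPDFReal 0 1 z) - ν * gaussianPDFReal 0 1 ν := by
  have hi : Integrable (gaussianPDFReal 0 1) := integrable_gaussianPDFReal 0 1
  rw [integral_gaussianReal_eq_integral_smul one_ne_zero]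
  have e : ∀ z, gaussianPDFReal 0 1 z • np ν z ^ 2 = (Set.Iic (-ν)).indicator
      (fun z => gaussianPDFReal 0 1 z * z ^ 2 + 2 * ν * (gaussianPDFReal 0 1 z * z)
        + ν ^ 2 * gaussianPDFReal 0 1 z) z := by
    intro z
    rw [np_eq_indicator, smul_eq_mul]
    by_cases h : z ∈ Set.Iic (-ν)
    · rw [Set.indicator_of_mem h, Set.indicator_of_mem h]; ring
    · rw [Set.indicator_of_notMem h, Set.indicator_of_notMem h]; ring
  have i1 : Integrable fun z => gaussianPDFReal 0 1 z * z ^ 2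
      + 2 * ν * (gaussianPDFReal 0 1 z * z) :=
    integrable_pdf_mul_sq.add (integrable_pdf_mul_id.const_mul _)
  simp_rw [e]
  rw [integral_indicator measurableSet_Iic, integral_add i1.integrableOn
    (hi.const_mul _).integrableOn, integral_add integrable_pdf_mul_sq.integrableOn
    (integrable_pdf_mul_id.const_mul _).integrableOn, integral_const_mul, integral_const_mul,
    integral_Iic_pdf_mul_id, integral_Iic_pdf_mul_sq]
  have : gaussianPDFReal 0 1 (-ν) = gaussianPDFReal 0 1 ν := by simp [gaussianPDFReal_std]
  rw [this]
  ring

/-- The characteristic curve gives the minimizing threshold `ν` and identifies the minimal value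
of the limiting dual problem with the curve. -/
lemma exists_threshold {α β : ℝ} (hβ : 0 < β) (h : BelowSignedCurve α β) :
    ∃ D ν : ℝ, β < D ∧ D < 1 ∧ D < α ∧ 0 ≤ ν ∧
      (1 - β) * ∫ z, np ν z ∂(gaussianReal 0 1) = β * ν ∧
      (1 - β) * ∫ z, np ν z ^ 2 ∂(gaussianReal 0 1) + β * (1 + ν ^ 2) = D := by
  obtain ⟨D, hβD, hD1, hc, hDα⟩ := h
  set e := erfinv (2 * ((1 - D) / (1 - β)) - 1) with he
  have hb : 0 < 1 - β := by linarith
  have hD0 : 0 < D := by linarith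
  have hpos : 0 < (1 - D) / (1 - β) := div_pos (by linarith) hb
  have hlt : (1 - D) / (1 - β) < 1 := by rw [div_lt_one hb]; linarith
  have herf : erf e = 2 * ((1 - D) / (1 - β)) - 1 :=
    erf_erfinv (by linarith) (by linarith)
  have h2 : (0 : ℝ) < √2 := by positivity
  set ν := √2 * e with hν
  -- The argument of `erfinv` in the curve is exactly the one that makes this tail `(D - β) / (1 -
  -- β)`.
  have hQ : ∫ z in Set.Iic (-ν), gaussianPDFReal 0 1 z = (D - β) / (1 - β) := by
    rw [integral_Iic_gaussianPDF, hν, mul_div_cancel_left₀ _ h2.ne', herf]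
    field_simp; ring
  have hφ : gaussianPDFReal 0 1 ν = √(1 / (2 * Real.pi)) * Real.exp (-e ^ 2) := by
    rw [gaussianPDFReal_std, one_div, Real.sqrt_inv, hν, mul_pow, Real.sq_sqrt (by norm_num)]
    congr 2; ring
  -- The curve equation, cleared of denominators. Together with `hQ` it makes `ν` stationary for the
  -- limiting dual value, and it forces `ν ≥ 0`.
  have hcurve : (1 - β) * gaussianPDFReal 0 1 ν = D * ν := by
    have h3 : (1 - β) * (√(1 / (2 * Real.pi)) * Real.exp (-e ^ 2)) / D - √2 * e = 0 := hc
    rw [← hφ, ← hν, sub_eq_zero, div_eq_iff hD0.ne'] at h3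
    linarith
  refine ⟨D, ν, hβD, hD1, hDα, ?_, ?_, ?_⟩
  · have : 0 ≤ D * ν := by
      rw [← hcurve]; exact mul_nonneg hb.le (gaussianPDFReal_nonneg _ _ _)
    exact nonneg_of_mul_nonneg_right this hD0
  · rw [integral_np, hQ, mul_sub, hcurve]
    field_simp; ring
  · rw [integral_np_sq, hQ, mul_sub, mul_left_comm (1 - β) ν, hcurve]
    field_simp; ring

/-! ### A law of large numbers by Chebyshev's inequality. -/

lemma memLp_two_of_le_exp_abs {f : ℝ → ℝ} (hf : Measurable f) {C c : ℝ}
    (h : ∀ z, |f z| ≤ C * Real.exp (c * |z|)) : MemLp f 2 (gaussianReal 0 1) := by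
  rw [memLp_two_iff_integrable_sq hf.aestronglyMeasurable]
  refine integrable_of_le_exp_abs (by fun_prop) (C := C ^ 2) (c := 2 * c) fun z => ?_
  rw [abs_pow]
  refine (pow_le_pow_left₀ (abs_nonneg _) (h z) 2).trans (le_of_eq ?_)
  rw [mul_pow, ← Real.exp_nat_mul]
  congr 2; push_cast; ring

/-- A weak law of large numbers for partial sums, uniform in the set of indices. -/
lemma weak_lln {f : ℝ → ℝ} (hf : MemLp f 2 (gaussianReal 0 1)) {δ θ : ℝ} (hδ : 0 < δ)
    (hθ : 0 < θ) : ∃ N : ℕ, ∀ n : ℕ, N ≤ n → ∀ S : Finset (Fin n),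
      stdG (Fin n) {h | δ * n ≤ |∑ i ∈ S, f (h i) - S.card * ∫ z, f z ∂(gaussianReal 0 1)|}
        ≤ ENNReal.ofReal θ := by
  obtain ⟨N, hN⟩ := exists_nat_gt (Var[f; gaussianReal 0 1] / (δ ^ 2 * θ))
  refine ⟨N + 1, fun n hn S => ?_⟩
  have hn0 : (0 : ℝ) < n := by
    have : 0 < n := by omega
    exact_mod_cast this
  -- Terms outside `S` are replaced by zero. The variance is then at most `n` times that of `f`,
  -- uniformly in `S`.
  let X : Fin n → ℝ → ℝ := fun i => if i ∈ S then f else 0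
  have hX : ∀ i, MemLp (X i) 2 (gaussianReal 0 1) := by
    intro i
    by_cases h : i ∈ S
    · simpa [X, h] using hf
    · simp [X, h]
  have hXm : ∀ i, MemLp (fun h : Fin n → ℝ => X i (h i)) 2 (stdG (Fin n)) := fun i =>
    (hX i).comp_measurePreserving (measurePreserving_eval (fun _ : Fin n => gaussianReal 0 1) i)
  have hsum : ∀ h : Fin n → ℝ, (∑ i, fun h : Fin n → ℝ => X i (h i)) h = ∑ i ∈ S, f (h i) := by
    intro h
    rw [Finset.sum_apply, ← Finset.sum_filter_add_sum_filter_not Finset.univ (· ∈ S)]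
    rw [Finset.sum_eq_zero (s := Finset.univ.filter (· ∉ S))
      (fun i hi => by simp [X, (Finset.mem_filter.1 hi).2]), add_zero, Finset.filter_mem_eq_inter,
      Finset.univ_inter]
    exact Finset.sum_congr rfl fun i hi => by simp [X, hi]
  have hvar : Var[∑ i, fun h : Fin n → ℝ => X i (h i); stdG (Fin n)]
      ≤ n * Var[f; gaussianReal 0 1] := by
    rw [variance_sum_pi hX]
    have : ∀ i ∈ (Finset.univ : Finset (Fin n)),
        Var[X i; gaussianReal 0 1] ≤ Var[f; gaussianReal 0 1] := by
      intro i _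
      by_cases h : i ∈ S
      · simp [X, h]
      · simp only [X, h, if_false]
        rw [variance_zero]
        exact variance_nonneg _ _
    simpa using Finset.sum_le_sum this
  have hmean : ∫ h, (∑ i, fun h : Fin n → ℝ => X i (h i)) h ∂(stdG (Fin n))
      = S.card * ∫ z, f z ∂(gaussianReal 0 1) := by
    simp_rw [hsum]
    have hi : ∀ i, Integrable (fun h : Fin n → ℝ => f (h i)) (stdG (Fin n)) := fun i =>
      (hf.comp_measurePreserving
        (measurePreserving_eval (fun _ : Fin n => gaussianReal 0 1) i)).integrable (by norm_num)
    rw [integral_finsetSum _ fun i _ => hi i]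
    have : ∀ i ∈ S, ∫ h : Fin n → ℝ, f (h i) ∂(stdG (Fin n)) = ∫ z, f z ∂(gaussianReal 0 1) := by
      intro i _
      have mp := measurePreserving_eval (fun _ : Fin n => gaussianReal 0 1) i
      conv_rhs => rw [← mp.map_eq]
      exact (integral_map mp.measurable.aemeasurable
        (by rw [mp.map_eq]; exact hf.aestronglyMeasurable)).symm
    rw [Finset.sum_congr rfl this, Finset.sum_const, nsmul_eq_mul]
  have key := meas_ge_le_variance_div_sq (μ := stdG (Fin n)) (memLp_finsetSum' Finset.univ
    fun i _ => hXm i) (mul_pos hδ hn0)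
  rw [hmean] at key
  simp_rw [hsum] at key
  refine key.trans (ENNReal.ofReal_le_ofReal ?_)
  rw [div_le_iff₀ (by positivity)]
  refine hvar.trans ?_
  have h1 : Var[f; gaussianReal 0 1] ≤ n * (δ ^ 2 * θ) := by
    rw [← div_le_iff₀ (by positivity)]
    refine hN.le.trans ?_
    exact_mod_cast (by omega : N ≤ n)
  nlinarith

/-! ### The dual problem: weak duality and an almost optimal primal direction. -/

/-- The cone of directions along which a sparse nonnegative vector can be perturbed. -/
def errCone (n k : ℕ) : Set (Fin n → ℝ) :=
  {w | (∀ i : Fin n, (i : ℕ) < n - k → 0 ≤ w i) ∧ ∑ i, w i ≤ 0}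

lemma xiGen_le {n k : ℕ} {h : Fin n → ℝ} {p : ℝ × (Fin n → ℝ)} (hp : p ∈ dualFeasible n k) :
    xiGen k h ≤ l2norm (fun i => h i + p.1 - p.2 i) :=
  csInf_le ⟨0, by rintro _ ⟨q, _, rfl⟩; exact l2norm_nonneg _⟩ ⟨p, hp, rfl⟩

lemma zero_mem_dualFeasible (n k : ℕ) : (0 : ℝ × (Fin n → ℝ)) ∈ dualFeasible n k :=
  ⟨le_rfl, fun _ => ⟨fun _ => rfl, fun _ => le_rfl⟩⟩

lemma xiGen_nonneg {n k : ℕ} (h : Fin n → ℝ) : 0 ≤ xiGen k h := by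
  refine Real.sInf_nonneg ?_
  rintro _ ⟨q, _, rfl⟩
  exact l2norm_nonneg _

/-- Weak duality. -/
lemma neg_xiGen_mul_le {n k : ℕ} (h : Fin n → ℝ) {w : Fin n → ℝ} (hw : w ∈ errCone n k) :
    -(xiGen k h * l2norm w) ≤ w ⬝ᵥ h := by
  rcases (l2norm_nonneg w).eq_or_lt with h0 | h0
  · have : w = 0 := l2norm_eq_zero.1 h0.symm
    simp [this, l2norm_zero]
  have key : -(w ⬝ᵥ h) / l2norm w ≤ xiGen k h := by
    refine le_csInf (Set.Nonempty.image _ ⟨0, zero_mem_dualFeasible n k⟩) ?_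
    rintro _ ⟨p, hp, rfl⟩
    rw [div_le_iff₀ h0, mul_comm]
    have h1 := neg_l2norm_le_dotProduct w (fun i => h i + p.1 - p.2 i)
    have h2 : w ⬝ᵥ (fun i => h i + p.1 - p.2 i)
        = w ⬝ᵥ h + p.1 * ∑ i, w i - ∑ i, w i * p.2 i := by
      simp only [dotProduct, Finset.mul_sum, ← Finset.sum_add_distrib, ← Finset.sum_sub_distrib]
      exact Finset.sum_congr rfl fun i _ => by ring
    have h3 : p.1 * ∑ i, w i ≤ 0 := mul_nonpos_of_nonneg_of_nonpos hp.1 hw.2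
    have h4 : 0 ≤ ∑ i, w i * p.2 i := by
      refine Finset.sum_nonneg fun i _ => ?_
      rcases lt_or_ge (i : ℕ) (n - k) with hi | hi
      · exact mul_nonneg (hw.1 i hi) ((hp.2 i).2 hi)
      · rw [(hp.2 i).1 hi, mul_zero]
    linarith
  rw [div_le_iff₀ h0] at key
  linarith

/-- The approximate minimizer of the dual problem at the threshold `ν`, with reversed sign. -/
noncomputable def dualVec {n : ℕ} (k : ℕ) (ν : ℝ) (h : Fin n → ℝ) : Fin n → ℝ :=
  fun i => if (i : ℕ) < n - k then np ν (h i) else -(h i + ν)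

/-- For fixed `ν` the best `lam` is the positive part of `h + ν` on the first coordinates, leaving
the negative part `np` there and `h + ν` on the last ones. -/
lemma xiGen_le_dualVec {n k : ℕ} {ν : ℝ} (hν : 0 ≤ ν) (h : Fin n → ℝ) :
    xiGen k h ≤ l2norm (dualVec k ν h) := by
  have hp : (ν, fun i : Fin n => h i + ν + dualVec k ν h i) ∈ dualFeasible n k := by
    refine ⟨hν, fun i => ⟨fun hi => ?_, fun hi => ?_⟩⟩
    · simp only [dualVec, if_neg (not_lt.2 hi)]; ring
    · simp only [dualVec, if_pos hi, np]
      have := le_max_left (-(h i + ν)) 0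
      linarith
  refine (xiGen_le hp).trans (le_of_eq ?_)
  rw [← l2norm_neg]
  congr 1
  ext i
  simp

/-- The indices of the vanishing coordinates. -/
def firstIdx (n k : ℕ) : Finset (Fin n) := Finset.univ.filter fun i => (i : ℕ) < n - k

/-- The indices of the remaining coordinates. -/
def lastIdx (n k : ℕ) : Finset (Fin n) := Finset.univ.filter fun i => ¬ (i : ℕ) < n - k

lemma card_firstIdx (n k : ℕ) : (firstIdx n k).card = n - k := by
  rw [firstIdx, Fin.card_filter_val_lt]
  omega

lemma card_lastIdx {n k : ℕ} (hk : k ≤ n) : (lastIdx n k).card = k := by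
  have h := Finset.card_filter_add_card_filter_not (s := (Finset.univ : Finset (Fin n)))
    (fun i : Fin n => (i : ℕ) < n - k)
  rw [← firstIdx, ← lastIdx, card_firstIdx, Finset.card_univ, Fintype.card_fin] at h
  omega

lemma sum_split {n : ℕ} (k : ℕ) (f : Fin n → ℝ) :
    ∑ i, f i = ∑ i ∈ firstIdx n k, f i + ∑ i ∈ lastIdx n k, f i :=
  (Finset.sum_filter_add_sum_filter_not _ _ _).symm

lemma dualVec_first {n k : ℕ} {ν : ℝ} {h : Fin n → ℝ} {i : Fin n} (hi : i ∈ firstIdx n k) :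
    dualVec k ν h i = np ν (h i) := if_pos (Finset.mem_filter.1 hi).2

lemma dualVec_last {n k : ℕ} {ν : ℝ} {h : Fin n → ℝ} {i : Fin n} (hi : i ∈ lastIdx n k) :
    dualVec k ν h i = -(h i + ν) := if_neg (Finset.mem_filter.1 hi).2

/-- Complementary slackness: where the negative part is nonzero, `-z` equals it plus `ν`. This
expresses `dualVec ⬝ᵥ h` through `‖dualVec‖²` and the sum of its entries. -/
lemma np_mul_self (ν z : ℝ) : -(np ν z * z) = np ν z ^ 2 + ν * np ν z := by
  rcases le_total 0 (-(z + ν)) with h | h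
  · rw [np, max_eq_left h]; ring
  · rw [np, max_eq_right h]; ring

/-- The estimates for the dual problem that follow from the law of large numbers. -/
lemma dual_estimates {n k : ℕ} (hk : k ≤ n) {β ν D δ a₁ a₂ : ℝ} (hβ : 0 < β) (hν : 0 ≤ ν)
    (hδ : 0 < δ) (hkn : (k : ℝ) = β * n) (h₁ : (1 - β) * a₁ = β * ν)
    (h₂ : (1 - β) * a₂ + β * (1 + ν ^ 2) = D) {h : Fin n → ℝ}
    (A₁ : |∑ i ∈ firstIdx n k, np ν (h i) - ((n - k : ℕ) : ℝ) * a₁| ≤ δ * n)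
    (A₂ : |∑ i ∈ firstIdx n k, np ν (h i) ^ 2 - ((n - k : ℕ) : ℝ) * a₂| ≤ δ * n)
    (B₁ : |∑ i ∈ lastIdx n k, h i| ≤ δ * n)
    (B₂ : |∑ i ∈ lastIdx n k, h i ^ 2 - k| ≤ δ * n) :
    xiGen k h ^ 2 ≤ n * (D + (2 + 2 * ν) * δ) ∧
    ∃ w ∈ errCone n k, w ⬝ᵥ h ≤ -(n * (D - (2 + 4 * ν) * δ - 2 / β * δ ^ 2)) ∧
      l2norm w ≤ √n * (√(D + (2 + 2 * ν) * δ) + 2 / β * δ) := by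
  have hcast : ((n - k : ℕ) : ℝ) = (1 - β) * n := by
    rw [Nat.cast_sub hk, hkn]; ring
  rw [hcast] at A₁ A₂
  rw [hkn] at B₂
  obtain ⟨A₁l, A₁u⟩ := abs_le.1 A₁
  obtain ⟨A₂l, A₂u⟩ := abs_le.1 A₂
  obtain ⟨B₁l, B₁u⟩ := abs_le.1 B₁
  obtain ⟨B₂l, B₂u⟩ := abs_le.1 B₂
  have hn0 : (0 : ℝ) ≤ n := Nat.cast_nonneg n
  have e₁ : (1 - β) * n * a₁ = n * (β * ν) := by rw [← h₁]; ring
  have e₂ : (1 - β) * n * a₂ = n * (D - β * (1 + ν ^ 2)) := by rw [← h₂]; ring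
  rw [e₁] at A₁l A₁u
  rw [e₂] at A₂l A₂u
  set W := dualVec k ν h with hW
  have hconst : ∀ c : ℝ, β * n * c = ∑ i ∈ lastIdx n k, c := fun c => by
    rw [Finset.sum_const, card_lastIdx hk, nsmul_eq_mul, hkn]
  have hlast2 : ∑ i ∈ lastIdx n k, W i ^ 2
      = ∑ i ∈ lastIdx n k, h i ^ 2 + 2 * ν * ∑ i ∈ lastIdx n k, h i + β * n * ν ^ 2 := by
    rw [hconst, Finset.mul_sum, ← Finset.sum_add_distrib, ← Finset.sum_add_distrib]
    exact Finset.sum_congr rfl fun i hi => by rw [hW, dualVec_last hi]; ring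
  have hW2 : l2norm W ^ 2 = ∑ i ∈ firstIdx n k, np ν (h i) ^ 2 + ∑ i ∈ lastIdx n k, W i ^ 2 := by
    rw [l2norm_sq, sum_split k]
    congr 1
    exact Finset.sum_congr rfl fun i hi => by rw [hW, dualVec_first hi]
  have hWs : ∑ i, W i = ∑ i ∈ firstIdx n k, np ν (h i) - ∑ i ∈ lastIdx n k, h i - β * n * ν := by
    rw [sum_split k, Finset.sum_congr rfl fun i hi => by rw [hW, dualVec_first hi], sub_sub,
      sub_eq_add_neg]
    congr 1
    rw [hconst, ← Finset.sum_add_distrib, ← Finset.sum_neg_distrib]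
    exact Finset.sum_congr rfl fun i hi => by rw [hW, dualVec_last hi]
  have hWh : W ⬝ᵥ h = -(l2norm W ^ 2 + ν * ∑ i, W i) := by
    rw [l2norm_sq, Finset.mul_sum, ← Finset.sum_add_distrib, ← Finset.sum_neg_distrib]
    refine Finset.sum_congr rfl fun i _ => ?_
    by_cases hi : (i : ℕ) < n - k
    · have := np_mul_self ν (h i)
      simp only [hW, dualVec, if_pos hi]
      linarith
    · simp only [hW, dualVec, if_neg hi]; ring
  have hνB : |ν * ∑ i ∈ lastIdx n k, h i| ≤ ν * (δ * n) := by
    rw [abs_mul, abs_of_nonneg hν]; exact mul_le_mul_of_nonneg_left B₁ hν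
  obtain ⟨νBl, νBu⟩ := abs_le.1 hνB
  have hup : l2norm W ^ 2 ≤ n * (D + (2 + 2 * ν) * δ) := by
    rw [hW2, hlast2]; linarith
  have hlow : n * (D - (2 + 2 * ν) * δ) ≤ l2norm W ^ 2 := by
    rw [hW2, hlast2]; linarith
  have hsu : ∑ i, W i ≤ 2 * δ * n := by rw [hWs]; linarith
  have hsl : -(2 * δ * n) ≤ ∑ i, W i := by rw [hWs]; linarith
  refine ⟨?_, ?_⟩
  · exact (pow_le_pow_left₀ (xiGen_nonneg h) (xiGen_le_dualVec hν h) 2).trans hup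
  -- `W` misses the cone only because its sum may reach `2 δ n`. Lowering each of the last `k = β n`
  -- coordinates by `d` removes `d * k = 2 δ n`; these coordinates carry no sign constraint.
  · set d : ℝ := 2 / β * δ with hd
    have hd0 : 0 < d := by positivity
    have hdk : d * (β * n) = 2 * δ * n := by rw [hd]; field_simp
    let I : Fin n → ℝ := fun i => if (i : ℕ) < n - k then 0 else 1
    have hIs : ∀ f : Fin n → ℝ, ∑ i, I i * f i = ∑ i ∈ lastIdx n k, f i := by
      intro f
      rw [sum_split k, Finset.sum_eq_zero (s := firstIdx n k)
        (fun i hi => by simp [I, (Finset.mem_filter.1 hi).2]), zero_add]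
      exact Finset.sum_congr rfl fun i hi => by simp [I, (Finset.mem_filter.1 hi).2]
    have hI1 : ∑ i, I i = β * n := by
      have := hIs fun _ => 1
      simp only [mul_one, Finset.sum_const, card_lastIdx hk, nsmul_eq_mul] at this
      rw [this, hkn]
    have hI2 : l2norm I ≤ √n := by
      refine Real.le_sqrt_of_sq_le ?_
      rw [l2norm_sq]
      have : ∀ i ∈ (Finset.univ : Finset (Fin n)), I i ^ 2 ≤ 1 := by
        intro i _; simp only [I]; split_ifs <;> norm_num
      simpa using Finset.sum_le_sum this
    refine ⟨W - d • I, ⟨fun i hi => ?_, ?_⟩, ?_, ?_⟩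
    · simp only [Pi.sub_apply, Pi.smul_apply, hW, dualVec, if_pos hi, I, smul_eq_mul, mul_zero,
        sub_zero]
      exact np_nonneg _ _
    · simp only [Pi.sub_apply, Pi.smul_apply, smul_eq_mul, Finset.sum_sub_distrib,
        ← Finset.mul_sum, hI1, hdk]
      linarith
    · have h3 : I ⬝ᵥ h = ∑ i ∈ lastIdx n k, h i := hIs h
      have h4 : d * (-(δ * n)) ≤ d * (I ⬝ᵥ h) := by
        rw [h3]; exact mul_le_mul_of_nonneg_left B₁l hd0.le
      have h5 : ν * (-(2 * δ * n)) ≤ ν * ∑ i, W i := mul_le_mul_of_nonneg_left hsl hν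
      have h6 : d * (-(δ * n)) = -(n * (2 / β * δ ^ 2)) := by rw [hd]; ring
      rw [sub_dotProduct, smul_dotProduct, smul_eq_mul, hWh]
      linarith
    · refine (l2norm_sub_le _ _).trans ?_
      rw [l2norm_smul, abs_of_pos hd0, mul_add, mul_comm d]
      refine add_le_add ?_ (mul_le_mul_of_nonneg_right hI2 hd0.le)
      rw [← Real.sqrt_mul hn0]
      exact Real.le_sqrt_of_sq_le hup

/-! ### Typical behaviour of `(g, h, h₀)`. -/

/-- Each inequality holds strictly at `δ = 0` and both sides are continuous, so all hold for some
small `δ > 0`. -/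
lemma exists_scale {D α η : ℝ} (hD : 0 < D) (hη : 0 < η) (c₁ c₂ c₃ : ℝ) :
    ∃ δ : ℝ, 0 < δ ∧ √(D + c₁ * δ) ≤ √D + η ∧ 0 < D - c₂ * δ - c₃ * δ ^ 2 ∧
      (√D - η) * (√(D + c₁ * δ) + c₃ * δ) ≤ D - c₂ * δ - c₃ * δ ^ 2 ∧
      √(α + δ) ≤ √α + η ∧ √α - η ≤ √(α - δ) := by
  have lt_ev : ∀ {f g : ℝ → ℝ}, Continuous f → Continuous g → f 0 < g 0 →
      ∀ᶠ δ in nhdsWithin (0 : ℝ) (Set.Ioi 0), f δ < g δ := fun hf hg h =>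
    Filter.Eventually.filter_mono nhdsWithin_le_nhds
      (hf.continuousAt.eventually_lt hg.continuousAt h)
  have hs : 0 < √D := Real.sqrt_pos.2 hD
  have hss : √D * √D = D := Real.mul_self_sqrt hD.le
  have h1 := lt_ev (f := fun δ => √(D + c₁ * δ)) (g := fun _ => √D + η) (by fun_prop)
    (by fun_prop) (by simpa using hη)
  have h2 := lt_ev (f := fun _ => 0) (g := fun δ => D - c₂ * δ - c₃ * δ ^ 2) (by fun_prop)
    (by fun_prop) (by simpa using hD)
  have h3 := lt_ev (f := fun δ => (√D - η) * (√(D + c₁ * δ) + c₃ * δ))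
    (g := fun δ => D - c₂ * δ - c₃ * δ ^ 2) (by fun_prop) (by fun_prop) (by
      simp only [mul_zero, add_zero, sub_zero, ne_eq, OfNat.ofNat_ne_zero, not_false_eq_true,
        zero_pow]
      nlinarith [mul_pos hη hs])
  have h4 := lt_ev (f := fun δ => √(α + δ)) (g := fun _ => √α + η) (by fun_prop)
    (by fun_prop) (by simpa using hη)
  have h5 := lt_ev (f := fun _ => √α - η) (g := fun δ => √(α - δ)) (by fun_prop)
    (by fun_prop) (by simpa using hη)
  have h0 : ∀ᶠ δ in nhdsWithin (0 : ℝ) (Set.Ioi 0), 0 < δ := self_mem_nhdsWithin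
  obtain ⟨δ, h, ⟨g1, g2, g3⟩, g4, g5⟩ :=
    (h0.and ((h1.and (h2.and h3)).and (h4.and h5))).exists
  exact ⟨δ, h, g1.le, g2, g3.le, g4.le, g5.le⟩

/-- The typical behaviour of the Gaussian vectors `(g, h, h₀)`, up to the precision `η`. -/
structure Typical {m n : ℕ} (k : ℕ) (α D η : ℝ) (t : (Fin m → ℝ) × (Fin n → ℝ) × ℝ) : Prop where
  g_lower : (√α - η) * √n ≤ l2norm t.1
  g_upper : l2norm t.1 ≤ (√α + η) * √n
  h₀_le : |t.2.2| ≤ η * √n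
  xi_upper : xiGen k t.2.1 ≤ (√D + η) * √n
  exists_dir : ∃ u ∈ errCone n k, l2norm u = 1 ∧ u ⬝ᵥ t.2.1 ≤ -((√D - η) * √n)

lemma memLp_np (ν : ℝ) : MemLp (np ν) 2 (gaussianReal 0 1) ∧
    MemLp (fun z => np ν z ^ 2) 2 (gaussianReal 0 1) := by
  have hb : ∀ z, |np ν z| ≤ (1 + |ν|) * Real.exp (1 * |z|) := by
    intro z
    have h1 := abs_le_exp_abs z
    have h2 := Real.one_le_exp (abs_nonneg z)
    have h3 : |np ν z| ≤ |z| + |ν| := by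
      rw [abs_of_nonneg (np_nonneg _ _), np]
      refine max_le ?_ (by positivity)
      linarith [neg_le_abs z, neg_le_abs ν]
    rw [one_mul]
    nlinarith [abs_nonneg ν]
  refine ⟨memLp_two_of_le_exp_abs (continuous_np ν).measurable hb,
    memLp_two_of_le_exp_abs ((continuous_np ν).pow 2).measurable
      (C := (1 + |ν|) ^ 2) (c := 2 * 1) fun z => ?_⟩
  rw [abs_pow]
  refine (pow_le_pow_left₀ (abs_nonneg _) (hb z) 2).trans (le_of_eq ?_)
  rw [mul_pow, ← Real.exp_nat_mul]
  congr 2; push_cast; ring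

lemma gaussian_abs_ge_le {θ c : ℝ} (hc : 0 < c) (h : 1 ≤ θ * c ^ 2) :
    gaussianReal 0 1 {z | c ≤ |z|} ≤ ENNReal.ofReal θ := by
  have h1 := meas_ge_le_variance_div_sq (μ := gaussianReal 0 1)
    (memLp_two_of_le_exp_abs measurable_id abs_le_mul_exp) hc
  simp only [id_eq, integral_id_gaussianReal, sub_zero, variance_id_gaussianReal] at h1
  refine h1.trans (ENNReal.ofReal_le_ofReal ?_)
  rw [div_le_iff₀ (by positivity)]
  simpa using h

lemma ghzLaw_h_le {m n : ℕ} {s : Set (Fin n → ℝ)} {ε : ENNReal} (h : stdG (Fin n) s ≤ ε) :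
    ghzLaw m n {t | t.2.1 ∈ s} ≤ ε := by
  have : {t : (Fin m → ℝ) × (Fin n → ℝ) × ℝ | t.2.1 ∈ s} = Set.univ ×ˢ (s ×ˢ Set.univ) := by
    ext t; simp
  rw [this, ghzLaw, Measure.prod_prod, Measure.prod_prod]
  simpa using h

lemma ghzLaw_g_le {m n : ℕ} {s : Set (Fin m → ℝ)} {ε : ENNReal} (h : stdG (Fin m) s ≤ ε) :
    ghzLaw m n {t | t.1 ∈ s} ≤ ε := by
  have : {t : (Fin m → ℝ) × (Fin n → ℝ) × ℝ | t.1 ∈ s} = s ×ˢ Set.univ := by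
    ext t; simp
  rw [this, ghzLaw, Measure.prod_prod]
  simpa using h

lemma ghzLaw_h₀_le {m n : ℕ} {s : Set ℝ} {ε : ENNReal} (h : gaussianReal 0 1 s ≤ ε) :
    ghzLaw m n {t | t.2.2 ∈ s} ≤ ε := by
  have : {t : (Fin m → ℝ) × (Fin n → ℝ) × ℝ | t.2.2 ∈ s} = Set.univ ×ˢ (Set.univ ×ˢ s) := by
    ext t; simp
  rw [this, ghzLaw, Measure.prod_prod, Measure.prod_prod]
  simpa using h

set_option maxHeartbeats 800000 in
/-- Typical behaviour holds with probability close to one in high dimension. -/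
theorem ghzLaw_not_typical_le {α β D ν η θ : ℝ} (hα0 : 0 < α) (hα1 : α ≤ 1) (hβ : 0 < β)
    (hβ1 : β ≤ 1) (hD : 0 < D) (hν : 0 ≤ ν)
    (h₁ : (1 - β) * ∫ z, np ν z ∂(gaussianReal 0 1) = β * ν)
    (h₂ : (1 - β) * ∫ z, np ν z ^ 2 ∂(gaussianReal 0 1) + β * (1 + ν ^ 2) = D)
    (hη : 0 < η) (hθ : 0 < θ) :
    ∃ N : ℕ, ∀ n m k : ℕ, N ≤ n → (m : ℝ) = α * n → (k : ℝ) = β * n →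
      ghzLaw m n {t | ¬ Typical k α D η t} ≤ ENNReal.ofReal θ := by
  -- The three constants are those of `dual_estimates`. Six exceptional events, of probability at
  -- most `θ / 6` each, are discarded.
  obtain ⟨δ, hδ, s1, s2, s3, s4, s5⟩ := exists_scale (α := α) hD hη (2 + 2 * ν) (2 + 4 * ν) (2 / β)
  have hθ6 : 0 < θ / 6 := by positivity
  obtain ⟨N₁, hN₁⟩ := weak_lln (memLp_np ν).1 hδ hθ6
  obtain ⟨N₂, hN₂⟩ := weak_lln (memLp_np ν).2 hδ hθ6
  obtain ⟨N₃, hN₃⟩ := weak_lln (memLp_two_of_le_exp_abs measurable_id abs_le_mul_exp) hδ hθ6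
  have hsq2 : MemLp (fun z : ℝ => z ^ 2) 2 (gaussianReal 0 1) :=
    memLp_two_of_le_exp_abs (by fun_prop) sq_le_mul_exp
  obtain ⟨N₄, hN₄⟩ := weak_lln hsq2 hδ hθ6
  obtain ⟨N₅, hN₅⟩ := exists_nat_gt (1 / (θ / 6 * η ^ 2))
  obtain ⟨N₆, hN₆⟩ := exists_nat_gt (N₄ / α)
  refine ⟨max (max (max N₁ N₂) (max N₃ N₄)) (max (max N₅ N₆) 1), fun n m k hn hm hk => ?_⟩
  simp only [max_le_iff] at hn
  obtain ⟨⟨⟨hn1, hn2⟩, hn3, hn4⟩, ⟨hn5, hn6⟩, hn7⟩ := hn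
  have hn0 : (0 : ℝ) < n := by exact_mod_cast hn7
  have hsn : 0 < √(n : ℝ) := Real.sqrt_pos.2 hn0
  have hkn : k ≤ n := by
    have : (k : ℝ) ≤ n := by rw [hk]; nlinarith
    exact_mod_cast this
  have hm4 : N₄ ≤ m := by
    have h : (N₄ : ℝ) ≤ m := by
      rw [hm, ← div_le_iff₀' hα0]
      exact hN₆.le.trans (by exact_mod_cast hn6)
    exact_mod_cast h
  have b1 := ghzLaw_h_le (m := m) (hN₁ n hn1 (firstIdx n k))
  have b2 := ghzLaw_h_le (m := m) (hN₂ n hn2 (firstIdx n k))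
  have b3 := ghzLaw_h_le (m := m) (hN₃ n hn3 (lastIdx n k))
  have b4 := ghzLaw_h_le (m := m) (hN₄ n hn4 (lastIdx n k))
  have b5 := ghzLaw_g_le (n := n) (hN₄ m hm4 Finset.univ)
  have b6 := ghzLaw_h₀_le (m := m) (n := n) (gaussian_abs_ge_le (θ := θ / 6) (c := η * √n) (by positivity) (by
    rw [mul_pow, Real.sq_sqrt hn0.le, ← mul_assoc, ← div_le_iff₀' (by positivity)]
    exact hN₅.le.trans (by exact_mod_cast hn5)))
  rw [card_firstIdx] at b1 b2
  rw [card_lastIdx hkn] at b3 b4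
  simp only [id_eq, integral_id_gaussianReal, mul_zero, sub_zero] at b3
  simp only [integral_gaussian_sq, mul_one] at b4 b5
  rw [Finset.card_univ, Fintype.card_fin] at b5
  have key := (measure_union_le _ _).trans (add_le_add b1 ((measure_union_le _ _).trans
    (add_le_add b2 ((measure_union_le _ _).trans (add_le_add b3 ((measure_union_le _ _).trans
      (add_le_add b4 ((measure_union_le _ _).trans (add_le_add b5 b6)))))))))
  have hsix : ENNReal.ofReal θ = ENNReal.ofReal (θ / 6) + (ENNReal.ofReal (θ / 6) +
      (ENNReal.ofReal (θ / 6) + (ENNReal.ofReal (θ / 6) + (ENNReal.ofReal (θ / 6) +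
        ENNReal.ofReal (θ / 6))))) := by
    repeat rw [← ENNReal.ofReal_add (by positivity) (by positivity)]
    congr 1; ring
  rw [hsix]
  refine (measure_mono ?_).trans key
  intro t ht
  by_contra hcon
  simp only [Set.mem_union, Set.mem_ofPred_eq, not_or] at hcon
  obtain ⟨q1, q2, q3, q4, q5, q6⟩ := hcon
  refine ht ?_
  replace q1 := not_le.1 q1
  replace q2 := not_le.1 q2
  replace q3 := not_le.1 q3
  replace q4 := not_le.1 q4
  replace q5 := not_le.1 q5
  replace q6 := not_le.1 q6
  obtain ⟨d1, w, hw, d2, d3⟩ := dual_estimates hkn hβ hν hδ hk h₁ h₂ q1.le q2.le q3.le q4.le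
  have q5' : |l2norm t.1 ^ 2 - α * n| < δ * n := by
    rw [l2norm_sq, ← hm]
    refine q5.trans_le (mul_le_mul_of_nonneg_left ?_ hδ.le)
    rw [hm]; nlinarith
  obtain ⟨q5l, q5u⟩ := abs_lt.1 q5'
  have hwneg : w ⬝ᵥ t.2.1 < 0 := by
    have := mul_pos hn0 s2
    linarith
  have hw0 : 0 < l2norm w := by
    refine lt_of_le_of_ne (l2norm_nonneg _) fun h => ?_
    rw [l2norm_eq_zero.1 h.symm, zero_dotProduct] at hwneg
    exact lt_irrefl _ hwneg
  refine ⟨?_, ?_, q6.le, ?_, (l2norm w)⁻¹ • w, ⟨fun i hi => ?_, ?_⟩, ?_, ?_⟩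
  · refine (mul_le_mul_of_nonneg_right s5 hsn.le).trans ?_
    rw [← Real.sqrt_mul' _ hn0.le]
    refine Real.sqrt_le_iff.2 ⟨l2norm_nonneg _, by linarith⟩
  · refine le_trans ?_ (mul_le_mul_of_nonneg_right s4 hsn.le)
    rw [← Real.sqrt_mul' _ hn0.le]
    exact Real.le_sqrt_of_sq_le (by linarith)
  · refine le_trans ?_ (mul_le_mul_of_nonneg_right s1 hsn.le)
    rw [← Real.sqrt_mul' _ hn0.le]
    exact Real.le_sqrt_of_sq_le (by linarith)
  · exact mul_nonneg (inv_nonneg.2 hw0.le) (hw.1 i hi)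
  · simp only [Pi.smul_apply, smul_eq_mul, ← Finset.mul_sum]
    exact mul_nonpos_of_nonneg_of_nonpos (inv_nonneg.2 hw0.le) hw.2
  · rw [l2norm_smul, abs_of_pos (inv_pos.2 hw0), inv_mul_cancel₀ hw0.ne']
  · rw [smul_dotProduct, smul_eq_mul, inv_mul_le_iff₀ hw0]
    -- If `√D ≤ η` the bound asks for no more than `w ⬝ᵥ h < 0`. Otherwise `s3` turns the bounds on
    -- `w ⬝ᵥ h` and `‖w‖` into one on the normalised direction.
    rcases le_or_gt (√D - η) 0 with hneg | hpos
    · have : 0 ≤ l2norm w * -((√D - η) * √n) :=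
        mul_nonneg hw0.le (by nlinarith)
      linarith
    · have h5 : (√D - η) * √n * l2norm w ≤ n * (D - (2 + 4 * ν) * δ - 2 / β * δ ^ 2) := by
        calc (√D - η) * √n * l2norm w
            ≤ (√D - η) * √n * (√n * (√(D + (2 + 2 * ν) * δ) + 2 / β * δ)) := by gcongr
          _ = n * ((√D - η) * (√(D + (2 + 2 * ν) * δ) + 2 / β * δ)) := by
              have : √(n : ℝ) * √n = n := Real.mul_self_sqrt hn0.le
              linear_combination (√D - η) * (√(D + (2 + 2 * ν) * δ) + 2 / β * δ) * this
          _ ≤ _ := mul_le_mul_of_nonneg_left s3 hn0.le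
      linarith

/-! ### Strong duality and Gaussian concentration. -/

/-- Strong duality for the dual problem. -/
lemma exists_dir_of_lt_xiGen {n k : ℕ} {h : Fin n → ℝ} {c : ℝ} (hc : 0 ≤ c)
    (hlt : c < xiGen k h) : ∃ w ∈ errCone n k, l2norm w = 1 ∧ w ⬝ᵥ h < -c := by
  -- `xiGen k h` is the distance from `-h` to the convex cone `T`. The open ball of this radius
  -- about `-h` misses `T`, and a separating functional yields the direction.
  set T : Set (Fin n → ℝ) := (fun p : ℝ × (Fin n → ℝ) => fun i => p.1 - p.2 i) '' dualFeasible n k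
    with hT
  have hball : Convex ℝ {x : Fin n → ℝ | l2norm (x + h) < xiGen k h} := by
    intro x hx y hy a b ha hb hab
    have hx' : l2norm (x + h) < xiGen k h := hx
    have hy' : l2norm (y + h) < xiGen k h := hy
    change l2norm _ < _
    have e : a • x + b • y + h = a • (x + h) + b • (y + h) := by
      rw [smul_add, smul_add]
      have : h = a • h + b • h := by rw [← add_smul, hab, one_smul]
      nth_rewrite 1 [this]
      abel
    rw [e]
    refine (l2norm_add_le _ _).trans_lt ?_
    rw [l2norm_smul, l2norm_smul, abs_of_nonneg ha, abs_of_nonneg hb]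
    have hb' : b = 1 - a := by linarith
    subst hb'
    rcases ha.eq_or_lt with rfl | ha'
    · simpa using hy'
    · nlinarith
  have hopen : IsOpen {x : Fin n → ℝ | l2norm (x + h) < xiGen k h} :=
    isOpen_lt (continuous_l2norm.comp (continuous_id.add continuous_const)) continuous_const
  have hTc : Convex ℝ T := by
    rintro _ ⟨p, hp, rfl⟩ _ ⟨q, hq, rfl⟩ a b ha hb hab
    refine ⟨a • p + b • q, ⟨?_, fun i => ⟨fun hi => ?_, fun hi => ?_⟩⟩, ?_⟩
    · exact add_nonneg (mul_nonneg ha hp.1) (mul_nonneg hb hq.1)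
    · simp [(hp.2 i).1 hi, (hq.2 i).1 hi]
    · exact add_nonneg (mul_nonneg ha ((hp.2 i).2 hi)) (mul_nonneg hb ((hq.2 i).2 hi))
    · ext i
      simp only [Prod.fst_add, Prod.smul_fst, Prod.snd_add, Prod.smul_snd, Pi.add_apply,
        Pi.smul_apply, smul_eq_mul]
      ring
  have hdisj : Disjoint {x : Fin n → ℝ | l2norm (x + h) < xiGen k h} T := by
    rw [Set.disjoint_left]
    rintro _ hx ⟨p, hp, rfl⟩
    have hx' : l2norm ((fun i => p.1 - p.2 i) + h) < xiGen k h := hx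
    refine absurd (xiGen_le (h := h) hp) (not_le.2 (lt_of_eq_of_lt ?_ hx'))
    congr 1
    ext i
    simp only [Pi.add_apply]
    ring
  obtain ⟨f, u, hf, hfT⟩ := geometric_hahn_banach_open hball hopen hTc hdisj
  have hu : u ≤ 0 := by
    have := hfT 0 ⟨0, zero_mem_dualFeasible n k, by ext i; simp⟩
    simpa using this
  -- A linear functional bounded below on a cone is nonnegative on it; otherwise scaling by `(u - 1)
  -- / y` gives the value `u - 1`.
  have hcone : ∀ p ∈ dualFeasible n k, 0 ≤ f (fun i => p.1 - p.2 i) := by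
    intro p hp
    by_contra hneg
    push Not at hneg
    set y := f (fun i => p.1 - p.2 i) with hy
    have hs : 0 ≤ (u - 1) / y := div_nonneg_of_nonpos (by linarith) hneg.le
    have := hfT (((u - 1) / y) • (fun i => p.1 - p.2 i)) ⟨((u - 1) / y) • p,
      ⟨mul_nonneg hs hp.1, fun i => ⟨fun hi => by simp [(hp.2 i).1 hi],
        fun hi => mul_nonneg hs ((hp.2 i).2 hi)⟩⟩, by
        ext i
        simp only [Prod.smul_fst, Prod.smul_snd, Pi.smul_apply, smul_eq_mul]
        ring⟩
    rw [map_smul, smul_eq_mul, ← hy, div_mul_cancel₀ _ hneg.ne] at this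
    linarith
  set w : Fin n → ℝ := fun i => -f (Pi.single i 1) with hw
  have hfw : ∀ x, f x = -(w ⬝ᵥ x) := by
    intro x
    have : x = ∑ i, x i • (Pi.single i (1 : ℝ) : Fin n → ℝ) := by
      ext j; simp [Finset.sum_apply, Pi.single_apply]
    conv_lhs => rw [this]
    rw [map_sum, dotProduct, ← Finset.sum_neg_distrib]
    refine Finset.sum_congr rfl fun i _ => ?_
    rw [map_smul, hw, smul_eq_mul]
    ring
  have hwC : w ∈ errCone n k := by
    refine ⟨fun i hi => ?_, ?_⟩
    · have h1 := hcone (0, Pi.single i 1) ⟨le_rfl, fun j => ⟨fun hj => ?_, fun _ => ?_⟩⟩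
      · rw [hfw] at h1
        have h2 : w ⬝ᵥ (fun j => (0 : ℝ) - (Pi.single i (1 : ℝ) : Fin n → ℝ) j) = -w i := by
          simp [dotProduct, Pi.single_apply]
        rw [h2] at h1
        linarith
      · exact Pi.single_eq_of_ne (by rintro rfl; omega) _
      · simp only [Pi.single_apply]; split_ifs <;> norm_num
    · have h1 := hcone (1, 0) ⟨zero_le_one, fun j => ⟨fun _ => rfl, fun _ => le_rfl⟩⟩
      rw [hfw] at h1
      have h2 : w ⬝ᵥ (fun j => (1 : ℝ) - (0 : Fin n → ℝ) j) = ∑ i, w i := by simp [dotProduct]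
      rw [h2] at h1
      linarith
  have hkey : ∀ y : Fin n → ℝ, l2norm y < xiGen k h → w ⬝ᵥ h < w ⬝ᵥ y := by
    intro y hy
    have h1 := hf (y - h) (by change l2norm (y - h + h) < _; rwa [sub_add_cancel])
    rw [hfw, dotProduct_sub] at h1
    linarith
  have hw0 : 0 < l2norm w := by
    refine lt_of_le_of_ne (l2norm_nonneg _) fun h0 => ?_
    have := hkey 0 (by rw [l2norm_zero]; linarith)
    rw [l2norm_eq_zero.1 h0.symm] at this
    simp at this
  refine ⟨(l2norm w)⁻¹ • w, ⟨fun i hi => mul_nonneg (inv_nonneg.2 hw0.le) (hwC.1 i hi), ?_⟩, ?_, ?_⟩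
  · simp only [Pi.smul_apply, smul_eq_mul, ← Finset.mul_sum]
    exact mul_nonpos_of_nonneg_of_nonpos (inv_nonneg.2 hw0.le) hwC.2
  · rw [l2norm_smul, abs_of_pos (inv_pos.2 hw0), inv_mul_cancel₀ hw0.ne']
  -- The test point `-c w / ‖w‖` has norm `c < xiGen k h`.
  · have h1 := hkey ((-c * (l2norm w)⁻¹) • w) (by
      rw [l2norm_smul, abs_mul, abs_neg, abs_of_nonneg hc, abs_of_pos (inv_pos.2 hw0), mul_assoc,
        inv_mul_cancel₀ hw0.ne', mul_one]
      exact hlt)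
    rw [dotProduct_smul, smul_eq_mul, ← l2norm_sq_eq_dotProduct] at h1
    rw [smul_dotProduct, smul_eq_mul, inv_mul_lt_iff₀ hw0]
    refine h1.trans_eq ?_
    field_simp

lemma xiGen_sub_le {n k : ℕ} (h h' : Fin n → ℝ) : xiGen k h - l2norm (h - h') ≤ xiGen k h' := by
  refine le_csInf (Set.Nonempty.image _ ⟨0, zero_mem_dualFeasible n k⟩) ?_
  rintro _ ⟨p, hp, rfl⟩
  have h1 := xiGen_le (h := h) hp
  have h2 : (fun i => h i + p.1 - p.2 i) = (fun i => h' i + p.1 - p.2 i) + (h - h') := by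
    ext i; simp only [Pi.add_apply, Pi.sub_apply]; ring
  have h3 := l2norm_add_le (fun i => h' i + p.1 - p.2 i) (h - h')
  rw [← h2] at h3
  change _ ≤ l2norm (fun i => h' i + p.1 - p.2 i)
  linarith

lemma continuous_xiGen (n k : ℕ) : Continuous (xiGen k : (Fin n → ℝ) → ℝ) := by
  rw [continuous_iff_continuousAt]
  intro h
  have hl : Filter.Tendsto (fun h' : Fin n → ℝ => l2norm (h' - h)) (nhds h) (nhds 0) := by
    have : Continuous fun h' : Fin n → ℝ => l2norm (h' - h) :=
      continuous_l2norm.comp (continuous_id.sub continuous_const)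
    simpa [l2norm_zero] using this.tendsto h
  refine tendsto_of_tendsto_of_tendsto_of_le_of_le
    (g := fun h' => xiGen k h - l2norm (h' - h)) (h := fun h' => xiGen k h + l2norm (h' - h))
    (by simpa using tendsto_const_nhds.sub hl) (by simpa using tendsto_const_nhds.add hl) ?_ ?_
  · intro h'
    have := xiGen_sub_le (k := k) h h'
    rw [l2norm_sub_comm] at this
    exact this
  · intro h'
    have := xiGen_sub_le (k := k) h' h
    change _ ≤ _ + _
    linarith

lemma xiGen_le_l2norm {n : ℕ} (k : ℕ) (h : Fin n → ℝ) : xiGen k h ≤ l2norm h := by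
  simpa using xiGen_le (h := h) (zero_mem_dualFeasible n k)

/-- Gaussian concentration for suprema of linear functionals. -/
lemma sup_concentration {ι : Type*} [Fintype ι] {T : Set (ι → ℝ)} (hT : T.Nonempty)
    (hT1 : ∀ w ∈ T, l2norm w ≤ 1) {a b : ℝ} (hab : b ≤ a) :
    stdG ι {z | ∃ w ∈ T, a < w ⬝ᵥ z} * stdG ι {z | ∀ w ∈ T, w ⬝ᵥ z ≤ b}
      ≤ ENNReal.ofReal (Real.exp (-(a - b) ^ 2 / 8)) := by
  obtain ⟨w, hwT, hw⟩ := exists_dense_seq hT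
  have hg : ∀ i j, |∑ l, w i l * w j l| ≤ 1 := fun i j =>
    (abs_dotProduct_le (w i) (w j)).trans
      (mul_le_one₀ (hT1 _ (hwT i)) (l2norm_nonneg _) (hT1 _ (hwT j)))
  -- Both families are the same and do not depend on the row, so the comparison of two independent
  -- copies becomes a concentration inequality.
  have key := gordon_tail (x := fun q : ℕ × ℕ => w q.2) (y := fun q : ℕ × ℕ => w q.2) one_pos
    (fun _ => 0) (fun a b => hg _ _) (fun a b => hg _ _) (fun _ _ _ => rfl) (fun _ _ => le_rfl) hab
  rw [mul_one] at key
  refine (mul_le_mul' (measure_mono ?_) (measure_mono ?_)).trans key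
  · rintro z ⟨x, hx, hxz⟩ i
    have hop : IsOpen {x : ι → ℝ | a < x ⬝ᵥ z} := by
      refine isOpen_lt continuous_const ?_
      unfold dotProduct
      fun_prop
    obtain ⟨j, hj⟩ := hw _ hop ⟨x, hx, hxz⟩
    exact ⟨j, by rw [add_zero]; exact le_of_lt hj⟩
  · intro z hz
    exact ⟨0, fun j => by rw [add_zero]; exact hz _ (hwT j)⟩

lemma le_two_mul_of_mul_le {x y e : ENNReal} (h : x * y ≤ e) (hy : 2⁻¹ ≤ y) : x ≤ 2 * e := by
  calc x = 2 * (x * 2⁻¹) := by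
        rw [mul_comm x, ← mul_assoc, ENNReal.mul_inv_cancel two_ne_zero ENNReal.ofNat_ne_top, one_mul]
    _ ≤ 2 * e := by gcongr; exact (mul_le_mul_right hy x).trans h

/-- By weak and strong duality, the dual value is the supremum of `-wᵀz` over cone vectors of norm
at most one, so `sup_concentration` applies around any level `b` reached with probability one half.
-/
lemma xiGen_upper_tail {n k : ℕ} {a b : ℝ} (hb : 0 ≤ b) (hab : b ≤ a)
    (h : 2⁻¹ ≤ stdG (Fin n) {z | xiGen k z ≤ b}) :
    stdG (Fin n) {z | a < xiGen k z} ≤ 2 * ENNReal.ofReal (Real.exp (-(a - b) ^ 2 / 8)) := by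
  have key := sup_concentration (T := {w : Fin n → ℝ | -w ∈ errCone n k ∧ l2norm w ≤ 1})
    ⟨0, by simp [errCone], by rw [l2norm_zero]; exact zero_le_one⟩ (fun w hw => hw.2) hab
  refine (measure_mono ?_).trans (le_two_mul_of_mul_le key (h.trans (measure_mono ?_)))
  · intro z hz
    obtain ⟨w, hw, hw1, hwz⟩ := exists_dir_of_lt_xiGen (hb.trans hab) hz
    refine ⟨-w, ⟨by rwa [neg_neg], by rw [l2norm_neg, hw1]⟩, ?_⟩
    rw [neg_dotProduct]
    linarith
  · rintro z hz w ⟨hw, hw1⟩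
    have h1 := neg_xiGen_mul_le z hw
    rw [l2norm_neg, neg_dotProduct] at h1
    have h2 := mul_le_mul_of_nonneg_left hw1 (xiGen_nonneg (k := k) z)
    have h3 : xiGen k z ≤ b := hz
    linarith

lemma l2norm_lower_tail {m : ℕ} [NeZero m] {a b : ℝ} (hab : b ≤ a)
    (h : 2⁻¹ ≤ stdG (Fin m) {z | a < l2norm z}) :
    stdG (Fin m) {z | l2norm z ≤ b} ≤ 2 * ENNReal.ofReal (Real.exp (-(a - b) ^ 2 / 8)) := by
  have key := sup_concentration (T := {w : Fin m → ℝ | l2norm w = 1})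
    (by obtain ⟨u, hu, _⟩ := exists_unit_dotProduct_eq (0 : Fin m → ℝ); exact ⟨u, hu⟩)
    (fun w hw => le_of_eq hw) hab
  rw [mul_comm] at key
  refine (measure_mono ?_).trans (le_two_mul_of_mul_le key (h.trans (measure_mono ?_)))
  · intro z hz w hw
    have := dotProduct_le_l2norm w z
    have hw' : l2norm w = 1 := hw
    rw [hw', one_mul] at this
    exact this.trans hz
  · intro z hz
    obtain ⟨u, hu, huz⟩ := exists_unit_dotProduct_eq z
    exact ⟨u, hu, by rw [huz]; exact hz⟩

/-! ### Negative moments and integrability of `‖w_gen+‖₂`. -/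

/-- The truncated power `s₊ ^ (-3/4)`. -/
noncomputable def negPow (s : ℝ) : ENNReal :=
  if 0 < s then ENNReal.ofReal (s ^ (-(3 / 4) : ℝ)) else 0

lemma measurable_negPow : Measurable negPow :=
  Measurable.ite measurableSet_Ioi (by fun_prop) measurable_const

lemma lintegral_negPow_Ioc : ∫⁻ s in Set.Ioc (0 : ℝ) 1, negPow s ≠ ⊤ := by
  have h1 : IntervalIntegrable (fun s : ℝ => s ^ (-(3 / 4) : ℝ)) volume 0 1 :=
    intervalIntegral.intervalIntegrable_rpow' (by norm_num)
  have h2 := ((intervalIntegrable_iff_integrableOn_Ioc_of_le zero_le_one).1 h1).lintegral_lt_top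
  refine ne_of_lt (lt_of_le_of_lt (le_of_eq ?_) h2)
  exact setLIntegral_congr_fun measurableSet_Ioc fun s hs => if_pos hs.1

lemma gaussianReal_le_volume : gaussianReal 0 1 ≤ volume := by
  rw [gaussianReal_of_var_ne_zero 0 one_ne_zero]
  refine (withDensity_mono (Filter.Eventually.of_forall fun x => ?_)).trans_eq withDensity_one
  rw [gaussianPDF, Pi.one_apply, ← ENNReal.ofReal_one]
  refine ENNReal.ofReal_le_ofReal ?_
  rw [gaussianPDFReal]
  refine mul_le_one₀ (inv_le_one_of_one_le₀ ?_) (Real.exp_nonneg _) (Real.exp_le_one_iff.2 ?_)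
  · rw [Real.one_le_sqrt]
    have := Real.two_le_pi
    push_cast
    linarith
  · exact div_nonpos_of_nonpos_of_nonneg (neg_nonpos.2 (sq_nonneg _)) (by positivity)

/-- In polar coordinates `r dr` becomes half of `ds` for `s = r²`, so the shift by `c` is a
translation of the line and the bound is uniform in `c`. The exponent `3/4 < 1` makes the integral
near zero finite. -/
lemma lintegral_negPow_plane_le (c : ℝ) :
    ∫⁻ p : ℝ × ℝ, (if p.1 ^ 2 + p.2 ^ 2 - c ≤ 1 then negPow (p.1 ^ 2 + p.2 ^ 2 - c) else 0)
      ≤ (∫⁻ s in Set.Ioc (0 : ℝ) 1, negPow s) * ENNReal.ofReal (2 * Real.pi) := by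
  set G : ℝ → ENNReal := fun s => if s ≤ 1 then negPow s else 0 with hG
  have hGm : Measurable G := Measurable.ite measurableSet_Iic measurable_negPow measurable_const
  change ∫⁻ p : ℝ × ℝ, G (p.1 ^ 2 + p.2 ^ 2 - c) ≤ _
  rw [← lintegral_comp_polarCoord_symm]
  have e : ∀ p : ℝ × ℝ, ENNReal.ofReal p.1 • G ((polarCoord.symm p).1 ^ 2 +
      (polarCoord.symm p).2 ^ 2 - c) = (ENNReal.ofReal p.1 * G (p.1 ^ 2 - c)) * 1 := by
    intro p
    rw [polarCoord_symm_apply, smul_eq_mul, mul_one]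
    congr 3
    linear_combination p.1 ^ 2 * Real.cos_sq_add_sin_sq p.2
  simp_rw [e]
  rw [polarCoord_target, Measure.volume_eq_prod, ← Measure.prod_restrict,
    lintegral_prod_mul (f := fun r => ENNReal.ofReal r * G (r ^ 2 - c)) (g := fun _ => 1)
      (by fun_prop) (by fun_prop)]
  have hang : ∫⁻ _ in Set.Ioo (-Real.pi) Real.pi, (1 : ENNReal) = ENNReal.ofReal (2 * Real.pi) := by
    rw [setLIntegral_one, Real.volume_Ioo]
    congr 1; ring
  rw [hang]
  refine mul_le_mul_left ?_ _
  have hsub := lintegral_image_eq_lintegral_abs_deriv_mul (s := Set.Ioi (0 : ℝ))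
    (f := fun r => r ^ 2) (f' := fun r => 2 * r) measurableSet_Ioi
    (fun r _ => by simpa using (hasDerivAt_pow 2 r).hasDerivWithinAt)
    (fun x hx y hy hxy => by
      have hx' : (0 : ℝ) < x := hx
      have hy' : (0 : ℝ) < y := hy
      exact (pow_left_inj₀ hx'.le hy'.le two_ne_zero).1 hxy) (fun s => G (s - c))
  calc ∫⁻ r in Set.Ioi 0, ENNReal.ofReal r * G (r ^ 2 - c)
      ≤ ∫⁻ r in Set.Ioi 0, ENNReal.ofReal |2 * r| * G (r ^ 2 - c) := by
        refine setLIntegral_mono' measurableSet_Ioi fun r hr => ?_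
        have hr' : (0 : ℝ) < r := hr
        refine mul_le_mul_left (ENNReal.ofReal_le_ofReal ?_) _
        rw [abs_of_pos (by positivity)]
        linarith
    _ = ∫⁻ s in (fun r : ℝ => r ^ 2) '' Set.Ioi 0, G (s - c) := hsub.symm
    _ ≤ ∫⁻ s, G (s - c) := setLIntegral_le_lintegral _ _
    _ = ∫⁻ s, G s := lintegral_sub_right_eq_self G c
    _ = ∫⁻ s in Set.Ioc (0 : ℝ) 1, negPow s := by
        rw [← lintegral_indicator measurableSet_Ioc]
        refine lintegral_congr fun s => ?_
        simp only [hG, Set.indicator, Set.mem_Ioc, negPow]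
        split_ifs <;> first | rfl | (exfalso; tauto)

/-- The negative moment of the square of a planar Gaussian, uniformly in the shift. -/
lemma exists_lintegral_negPow_gaussian_le : ∃ K : ℝ, 0 ≤ K ∧ ∀ c : ℝ,
    ∫⁻ p : ℝ × ℝ, negPow (p.1 ^ 2 + p.2 ^ 2 - c) ∂((gaussianReal 0 1).prod (gaussianReal 0 1))
      ≤ ENNReal.ofReal K := by
  set L := (∫⁻ s in Set.Ioc (0 : ℝ) 1, negPow s) * ENNReal.ofReal (2 * Real.pi) with hL
  have hLtop : L ≠ ⊤ := ENNReal.mul_ne_top lintegral_negPow_Ioc ENNReal.ofReal_ne_top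
  refine ⟨L.toReal + 1, by positivity, fun c => ?_⟩
  rw [ENNReal.ofReal_add ENNReal.toReal_nonneg zero_le_one, ENNReal.ofReal_toReal hLtop,
    ENNReal.ofReal_one]
  have hm : Measurable fun p : ℝ × ℝ =>
      if p.1 ^ 2 + p.2 ^ 2 - c ≤ 1 then negPow (p.1 ^ 2 + p.2 ^ 2 - c) else 0 :=
    Measurable.ite (measurableSet_le (by fun_prop) measurable_const)
      (measurable_negPow.comp (by fun_prop)) measurable_const
  calc ∫⁻ p : ℝ × ℝ, negPow (p.1 ^ 2 + p.2 ^ 2 - c) ∂((gaussianReal 0 1).prod (gaussianReal 0 1))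
      ≤ ∫⁻ p : ℝ × ℝ, ((if p.1 ^ 2 + p.2 ^ 2 - c ≤ 1 then negPow (p.1 ^ 2 + p.2 ^ 2 - c) else 0) + 1)
        ∂((gaussianReal 0 1).prod (gaussianReal 0 1)) := by
        refine lintegral_mono fun p => ?_
        dsimp only
        split_ifs with h
        · exact le_self_add
        · rw [zero_add, negPow]
          push Not at h
          rw [if_pos (by linarith), ← ENNReal.ofReal_one]
          exact ENNReal.ofReal_le_ofReal (Real.rpow_le_one_of_one_le_of_nonpos h.le (by norm_num))
    _ = ∫⁻ p : ℝ × ℝ, (if p.1 ^ 2 + p.2 ^ 2 - c ≤ 1 then negPow (p.1 ^ 2 + p.2 ^ 2 - c) else 0)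
        ∂((gaussianReal 0 1).prod (gaussianReal 0 1)) + 1 := by
        rw [lintegral_add_left hm, lintegral_one, measure_univ]
    _ ≤ L + 1 := by
        gcongr
        refine le_trans ?_ (lintegral_negPow_plane_le c)
        rw [Measure.volume_eq_prod]
        exact lintegral_mono' (Measure.prod_mono gaussianReal_le_volume gaussianReal_le_volume) le_rfl

lemma lintegral_stdG_update {ι : Type*} [Fintype ι] [DecidableEq ι] (k : ι) {F : (ι → ℝ) → ENNReal}
    (hF : Measurable F) : ∫⁻ z, F z ∂(stdG ι) =
      ∫⁻ z, ∫⁻ t, F (Function.update z k t) ∂(gaussianReal 0 1) ∂(stdG ι) := by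
  have h := measurePreserving_update k
  rw [← h.lintegral_comp hF]
  exact lintegral_prod (fun p : (ι → ℝ) × ℝ => F (Function.update p.1 k p.2))
    (hF.comp h.measurable).aemeasurable

/-- Adding coordinates does not affect the uniform bound for the negative moment. -/
lemma lintegral_negPow_l2norm_le {K : ℝ} (hK : ∀ c : ℝ,
    ∫⁻ p : ℝ × ℝ, negPow (p.1 ^ 2 + p.2 ^ 2 - c) ∂((gaussianReal 0 1).prod (gaussianReal 0 1))
      ≤ ENNReal.ofReal K) {m : ℕ} (hm : 2 ≤ m) (c : ℝ) :
    ∫⁻ g, negPow (l2norm g ^ 2 - c) ∂(stdG (Fin m)) ≤ ENNReal.ofReal K := by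
  set i : Fin m := ⟨0, by omega⟩ with hi
  set j : Fin m := ⟨1, by omega⟩ with hj
  have hij : i ≠ j := by rw [hi, hj, Ne, Fin.mk.injEq]; norm_num
  have hF : Measurable fun g : Fin m → ℝ => negPow (l2norm g ^ 2 - c) :=
    measurable_negPow.comp ((continuous_l2norm.pow 2).sub continuous_const).measurable
  have hF2 : Measurable fun z : Fin m → ℝ =>
      ∫⁻ t, negPow (l2norm (Function.update z i t) ^ 2 - c) ∂(gaussianReal 0 1) :=
    Measurable.lintegral_prod_right' (hF.comp (measurePreserving_update i).measurable)
  rw [lintegral_stdG_update i hF, lintegral_stdG_update j hF2]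
  -- Two coordinates are integrated out, and the squares of the others are absorbed into the shift
  -- `c`.
  have hcoord : ∀ (z : Fin m → ℝ) (s t : ℝ),
      l2norm (Function.update (Function.update z j s) i t) ^ 2
        = s ^ 2 + t ^ 2 + ∑ l ∈ (Finset.univ.erase i).erase j, z l ^ 2 := by
    intro z s t
    rw [l2norm_sq, ← Finset.add_sum_erase _ _ (Finset.mem_univ i),
      ← Finset.add_sum_erase _ _ (Finset.mem_erase.2 ⟨hij.symm, Finset.mem_univ j⟩)]
    have : ∑ l ∈ (Finset.univ.erase i).erase j, Function.update (Function.update z j s) i t l ^ 2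
        = ∑ l ∈ (Finset.univ.erase i).erase j, z l ^ 2 := by
      refine Finset.sum_congr rfl fun l hl => ?_
      simp only [Finset.mem_erase] at hl
      rw [Function.update_of_ne hl.2.1, Function.update_of_ne hl.1]
    rw [this, Function.update_self, Function.update_of_ne hij.symm, Function.update_self]
    ring
  calc ∫⁻ z, ∫⁻ s, ∫⁻ t, negPow (l2norm (Function.update (Function.update z j s) i t) ^ 2 - c)
        ∂(gaussianReal 0 1) ∂(gaussianReal 0 1) ∂(stdG (Fin m))
      ≤ ∫⁻ _, ENNReal.ofReal K ∂(stdG (Fin m)) := by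
        refine lintegral_mono fun z => ?_
        refine le_trans (le_of_eq ?_) (hK (c - ∑ l ∈ (Finset.univ.erase i).erase j, z l ^ 2))
        have hmeas : Measurable fun p : ℝ × ℝ => negPow (p.1 ^ 2 + p.2 ^ 2 -
            (c - ∑ l ∈ (Finset.univ.erase i).erase j, z l ^ 2)) :=
          measurable_negPow.comp (by fun_prop)
        rw [lintegral_prod _ hmeas.aemeasurable]
        refine lintegral_congr fun s => lintegral_congr fun t => ?_
        rw [hcoord]
        congr 1; ring
    _ = ENNReal.ofReal K := by rw [lintegral_const, measure_univ, mul_one]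

instance (m n : ℕ) : IsProbabilityMeasure (ghLaw m n) :=
  inferInstanceAs (IsProbabilityMeasure ((stdG (Fin m)).prod (stdG (Fin n))))

instance (m n : ℕ) : IsProbabilityMeasure (ghzLaw m n) :=
  inferInstanceAs (IsProbabilityMeasure
    ((stdG (Fin m)).prod ((stdG (Fin n)).prod (gaussianReal 0 1))))

lemma measurePreserving_gh (m n : ℕ) :
    MeasurePreserving (fun t : (Fin m → ℝ) × (Fin n → ℝ) × ℝ => (t.1, t.2.1))
      (ghzLaw m n) (ghLaw m n) :=
  (MeasurePreserving.id (stdG (Fin m))).prod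
    (measurePreserving_fst (μ := stdG (Fin n)) (ν := gaussianReal 0 1))

lemma measurable_wGenNorm (m n k : ℕ) (σ : ℝ) :
    Measurable fun gh : (Fin m → ℝ) × (Fin n → ℝ) => wGenNorm k σ gh.1 gh.2 := by
  have h1 : Measurable fun gh : (Fin m → ℝ) × (Fin n → ℝ) => xiGen k gh.2 :=
    (continuous_xiGen n k).measurable.comp measurable_snd
  have h2 : Measurable fun gh : (Fin m → ℝ) × (Fin n → ℝ) => l2norm gh.1 :=
    continuous_l2norm.measurable.comp measurable_fst
  unfold wGenNorm
  exact Measurable.ite (measurableSet_lt h1 h2)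
    ((h1.div ((h2.pow_const 2).sub (h1.pow_const 2)).sqrt).const_mul σ) measurable_const

lemma wGenNorm_nonneg {m n k : ℕ} {σ : ℝ} (hσ : 0 ≤ σ) (g : Fin m → ℝ) (h : Fin n → ℝ) :
    0 ≤ wGenNorm k σ g h := by
  have := xiGen_nonneg (k := k) h
  unfold wGenNorm
  split_ifs <;> positivity

/-- With `x = s ^ (-1/4)` this reads `x² ≤ δ x³ + δ⁻²`, by cases on `δ x ≤ 1`. Because `3/4 > 1/2`,
the singular term can carry an arbitrarily small coefficient. -/
lemma inv_sqrt_le {s δ : ℝ} (hs : 0 < s) (hδ : 0 < δ) :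
    (√s)⁻¹ ≤ δ * s ^ (-(3 / 4) : ℝ) + (δ ^ 2)⁻¹ := by
  set x := s ^ (-(1 / 4) : ℝ) with hx
  have hx0 : 0 < x := Real.rpow_pos_of_pos hs _
  have h1 : (√s)⁻¹ = x ^ 2 := by
    rw [Real.sqrt_eq_rpow, ← Real.rpow_neg hs.le, hx, ← Real.rpow_natCast, ← Real.rpow_mul hs.le]
    norm_num
  have h2 : s ^ (-(3 / 4) : ℝ) = x ^ 3 := by
    rw [hx, ← Real.rpow_natCast, ← Real.rpow_mul hs.le]
    norm_num
  rw [h1, h2]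
  rcases le_total (δ * x) 1 with h | h
  · have : x ^ 2 ≤ (δ ^ 2)⁻¹ := by
      rw [← one_div, le_div_iff₀ (by positivity), ← mul_pow, mul_comm]
      exact pow_le_one₀ (by positivity) h
    have := mul_pos hδ (pow_pos hx0 3)
    linarith
  · have : 0 < (δ ^ 2)⁻¹ := by positivity
    nlinarith [pow_pos hx0 2]

/-- The parameters `δ` and `τ` put small coefficients on the two unbounded terms; only the last,
constant term is large. -/
lemma ofReal_wGenNorm_le {m n k : ℕ} {σ δ τ : ℝ} (hσ : 0 ≤ σ) (hδ : 0 < δ) (hτ : 0 < τ)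
    (g : Fin m → ℝ) (h : Fin n → ℝ) :
    ENNReal.ofReal (wGenNorm k σ g h) ≤
      ENNReal.ofReal (σ * δ * (1 + l2norm h ^ 2)) * negPow (l2norm g ^ 2 - xiGen k h ^ 2)
      + (ENNReal.ofReal (σ * (δ ^ 2)⁻¹ * τ * l2norm h ^ 2)
        + ENNReal.ofReal (σ * (δ ^ 2)⁻¹ * τ⁻¹)) := by
  have hξ := xiGen_nonneg (k := k) h
  unfold wGenNorm
  split_ifs with hlt
  · have hs : 0 < l2norm g ^ 2 - xiGen k h ^ 2 := by
      have := l2norm_nonneg g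
      nlinarith
    rw [negPow, if_pos hs, ← ENNReal.ofReal_mul (by positivity),
      ← ENNReal.ofReal_add (by positivity) (by positivity),
      ← ENNReal.ofReal_add (by positivity) (by positivity)]
    refine ENNReal.ofReal_le_ofReal ?_
    set s := l2norm g ^ 2 - xiGen k h ^ 2
    have h1 := inv_sqrt_le hs hδ
    have h2 := xiGen_le_l2norm k h
    have h3 : xiGen k h ≤ 1 + l2norm h ^ 2 := by nlinarith [sq_nonneg (l2norm h - 1)]
    have h4 : xiGen k h ≤ τ * l2norm h ^ 2 + τ⁻¹ := by
      have e : τ * l2norm h ^ 2 + τ⁻¹ - l2norm h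
          = τ⁻¹ * ((τ * l2norm h - 1 / 2) ^ 2 + 3 / 4) := by field_simp; ring
      have : 0 ≤ τ⁻¹ * ((τ * l2norm h - 1 / 2) ^ 2 + 3 / 4) := by positivity
      linarith
    have hp : 0 ≤ s ^ (-(3 / 4) : ℝ) := Real.rpow_nonneg hs.le _
    calc σ * (xiGen k h / √s) = σ * xiGen k h * (√s)⁻¹ := by rw [div_eq_mul_inv, mul_assoc]
      _ ≤ σ * xiGen k h * (δ * s ^ (-(3 / 4) : ℝ) + (δ ^ 2)⁻¹) := by gcongr
      _ = σ * δ * xiGen k h * s ^ (-(3 / 4) : ℝ) + σ * (δ ^ 2)⁻¹ * xiGen k h := by ring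
      _ ≤ σ * δ * (1 + l2norm h ^ 2) * s ^ (-(3 / 4) : ℝ)
          + σ * (δ ^ 2)⁻¹ * (τ * l2norm h ^ 2 + τ⁻¹) := by gcongr
      _ = _ := by ring
  · rw [ENNReal.ofReal_zero]
    exact bot_le

lemma lintegral_l2norm_sq (n : ℕ) :
    ∫⁻ h, ENNReal.ofReal (l2norm h ^ 2) ∂(stdG (Fin n)) = ENNReal.ofReal n := by
  have h1 : ∫⁻ t, ENNReal.ofReal (t ^ 2) ∂(gaussianReal 0 1) = 1 := by
    have hi : Integrable (fun t : ℝ => t ^ 2) (gaussianReal 0 1) :=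
      (memLp_two_of_le_exp_abs (by fun_prop) sq_le_mul_exp).integrable one_le_two
    rw [← ofReal_integral_eq_lintegral_ofReal hi (Filter.Eventually.of_forall fun t => sq_nonneg t),
      integral_gaussian_sq, ENNReal.ofReal_one]
  have h2 : ∀ h : Fin n → ℝ, ENNReal.ofReal (l2norm h ^ 2) = ∑ i, ENNReal.ofReal (h i ^ 2) := by
    intro h
    rw [l2norm_sq, ENNReal.ofReal_sum_of_nonneg fun i _ => sq_nonneg _]
  simp_rw [h2]
  rw [lintegral_finsetSum _ fun i _ => by fun_prop]
  have h3 : ∀ i : Fin n, ∫⁻ h, ENNReal.ofReal (h i ^ 2) ∂(stdG (Fin n)) = 1 := by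
    intro i
    rw [← h1, ← (measurePreserving_eval (fun _ : Fin n => gaussianReal 0 1) i).lintegral_comp
      (f := fun t => ENNReal.ofReal (t ^ 2)) (by fun_prop)]
  simp [h3]

/-- The two unbounded terms are integrated over the whole space, where their means are polynomial in
`n`. Only the constant term uses the small probability of `S`. -/
lemma setLIntegral_wGenNorm_le {m n k : ℕ} (hm : 2 ≤ m) {σ δ τ K : ℝ} (hσ : 0 ≤ σ) (hδ : 0 < δ)
    (hτ : 0 < τ) (hK0 : 0 ≤ K) (hK : ∀ c : ℝ,
      ∫⁻ p : ℝ × ℝ, negPow (p.1 ^ 2 + p.2 ^ 2 - c) ∂((gaussianReal 0 1).prod (gaussianReal 0 1))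
        ≤ ENNReal.ofReal K) {p : ℝ} (hp : 0 ≤ p) {S : Set ((Fin m → ℝ) × (Fin n → ℝ))}
    (hS : ghLaw m n S ≤ ENNReal.ofReal p) :
    ∫⁻ gh in S, ENNReal.ofReal (wGenNorm k σ gh.1 gh.2) ∂(ghLaw m n) ≤
      ENNReal.ofReal (σ * (δ * (1 + n) * K + (δ ^ 2)⁻¹ * τ * n + (δ ^ 2)⁻¹ * τ⁻¹ * p)) := by
  have hmξ : Measurable (xiGen k : (Fin n → ℝ) → ℝ) := (continuous_xiGen n k).measurable
  have hml : ∀ l : ℕ, Measurable (l2norm : (Fin l → ℝ) → ℝ) := fun l => continuous_l2norm.measurable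
  have i1 : ∫⁻ gh : (Fin m → ℝ) × (Fin n → ℝ), ENNReal.ofReal (σ * δ * (1 + l2norm gh.2 ^ 2)) *
      negPow (l2norm gh.1 ^ 2 - xiGen k gh.2 ^ 2) ∂(ghLaw m n)
      ≤ ENNReal.ofReal (σ * δ * (1 + n) * K) := by
    have hmeas : Measurable fun gh : (Fin m → ℝ) × (Fin n → ℝ) =>
        ENNReal.ofReal (σ * δ * (1 + l2norm gh.2 ^ 2)) *
        negPow (l2norm gh.1 ^ 2 - xiGen k gh.2 ^ 2) := by
      refine Measurable.mul ?_ (measurable_negPow.comp ?_)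
      · exact (((((hml n).comp measurable_snd).pow_const 2).const_add 1).const_mul _).ennreal_ofReal
      · exact (((hml m).comp measurable_fst).pow_const 2).sub
          ((hmξ.comp measurable_snd).pow_const 2)
    change ∫⁻ gh : (Fin m → ℝ) × (Fin n → ℝ), _ ∂((stdG (Fin m)).prod (stdG (Fin n))) ≤ _
    rw [lintegral_prod_symm _ hmeas.aemeasurable]
    calc ∫⁻ h, ∫⁻ g, ENNReal.ofReal (σ * δ * (1 + l2norm h ^ 2)) *
          negPow (l2norm g ^ 2 - xiGen k h ^ 2) ∂(stdG (Fin m)) ∂(stdG (Fin n))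
        ≤ ∫⁻ h, ENNReal.ofReal (σ * δ * K) * (1 + ENNReal.ofReal (l2norm h ^ 2))
          ∂(stdG (Fin n)) := by
          refine lintegral_mono fun h => ?_
          dsimp only
          rw [lintegral_const_mul' _ _ ENNReal.ofReal_ne_top]
          refine (mul_le_mul_right (lintegral_negPow_l2norm_le hK hm _) _).trans_eq ?_
          rw [← ENNReal.ofReal_mul (by positivity), ← ENNReal.ofReal_one,
            ← ENNReal.ofReal_add zero_le_one (by positivity), ← ENNReal.ofReal_mul (by positivity)]
          congr 1; ring
      _ = ENNReal.ofReal (σ * δ * (1 + n) * K) := by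
          rw [lintegral_const_mul' _ _ ENNReal.ofReal_ne_top, lintegral_add_left measurable_const,
            lintegral_l2norm_sq, lintegral_one, measure_univ, ← ENNReal.ofReal_one,
            ← ENNReal.ofReal_add zero_le_one (by positivity), ← ENNReal.ofReal_mul (by positivity)]
          congr 1; ring
  have i2 : ∫⁻ gh : (Fin m → ℝ) × (Fin n → ℝ),
      ENNReal.ofReal (σ * (δ ^ 2)⁻¹ * τ * l2norm gh.2 ^ 2) ∂(ghLaw m n)
      = ENNReal.ofReal (σ * (δ ^ 2)⁻¹ * τ * n) := by
    have hp := measurePreserving_snd (μ := stdG (Fin m)) (ν := stdG (Fin n))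
    have hq := hp.lintegral_comp (f := fun h => ENNReal.ofReal (σ * (δ ^ 2)⁻¹ * τ * l2norm h ^ 2))
      (((hml n).pow_const 2).const_mul _).ennreal_ofReal
    refine hq.trans ?_
    have : ∀ h : Fin n → ℝ, ENNReal.ofReal (σ * (δ ^ 2)⁻¹ * τ * l2norm h ^ 2)
        = ENNReal.ofReal (σ * (δ ^ 2)⁻¹ * τ) * ENNReal.ofReal (l2norm h ^ 2) :=
      fun h => ENNReal.ofReal_mul (by positivity)
    simp_rw [this]
    rw [lintegral_const_mul' _ _ ENNReal.ofReal_ne_top, lintegral_l2norm_sq,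
      ← ENNReal.ofReal_mul (by positivity)]
  calc ∫⁻ gh in S, ENNReal.ofReal (wGenNorm k σ gh.1 gh.2) ∂(ghLaw m n)
      ≤ ∫⁻ gh in S, (ENNReal.ofReal (σ * δ * (1 + l2norm gh.2 ^ 2)) *
          negPow (l2norm gh.1 ^ 2 - xiGen k gh.2 ^ 2)
        + (ENNReal.ofReal (σ * (δ ^ 2)⁻¹ * τ * l2norm gh.2 ^ 2)
          + ENNReal.ofReal (σ * (δ ^ 2)⁻¹ * τ⁻¹))) ∂(ghLaw m n) :=
        lintegral_mono fun gh => ofReal_wGenNorm_le hσ hδ hτ gh.1 gh.2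
    _ = ∫⁻ gh in S, ENNReal.ofReal (σ * δ * (1 + l2norm gh.2 ^ 2)) *
          negPow (l2norm gh.1 ^ 2 - xiGen k gh.2 ^ 2) ∂(ghLaw m n)
        + (∫⁻ gh in S, ENNReal.ofReal (σ * (δ ^ 2)⁻¹ * τ * l2norm gh.2 ^ 2) ∂(ghLaw m n)
          + ENNReal.ofReal (σ * (δ ^ 2)⁻¹ * τ⁻¹) * ghLaw m n S) := by
        rw [lintegral_add_right, lintegral_add_right _ measurable_const, setLIntegral_const]
        exact ((((hml n).comp measurable_snd).pow_const 2).const_mul _).ennreal_ofReal.add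
          measurable_const
    _ ≤ ENNReal.ofReal (σ * δ * (1 + n) * K) + (ENNReal.ofReal (σ * (δ ^ 2)⁻¹ * τ * n)
          + ENNReal.ofReal (σ * (δ ^ 2)⁻¹ * τ⁻¹) * ENNReal.ofReal p) := by
        gcongr
        · exact (setLIntegral_le_lintegral _ _).trans i1
        · exact (setLIntegral_le_lintegral _ _).trans_eq i2
    _ = _ := by
        rw [← ENNReal.ofReal_mul (by positivity), ← ENNReal.ofReal_add (by positivity) (by positivity),
          ← ENNReal.ofReal_add (by positivity) (by positivity)]
        congr 1; ring

/-! ### Convergence of the mean of `‖w_gen+‖₂`. -/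

lemma half_le_of_compl_le {Ω : Type*} [MeasurableSpace Ω] {μ : Measure Ω} [IsProbabilityMeasure μ]
    {S : Set Ω} (h : μ Sᶜ ≤ ENNReal.ofReal (1 / 2)) : 2⁻¹ ≤ μ S := by
  have h1 : (1 : ENNReal) ≤ μ S + μ Sᶜ := by
    rw [← measure_univ (μ := μ), ← Set.union_compl_self S]
    exact measure_union_le _ _
  have h2 : ENNReal.ofReal (1 / 2) = 2⁻¹ := by
    rw [one_div, ENNReal.ofReal_inv_of_pos two_pos]; norm_num
  rw [h2] at h
  have h3 : (2⁻¹ : ENNReal) + 2⁻¹ ≤ μ S + 2⁻¹ := by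
    rw [ENNReal.inv_two_add_inv_two]
    exact h1.trans (add_le_add_right h _)
  exact (ENNReal.add_le_add_iff_right (by simp)).1 h3

/-- Outside an exponentially small event `g` is not too short and the dual value not too large. -/
theorem ghLaw_bad_le {α β D ν η : ℝ} (hα0 : 0 < α) (hα1 : α ≤ 1) (hβ : 0 < β)
    (hβ1 : β ≤ 1) (hD : 0 < D) (hν : 0 ≤ ν)
    (h₁ : (1 - β) * ∫ z, np ν z ∂(gaussianReal 0 1) = β * ν)
    (h₂ : (1 - β) * ∫ z, np ν z ^ 2 ∂(gaussianReal 0 1) + β * (1 + ν ^ 2) = D)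
    (hη : 0 < η) :
    ∃ N : ℕ, ∀ n m k : ℕ, N ≤ n → (m : ℝ) = α * n → (k : ℝ) = β * n →
      ghLaw m n {gh | l2norm gh.1 ≤ (√α - η) * √n ∨ (√D + η) * √n < xiGen k gh.2}
        ≤ ENNReal.ofReal (4 * Real.exp (-(η ^ 2 / 32 * n))) := by
  -- Precision `η / 4` supplies levels within `η / 2` of the limits that are met with probability
  -- one half. Concentration over the remaining gap `η / 2 * √n` gives the rate `(η / 2)² / 8 = η² /
  -- 32`.
  obtain ⟨N, hN⟩ := ghzLaw_not_typical_le hα0 hα1 hβ hβ1 hD hν h₁ h₂ (η := η / 4) (θ := 1 / 2)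
    (by positivity) (by norm_num)
  refine ⟨max N 1, fun n m k hn hm hk => ?_⟩
  have hn0 : (0 : ℝ) < n := by exact_mod_cast (le_max_right N 1).trans hn
  have hsn : 0 < √(n : ℝ) := Real.sqrt_pos.2 hn0
  have hss : √(n : ℝ) ^ 2 = n := Real.sq_sqrt hn0.le
  have hm0 : NeZero m := ⟨by rintro rfl; rw [Nat.cast_zero] at hm; nlinarith [mul_pos hα0 hn0]⟩
  have htyp := hN n m k ((le_max_left _ _).trans hn) hm hk
  have hg : 2⁻¹ ≤ stdG (Fin m) {z | (√α - η / 2) * √n < l2norm z} := by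
    refine (half_le_of_compl_le (S := {t | Typical k α D (η / 4) t}) htyp).trans ?_
    refine (measure_mono fun t ht => ?_).trans (ghzLaw_g_le (n := n) le_rfl)
    have h1 : Typical k α D (η / 4) t := ht
    have h2 := h1.g_lower
    change _ < l2norm t.1
    nlinarith
  have hh : 2⁻¹ ≤ stdG (Fin n) {z | xiGen k z ≤ (√D + η / 2) * √n} := by
    refine (half_le_of_compl_le (S := {t | Typical k α D (η / 4) t}) htyp).trans ?_
    refine (measure_mono fun t ht => ?_).trans (ghzLaw_h_le (m := m) le_rfl)
    have h1 : Typical k α D (η / 4) t := ht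
    have h2 := h1.xi_upper
    change xiGen k t.2.1 ≤ _
    nlinarith
  have hD0 := Real.sqrt_nonneg D
  have t1 := l2norm_lower_tail (a := (√α - η / 2) * √n) (b := (√α - η) * √n) (by nlinarith) hg
  have t2 := xiGen_upper_tail (k := k) (a := (√D + η) * √n) (b := (√D + η / 2) * √n)
    (by positivity) (by nlinarith) hh
  have e1 : -((√α - η / 2) * √n - (√α - η) * √n) ^ 2 / 8 = -(η ^ 2 / 32 * n) := by
    linear_combination (-(η ^ 2) / 32) * hss
  have e2 : -((√D + η) * √n - (√D + η / 2) * √n) ^ 2 / 8 = -(η ^ 2 / 32 * n) := by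
    linear_combination (-(η ^ 2) / 32) * hss
  rw [e1] at t1
  rw [e2] at t2
  have e4 : ENNReal.ofReal (4 * Real.exp (-(η ^ 2 / 32 * n)))
      = 2 * ENNReal.ofReal (Real.exp (-(η ^ 2 / 32 * n)))
        + 2 * ENNReal.ofReal (Real.exp (-(η ^ 2 / 32 * n))) := by
    rw [ENNReal.ofReal_mul (by norm_num), ← add_mul]
    norm_num
  rw [e4]
  refine le_trans (measure_mono (t := (fun gh : (Fin m → ℝ) × (Fin n → ℝ) => gh.1) ⁻¹'
    {z | l2norm z ≤ (√α - η) * √n} ∪ (fun gh => gh.2) ⁻¹' {z | (√D + η) * √n < xiGen k z})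
    fun gh h => h) ((measure_union_le _ _).trans (add_le_add (le_trans (le_of_eq ?_) t1)
      (le_trans (le_of_eq ?_) t2)))
  · exact (measurePreserving_fst (μ := stdG (Fin m)) (ν := stdG (Fin n))).measure_preimage
      (continuous_l2norm.measurable measurableSet_Iic).nullMeasurableSet
  · exact (measurePreserving_snd (μ := stdG (Fin m)) (ν := stdG (Fin n))).measure_preimage
      ((continuous_xiGen n k).measurable measurableSet_Ioi).nullMeasurableSet

lemma ratio_mono {a a' b b' : ℝ} (hb : 0 ≤ b) (hbb : b ≤ b') (hba : b' < a') (haa : a' ≤ a) :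
    b / √(a ^ 2 - b ^ 2) ≤ b' / √(a' ^ 2 - b' ^ 2) := by
  have h : 0 < a' ^ 2 - b' ^ 2 := by nlinarith
  refine div_le_div₀ (hb.trans hbb) hbb (Real.sqrt_pos.2 h) (Real.sqrt_le_sqrt ?_)
  nlinarith

lemma ratio_scale {a b s : ℝ} (hs : 0 < s) :
    b * s / √((a * s) ^ 2 - (b * s) ^ 2) = b / √(a ^ 2 - b ^ 2) := by
  rw [show (a * s) ^ 2 - (b * s) ^ 2 = (a ^ 2 - b ^ 2) * s ^ 2 by ring,
    Real.sqrt_mul' _ (sq_nonneg s), Real.sqrt_sq hs.le, mul_div_mul_right _ _ hs.ne']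

lemma wGenNorm_le {m n k : ℕ} {σ a b : ℝ} (hσ : 0 ≤ σ) {g : Fin m → ℝ} {h : Fin n → ℝ}
    (hn : 0 < √(n : ℝ)) (hb0 : 0 ≤ b) (hba : b < a) (hg : a * √n ≤ l2norm g)
    (hξ : xiGen k h ≤ b * √n) :
    wGenNorm k σ g h ≤ σ * (b / √(a ^ 2 - b ^ 2)) := by
  unfold wGenNorm
  split_ifs
  · rw [← ratio_scale (a := a) (b := b) hn]
    exact mul_le_mul_of_nonneg_left (ratio_mono (xiGen_nonneg h) hξ (by nlinarith) hg) hσ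
  · exact mul_nonneg hσ (div_nonneg hb0 (Real.sqrt_nonneg _))

lemma le_wGenNorm {m n k : ℕ} {σ a b : ℝ} (hσ : 0 ≤ σ) {g : Fin m → ℝ} {h : Fin n → ℝ}
    (hn : 0 < √(n : ℝ)) (hb0 : 0 ≤ b) (hg : l2norm g ≤ a * √n)
    (hξ : b * √n ≤ xiGen k h) (hlt : xiGen k h < l2norm g) :
    σ * (b / √(a ^ 2 - b ^ 2)) ≤ wGenNorm k σ g h := by
  unfold wGenNorm
  rw [if_pos hlt, ← ratio_scale (a := a) (b := b) hn]
  exact mul_le_mul_of_nonneg_left (ratio_mono (by positivity) hξ hlt hg) hσ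

/-- The limit of the quantity `‖w_gen+‖₂`. -/
noncomputable def wLimit (σ α D : ℝ) : ℝ := σ * (√D / √(α - D))

/-- Both bounds are values of one function, continuous at zero and equal to `wLimit` there, taken at
`η` and at `-η`. Continuity uses `D < α`. -/
lemma exists_precision {σ α D ζ : ℝ} (hD : 0 < D) (hDα : D < α) (hζ : 0 < ζ) :
    ∃ η : ℝ, 0 < η ∧ √D + η < √α - η ∧ 0 ≤ √D - η ∧
      σ * ((√D + η) / √((√α - η) ^ 2 - (√D + η) ^ 2)) ≤ wLimit σ α D + ζ ∧
      wLimit σ α D - ζ ≤ σ * ((√D - η) / √((√α + η) ^ 2 - (√D - η) ^ 2)) := by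
  have hs : √D < √α := Real.sqrt_lt_sqrt hD.le hDα
  have hs0 : 0 < √D := Real.sqrt_pos.2 hD
  have hq : ContinuousAt (fun η : ℝ => σ * ((√D + η) / √((√α - η) ^ 2 - (√D + η) ^ 2))) 0 := by
    refine ContinuousAt.const_mul (ContinuousAt.div (by fun_prop) (by fun_prop) ?_) σ
    refine (Real.sqrt_pos.2 ?_).ne'
    simp only [sub_zero, add_zero]
    nlinarith
  have hq0 : σ * ((√D + 0) / √((√α - 0) ^ 2 - (√D + 0) ^ 2)) = wLimit σ α D := by
    rw [wLimit, add_zero, sub_zero, Real.sq_sqrt (hD.le.trans hDα.le), Real.sq_sqrt hD.le]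
  obtain ⟨d, hd, hclose⟩ := Metric.continuousAt_iff.1 hq ζ hζ
  rw [hq0] at hclose
  refine ⟨min (d / 2) (min ((√α - √D) / 3) √D), by
    have : 0 < √α - √D := by linarith
    positivity, ?_, ?_, ?_, ?_⟩
  · have := (min_le_right (d / 2) _).trans (min_le_left ((√α - √D) / 3) √D)
    linarith
  · have := (min_le_right (d / 2) _).trans (min_le_right ((√α - √D) / 3) √D)
    linarith
  all_goals
    set η := min (d / 2) (min ((√α - √D) / 3) √D) with hη
    have h0 : 0 ≤ η := by
      have : 0 < √α - √D := by linarith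
      positivity
    have h1 : η < d := (min_le_left _ _).trans_lt (by linarith)
  · have := hclose (x := η) (by rw [Real.dist_eq, sub_zero, abs_of_nonneg h0]; exact h1)
    rw [Real.dist_eq] at this
    linarith [(abs_lt.1 this).2]
  · have := hclose (x := -η) (by rw [Real.dist_eq, sub_zero, abs_neg, abs_of_nonneg h0]; exact h1)
    rw [Real.dist_eq, sub_neg_eq_add, ← sub_eq_add_neg] at this
    linarith [(abs_lt.1 this).1]

/-- The error of `setLIntegral_wGenNorm_le` for `δ = n⁻²` and `τ = n⁻⁶`: two terms of order `1 / n`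
and one of order `n ^ 10 * exp (-c n)`. -/
lemma tendsto_error (σ K c : ℝ) (hc : 0 < c) :
    Filter.Tendsto (fun n : ℕ => σ * (((n : ℝ) ^ 2)⁻¹ * (1 + n) * K
      + ((((n : ℝ) ^ 2)⁻¹) ^ 2)⁻¹ * ((n : ℝ) ^ 6)⁻¹ * n
      + ((((n : ℝ) ^ 2)⁻¹) ^ 2)⁻¹ * (((n : ℝ) ^ 6)⁻¹)⁻¹ * (4 * Real.exp (-(c * n)))))
      Filter.atTop (nhds 0) := by
  have hinv : Filter.Tendsto (fun n : ℕ => ((n : ℝ))⁻¹) Filter.atTop (nhds 0) :=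
    tendsto_inv_atTop_nhds_zero_nat
  have hexp : Filter.Tendsto (fun n : ℕ => (c * (n : ℝ)) ^ 10 * Real.exp (-(c * n)))
      Filter.atTop (nhds 0) :=
    (Real.tendsto_pow_mul_exp_neg_atTop_nhds_zero 10).comp
      (tendsto_natCast_atTop_atTop.const_mul_atTop hc)
  have h := ((((hinv.mul hinv).add hinv).mul_const K).add hinv |>.add
    (hexp.const_mul (4 / c ^ 10))).const_mul σ
  simp only [mul_zero, add_zero, zero_mul] at h
  refine h.congr' ?_
  filter_upwards [Filter.eventually_gt_atTop 0] with n hn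
  have : (n : ℝ) ≠ 0 := by exact_mod_cast hn.ne'
  field_simp

/-- The mean of `‖w_gen+‖₂` exists and converges to its limit. -/
theorem meanWGen_approx {α β D ν σ ζ : ℝ} (hα1 : α ≤ 1) (hβ : 0 < β)
    (hβ1 : β ≤ 1) (hD : 0 < D) (hDα : D < α) (hν : 0 ≤ ν) (hσ : 0 ≤ σ)
    (h₁ : (1 - β) * ∫ z, np ν z ∂(gaussianReal 0 1) = β * ν)
    (h₂ : (1 - β) * ∫ z, np ν z ^ 2 ∂(gaussianReal 0 1) + β * (1 + ν ^ 2) = D)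
    (hζ : 0 < ζ) :
    ∃ N : ℕ, ∀ n m k : ℕ, N ≤ n → (m : ℝ) = α * n → (k : ℝ) = β * n →
      Integrable (fun gh : (Fin m → ℝ) × (Fin n → ℝ) => wGenNorm k σ gh.1 gh.2) (ghLaw m n) ∧
      |meanWGen m n k σ - wLimit σ α D| ≤ ζ := by
  have hα0 : 0 < α := hD.trans hDα
  set r := wLimit σ α D with hr
  have hr0 : 0 ≤ r := by rw [hr, wLimit]; positivity
  obtain ⟨η, hη, e1, e2, e3, e4⟩ := exists_precision (σ := σ) hD hDα (half_pos hζ)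
  -- Chosen so that losing probability `θ` lowers a mean near `r` by at most `ζ / 2`.
  set θ := min (ζ / (2 * (r + 1))) 1 with hθ
  have hθ0 : 0 < θ := by positivity
  obtain ⟨N₁, hN₁⟩ := ghzLaw_not_typical_le hα0 hα1 hβ hβ1 hD hν h₁ h₂ hη hθ0
  obtain ⟨N₂, hN₂⟩ := ghLaw_bad_le hα0 hα1 hβ hβ1 hD hν h₁ h₂ hη
  obtain ⟨K, hK0, hK⟩ := exists_lintegral_negPow_gaussian_le
  obtain ⟨N₃, hN₃⟩ := Filter.eventually_atTop.1
    ((tendsto_error σ K (η ^ 2 / 32) (by positivity)).eventually (Iio_mem_nhds (half_pos hζ)))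
  obtain ⟨N₄, hN₄⟩ := exists_nat_gt (2 / α)
  refine ⟨max (max N₁ N₂) (max N₃ (max N₄ 1)), fun n m k hn hm hk => ?_⟩
  simp only [max_le_iff] at hn
  obtain ⟨⟨n1, n2⟩, n3, n4, n5⟩ := hn
  have hn0 : (0 : ℝ) < n := by exact_mod_cast n5
  have hsn : 0 < √(n : ℝ) := Real.sqrt_pos.2 hn0
  have hm2 : 2 ≤ m := by
    have h : (2 : ℝ) ≤ m := by
      rw [hm, ← div_le_iff₀' hα0]
      exact hN₄.le.trans (by exact_mod_cast n4)
    exact_mod_cast h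
  set w := fun gh : (Fin m → ℝ) × (Fin n → ℝ) => wGenNorm k σ gh.1 gh.2 with hw
  have hw0 : ∀ gh, 0 ≤ w gh := fun gh => wGenNorm_nonneg hσ _ _
  have hwm : Measurable w := measurable_wGenNorm m n k σ
  set S := {gh : (Fin m → ℝ) × (Fin n → ℝ) |
    l2norm gh.1 ≤ (√α - η) * √n ∨ (√D + η) * √n < xiGen k gh.2} with hS
  have hbad : ∫⁻ gh in S, ENNReal.ofReal (w gh) ∂(ghLaw m n) ≤ ENNReal.ofReal (ζ / 2) := by
    refine (setLIntegral_wGenNorm_le hm2 hσ (δ := ((n : ℝ) ^ 2)⁻¹) (τ := ((n : ℝ) ^ 6)⁻¹)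
      (by positivity) (by positivity) hK0 hK (by positivity) (hN₂ n m k n2 hm hk)).trans ?_
    exact ENNReal.ofReal_le_ofReal (le_of_lt (hN₃ n n3))
  have hgood : ∫⁻ gh in Sᶜ, ENNReal.ofReal (w gh) ∂(ghLaw m n) ≤ ENNReal.ofReal (r + ζ / 2) := by
    have hSm : MeasurableSet S := by
      refine MeasurableSet.union ?_ ?_
      · exact measurableSet_le (continuous_l2norm.measurable.comp measurable_fst) measurable_const
      · exact measurableSet_lt measurable_const
          ((continuous_xiGen n k).measurable.comp measurable_snd)
    calc ∫⁻ gh in Sᶜ, ENNReal.ofReal (w gh) ∂(ghLaw m n)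
        ≤ ∫⁻ _ in Sᶜ, ENNReal.ofReal (r + ζ / 2) ∂(ghLaw m n) := by
          refine setLIntegral_mono' hSm.compl fun gh hgh => ENNReal.ofReal_le_ofReal ?_
          have h1 : ¬ (_ ∨ _) := hgh
          push Not at h1
          exact (wGenNorm_le hσ hsn (by positivity) e1 h1.1.le h1.2).trans e3
      _ ≤ ENNReal.ofReal (r + ζ / 2) := by
          rw [setLIntegral_const]
          exact mul_le_of_le_one_right' prob_le_one
  have htot : ∫⁻ gh, ENNReal.ofReal (w gh) ∂(ghLaw m n) ≤ ENNReal.ofReal (r + ζ) := by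
    rw [← setLIntegral_univ, ← Set.union_compl_self S]
    refine (lintegral_union_le _ _ _).trans ((add_le_add hbad hgood).trans_eq ?_)
    rw [← ENNReal.ofReal_add (by positivity) (by positivity)]
    congr 1; ring
  have hint : Integrable w (ghLaw m n) := by
    refine ⟨hwm.aestronglyMeasurable, ?_⟩
    rw [hasFiniteIntegral_iff_ofReal (Filter.Eventually.of_forall hw0)]
    exact htot.trans_lt ENNReal.ofReal_lt_top
  refine ⟨hint, abs_le.2 ⟨?_, ?_⟩⟩
  · set q := σ * ((√D - η) / √((√α + η) ^ 2 - (√D - η) ^ 2)) with hq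
    have hq0 : 0 ≤ q := mul_nonneg hσ (div_nonneg e2 (Real.sqrt_nonneg _))
    -- The lower bound for the mean is Markov's inequality: on the typical event the variable is at
    -- least `q ≥ r - ζ / 2`.
    have hmk := mul_meas_ge_le_integral_of_nonneg (Filter.Eventually.of_forall hw0) hint q
    have hmeas : MeasurableSet {gh | q ≤ w gh} := measurableSet_le measurable_const hwm
    have hP : (ghLaw m n) {gh | q ≤ w gh}ᶜ ≤ ENNReal.ofReal θ := by
      rw [← (measurePreserving_gh m n).measure_preimage hmeas.compl.nullMeasurableSet]
      refine le_trans (measure_mono ?_) (hN₁ n m k n1 hm hk)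
      refine fun t ht hT => ht ?_
      have hT' : Typical k α D η t := hT
      obtain ⟨u, hu, hu1, hut⟩ := hT'.exists_dir
      have h1 := neg_xiGen_mul_le t.2.1 hu
      rw [hu1, mul_one] at h1
      refine le_wGenNorm hσ hsn e2 hT'.g_upper (by linarith) ?_
      have h2 := hT'.xi_upper
      have h3 := hT'.g_lower
      nlinarith
    have hP' : (ghLaw m n).real {gh | q ≤ w gh}ᶜ ≤ θ :=
      ENNReal.toReal_le_of_le_ofReal hθ0.le hP
    rw [probReal_compl_eq_one_sub hmeas] at hP'
    have h4 : q * (1 - θ) ≤ meanWGen m n k σ :=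
      (mul_le_mul_of_nonneg_left (by linarith) hq0).trans hmk
    have h5 : (r + 1) * θ ≤ ζ / 2 := by
      have := min_le_left (ζ / (2 * (r + 1))) 1
      rw [← hθ, le_div_iff₀ (by positivity)] at this
      linarith
    have h6 : θ ≤ 1 := min_le_right _ _
    have h7 : (r - ζ / 2) * (1 - θ) ≤ q * (1 - θ) :=
      mul_le_mul_of_nonneg_right e4 (by linarith)
    nlinarith
  · have h1 : meanWGen m n k σ ≤ r + ζ := by
      rw [meanWGen, integral_eq_lintegral_of_nonneg_ae (Filter.Eventually.of_forall hw0)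
        hwm.aestronglyMeasurable]
      exact ENNReal.toReal_le_of_le_ofReal (by positivity) htot
    linarith

/-! ### The feasible perturbations and the error vectors. -/

/-- The set of the admissible perturbations of `xt`. -/
def errSet {n : ℕ} (xt : Fin n → ℝ) : Set (Fin n → ℝ) :=
  {w | (∀ i, 0 ≤ xt i + w i) ∧ ∑ i, w i ≤ 0}

lemma IsSparsePos.nonneg {n k : ℕ} {xt : Fin n → ℝ} (h : IsSparsePos k xt) (i : Fin n) :
    0 ≤ xt i := by
  rcases lt_or_ge (i : ℕ) (n - k) with hi | hi
  · exact ((h i).1 hi).ge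
  · exact (h i).2 hi

lemma add_mem_feasible_iff {n : ℕ} {xt w : Fin n → ℝ} (h : ∀ i, 0 ≤ xt i) :
    xt + w ∈ feasible xt ↔ w ∈ errSet xt := by
  have e1 : l1norm xt = ∑ i, xt i := Finset.sum_congr rfl fun i _ => abs_of_nonneg (h i)
  have e2 : (∀ i, 0 ≤ xt i + w i) → l1norm (xt + w) = ∑ i, xt i + ∑ i, w i := fun h' => by
    rw [← Finset.sum_add_distrib]
    exact Finset.sum_congr rfl fun i _ => abs_of_nonneg (h' i)
  constructor
  · rintro ⟨h1, h2⟩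
    rw [e1, e2 h2] at h1
    exact ⟨h2, by linarith⟩
  · rintro ⟨h1, h2⟩
    refine ⟨?_, h1⟩
    rw [e1, e2 h1]
    linarith

lemma isErrorVector_iff {m n : ℕ} {A : Matrix (Fin m) (Fin n) ℝ} {v : Fin m → ℝ}
    {xt w : Fin n → ℝ} (h : ∀ i, 0 ≤ xt i) :
    IsErrorVector A v xt w ↔
      w ∈ errSet xt ∧ ∀ w' ∈ errSet xt, l2norm (v - A *ᵥ w) ≤ l2norm (v - A *ᵥ w') := by
  have e : ∀ w', A *ᵥ xt + v - A *ᵥ (xt + w') = v - A *ᵥ w' := fun w' => by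
    rw [Matrix.mulVec_add]; abel
  rw [IsErrorVector, IsLassoSolution, add_mem_feasible_iff h, isMinOn_iff]
  refine and_congr_right fun _ => ⟨fun h1 w' hw' => ?_, fun h1 x hx => ?_⟩
  · have := h1 _ ((add_mem_feasible_iff h).2 hw')
    rwa [e, e] at this
  · have hx' : xt + (x - xt) = x := by abel
    rw [← hx', add_mem_feasible_iff h] at hx
    have := h1 _ hx
    rwa [← e, ← e, hx'] at this

lemma zero_mem_errSet {n : ℕ} {xt : Fin n → ℝ} (h : ∀ i, 0 ≤ xt i) : 0 ∈ errSet xt :=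
  ⟨fun i => by simpa using h i, by simp⟩

lemma convex_errSet {n : ℕ} (xt : Fin n → ℝ) : Convex ℝ (errSet xt) := by
  intro x hx y hy a b ha hb hab
  refine ⟨fun i => ?_, ?_⟩
  · have h1 := mul_nonneg ha (hx.1 i)
    have h2 := mul_nonneg hb (hy.1 i)
    have h3 : xt i + (a • x + b • y) i = a * (xt i + x i) + b * (xt i + y i) := by
      simp only [Pi.add_apply, Pi.smul_apply, smul_eq_mul]
      linear_combination (-(xt i)) * hab
    rw [h3]
    exact add_nonneg h1 h2
  · simp only [Pi.add_apply, Pi.smul_apply, smul_eq_mul, Finset.sum_add_distrib, ← Finset.mul_sum]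
    have h1 := mul_nonneg ha (neg_nonneg.2 hx.2)
    have h2 := mul_nonneg hb (neg_nonneg.2 hy.2)
    linarith

lemma isClosed_errSet {n : ℕ} (xt : Fin n → ℝ) : IsClosed (errSet xt) := by
  have e : errSet xt = (⋂ i, {w : Fin n → ℝ | 0 ≤ xt i + w i}) ∩ {w | ∑ i, w i ≤ 0} := by
    ext w; simp [errSet]
  rw [e]
  exact (isClosed_iInter fun i => isClosed_le (by fun_prop) (by fun_prop)).inter
    (isClosed_le (by fun_prop) (by fun_prop))

lemma errSet_subset_errCone {n k : ℕ} {xt : Fin n → ℝ} (h : IsSparsePos k xt) :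
    errSet xt ⊆ errCone n k := fun w hw => ⟨fun i hi => by
  have := hw.1 i
  rwa [(h i).1 hi, zero_add] at this, hw.2⟩

lemma convex_l2norm_le {n : ℕ} (R : ℝ) : Convex ℝ {w : Fin n → ℝ | l2norm w ≤ R} := by
  intro x hx y hy a b ha hb hab
  have hx' : l2norm x ≤ R := hx
  have hy' : l2norm y ≤ R := hy
  change l2norm _ ≤ R
  refine (l2norm_add_le _ _).trans ?_
  rw [l2norm_smul, l2norm_smul, abs_of_nonneg ha, abs_of_nonneg hb]
  have : R = a * R + b * R := by rw [← add_mul, hab, one_mul]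
  rw [this]
  gcongr

lemma isCompact_l2norm_le {n : ℕ} (R : ℝ) : IsCompact {w : Fin n → ℝ | l2norm w ≤ R} := by
  refine Metric.isCompact_of_isClosed_isBounded (isClosed_le continuous_l2norm continuous_const) ?_
  refine (Metric.isBounded_iff_subset_closedBall 0).2 ⟨max R 0, fun w hw => ?_⟩
  rw [mem_closedBall_zero_iff, pi_norm_le_iff_of_nonneg (le_max_right _ _)]
  exact fun i => (abs_apply_le_l2norm w i).trans (le_trans hw (le_max_left _ _))

lemma isCompact_errSet_inter {n : ℕ} (xt : Fin n → ℝ) (R : ℝ) :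
    IsCompact (errSet xt ∩ {w | l2norm w ≤ R}) :=
  (isCompact_l2norm_le R).inter_left (isClosed_errSet xt)

lemma isCompact_errSet {n : ℕ} (xt : Fin n → ℝ) : IsCompact (errSet xt) := by
  refine Metric.isCompact_of_isClosed_isBounded (isClosed_errSet xt) ?_
  set R := (∑ i, |xt i|) with hR
  have hR0 : 0 ≤ R := Finset.sum_nonneg fun i _ => abs_nonneg _
  refine (Metric.isBounded_iff_subset_closedBall 0).2 ⟨2 * R, fun w hw => ?_⟩
  rw [mem_closedBall_zero_iff, pi_norm_le_iff_of_nonneg (by positivity)]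
  intro i
  have h1 : xt i + w i ≤ ∑ j, (xt j + w j) :=
    Finset.single_le_sum (f := fun j => xt j + w j) (fun j _ => hw.1 j) (Finset.mem_univ i)
  have h2 : ∑ j, xt j ≤ R := Finset.sum_le_sum fun j _ => le_abs_self _
  have h3 : |xt i| ≤ R :=
    Finset.single_le_sum (f := fun j => |xt j|) (fun j _ => abs_nonneg _) (Finset.mem_univ i)
  rw [Finset.sum_add_distrib] at h1
  have h4 := hw.1 i
  have h5 := hw.2
  obtain ⟨h6, h7⟩ := abs_le.1 h3
  rw [Real.norm_eq_abs, abs_le]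
  constructor <;> linarith

lemma continuous_residual {m n : ℕ} (A : Matrix (Fin m) (Fin n) ℝ) (v : Fin m → ℝ) :
    Continuous fun w : Fin n → ℝ => l2norm (v - A *ᵥ w) :=
  continuous_l2norm.comp (continuous_const.sub (continuous_const.matrix_mulVec continuous_id))

lemma exists_isErrorVector {m n : ℕ} (A : Matrix (Fin m) (Fin n) ℝ) (v : Fin m → ℝ)
    {xt : Fin n → ℝ} (h : ∀ i, 0 ≤ xt i) : ∃ w, IsErrorVector A v xt w := by
  obtain ⟨w, hw, hmin⟩ := (isCompact_errSet xt).exists_isMinOn ⟨0, zero_mem_errSet h⟩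
    (continuous_residual A v).continuousOn
  exact ⟨w, (isErrorVector_iff h).2 ⟨hw, isMinOn_iff.1 hmin⟩⟩

/-- A long error vector yields a vector of prescribed norm that beats all short ones. -/
lemma exists_sphere_of_errorVector {m n : ℕ} {A : Matrix (Fin m) (Fin n) ℝ} {v : Fin m → ℝ}
    {xt : Fin n → ℝ} (h : ∀ i, 0 ≤ xt i) {ρ ρ' : ℝ} (hρ' : 0 ≤ ρ') (hρ : ρ' ≤ ρ) {w : Fin n → ℝ}
    (hw : IsErrorVector A v xt w) (hwρ : ρ < l2norm w) :
    ∃ p ∈ errSet xt ∩ {p | l2norm p = ρ}, ∀ w' ∈ errSet xt ∩ {w' | l2norm w' ≤ ρ'},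
      l2norm (v - A *ᵥ p) ≤ l2norm (v - A *ᵥ w') := by
  obtain ⟨hwF, hwmin⟩ := (isErrorVector_iff h).1 hw
  obtain ⟨q, ⟨hqF, hqρ⟩, hqmin⟩ := (isCompact_errSet_inter xt ρ').exists_isMinOn
    ⟨0, zero_mem_errSet h, by change l2norm _ ≤ _; rwa [l2norm_zero]⟩
    (continuous_residual A v).continuousOn
  have hqρ' : l2norm q ≤ ρ' := hqρ
  have hcont : Continuous fun s : ℝ => l2norm ((1 - s) • q + s • w) :=
    continuous_l2norm.comp (by fun_prop)
  -- The segment from the best short vector `q` to `w` crosses the sphere of radius `ρ`. The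
  -- residual is convex and no larger at `w` than at `q`, so the crossing point does at least as
  -- well as `q`.
  obtain ⟨s, ⟨hs0, hs1⟩, hs⟩ := intermediate_value_Icc zero_le_one hcont.continuousOn
    (show ρ ∈ Set.Icc _ _ by
      simp only [sub_zero, one_smul, zero_smul, add_zero, sub_self, zero_add]
      exact ⟨hqρ'.trans hρ, hwρ.le⟩)
  refine ⟨(1 - s) • q + s • w, ⟨convex_errSet xt hqF hwF (by linarith) hs0 (by ring), hs⟩,
    fun w' hw' => le_trans ?_ (isMinOn_iff.1 hqmin w' hw')⟩
  have e : v - A *ᵥ ((1 - s) • q + s • w) = (1 - s) • (v - A *ᵥ q) + s • (v - A *ᵥ w) := by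
    rw [Matrix.mulVec_add, Matrix.mulVec_smul, Matrix.mulVec_smul, smul_sub, smul_sub]
    have : v = (1 - s) • v + s • v := by rw [← add_smul]; simp
    nth_rewrite 1 [this]
    abel
  rw [e]
  refine (l2norm_add_le _ _).trans ?_
  rw [l2norm_smul, l2norm_smul, abs_of_nonneg (by linarith : 0 ≤ 1 - s), abs_of_nonneg hs0]
  have := mul_le_mul_of_nonneg_left (hwmin q hqF) hs0
  linarith

/-! ### The limiting objective and the separating level. -/

/-- The limiting objective of the auxiliary problem, as a function of the norm. -/
noncomputable def auxLimit (σ α D x : ℝ) : ℝ := √α * √(σ ^ 2 + x ^ 2) - √D * x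

/-- The tangent-line inequality of a convex function, here Cauchy–Schwarz for `(σ, x)` and `(σ, y)`.
With `slope_pos` and `slope_neg` it turns the sign of the derivative into quantitative gaps. -/
lemma auxLimit_grad {σ α D : ℝ} (hσ : 0 < σ) (x y : ℝ) :
    auxLimit σ α D x + (y - x) * (√α * (x / √(σ ^ 2 + x ^ 2)) - √D) ≤ auxLimit σ α D y := by
  have hx : 0 < √(σ ^ 2 + x ^ 2) := Real.sqrt_pos.2 (by positivity)
  have hxx : √(σ ^ 2 + x ^ 2) ^ 2 = σ ^ 2 + x ^ 2 := Real.sq_sqrt (by positivity)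
  have h1 : √(σ ^ 2 + x ^ 2) + (y - x) * (x / √(σ ^ 2 + x ^ 2)) ≤ √(σ ^ 2 + y ^ 2) := by
    have e : √(σ ^ 2 + x ^ 2) + (y - x) * (x / √(σ ^ 2 + x ^ 2))
        = (σ ^ 2 + x * y) / √(σ ^ 2 + x ^ 2) := by
      field_simp
      rw [hxx]; ring
    rw [e, div_le_iff₀ hx, ← Real.sqrt_mul (by positivity)]
    refine Real.le_sqrt_of_sq_le ?_
    nlinarith [sq_nonneg (σ * (x - y))]
  have h2 := mul_le_mul_of_nonneg_left h1 (Real.sqrt_nonneg α)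
  unfold auxLimit
  linarith

lemma wLimit_sq {σ α D : ℝ} (hD : 0 ≤ D) (hDα : D < α) :
    wLimit σ α D ^ 2 * (α - D) = σ ^ 2 * D := by
  have h : 0 < α - D := by linarith
  rw [wLimit, mul_pow, div_pow, Real.sq_sqrt hD, Real.sq_sqrt h.le]
  field_simp

/-- The derivative vanishes where `α x² = D (σ² + x²)`, that is, at `wLimit`. -/
lemma slope_pos {σ α D x : ℝ} (hσ : 0 < σ) (hD : 0 ≤ D) (hDα : D < α)
    (hx : wLimit σ α D < x) : 0 < √α * (x / √(σ ^ 2 + x ^ 2)) - √D := by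
  have h0 : 0 ≤ wLimit σ α D := by unfold wLimit; positivity
  have hs : 0 < √(σ ^ 2 + x ^ 2) := Real.sqrt_pos.2 (by positivity)
  rw [sub_pos, ← mul_div_assoc, lt_div_iff₀ hs, ← Real.sqrt_mul hD,
    ← Real.sqrt_sq (h0.trans hx.le), ← Real.sqrt_mul (hD.trans hDα.le),
    Real.sq_sqrt (sq_nonneg x)]
  refine Real.sqrt_lt_sqrt (by positivity) ?_
  have h1 := wLimit_sq (σ := σ) hD hDα
  have h2 : wLimit σ α D ^ 2 < x ^ 2 := by gcongr
  nlinarith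

lemma slope_neg {σ α D x : ℝ} (hσ : 0 < σ) (hD : 0 ≤ D) (hDα : D < α) (hx0 : 0 ≤ x)
    (hx : x < wLimit σ α D) : √α * (x / √(σ ^ 2 + x ^ 2)) - √D < 0 := by
  have hs : 0 < √(σ ^ 2 + x ^ 2) := Real.sqrt_pos.2 (by positivity)
  rw [sub_neg, ← mul_div_assoc, div_lt_iff₀ hs, ← Real.sqrt_mul hD]
  have h1 := wLimit_sq (σ := σ) hD hDα
  have h2 : x ^ 2 < wLimit σ α D ^ 2 := by gcongr
  have h3 : √α * x = √(α * x ^ 2) := by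
    rw [Real.sqrt_mul (hD.trans hDα.le), Real.sqrt_sq hx0]
  rw [h3]
  refine Real.sqrt_lt_sqrt (by have := hD.trans hDα.le; positivity) ?_
  nlinarith

lemma sqrt_add_le {σ x : ℝ} (hσ : 0 ≤ σ) (hx : 0 ≤ x) : √(σ ^ 2 + x ^ 2) ≤ σ + x := by
  refine Real.sqrt_le_iff.2 ⟨by positivity, ?_⟩
  nlinarith [mul_nonneg hσ hx]

/-- Keeps the levels nonnegative, as `two_set_separation` requires. -/
lemma auxLimit_ge {σ α D x : ℝ} (hDα : D ≤ α) :
    (√α - √D) * σ ≤ auxLimit σ α D x := by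
  have h1 : √D ≤ √α := Real.sqrt_le_sqrt hDα
  have h2 : σ ≤ √(σ ^ 2 + x ^ 2) := Real.le_sqrt_of_sq_le (by nlinarith [sq_nonneg x])
  have h3 : x ≤ √(σ ^ 2 + x ^ 2) := Real.le_sqrt_of_sq_le (by nlinarith [sq_nonneg σ])
  have h4 := Real.sqrt_nonneg D
  unfold auxLimit
  nlinarith

lemma Typical.auxVal_ge {m n k : ℕ} {σ α D η : ℝ} {t : (Fin m → ℝ) × (Fin n → ℝ) × ℝ}
    (ht : Typical k α D η t) (hσ : 0 ≤ σ) (hη : 0 ≤ η) {w : Fin n → ℝ}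
    (hw : w ∈ errCone n k) {R : ℝ} (hR : l2norm w ≤ R) :
    (auxLimit σ α D (l2norm w) - η * (2 * σ + 2 * R)) * √n ≤ auxVal σ w t := by
  have h0 := l2norm_nonneg w
  have hn := Real.sqrt_nonneg (n : ℝ)
  have h1 := mul_le_mul_of_nonneg_left ht.g_lower (Real.sqrt_nonneg (σ ^ 2 + l2norm w ^ 2))
  have h2 := neg_xiGen_mul_le t.2.1 hw
  have h3 := mul_le_mul_of_nonneg_right ht.xi_upper h0
  have h4 := mul_le_mul_of_nonneg_left ((le_abs_self _).trans ht.h₀_le) hσ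
  have h5 := sqrt_add_le hσ h0
  have h6 : η * (√(σ ^ 2 + l2norm w ^ 2) + l2norm w + σ) * √n ≤ η * (2 * σ + 2 * R) * √n :=
    mul_le_mul_of_nonneg_right (mul_le_mul_of_nonneg_left (by linarith) hη) hn
  unfold auxVal auxLimit
  linarith

lemma Typical.auxVal_dir_le {m n k : ℕ} {σ α D η : ℝ} {t : (Fin m → ℝ) × (Fin n → ℝ) × ℝ}
    (ht : Typical k α D η t) (hσ : 0 ≤ σ) (hη : 0 ≤ η) {x : ℝ}
    (hx : 0 ≤ x) : ∃ u ∈ errCone n k, l2norm u = 1 ∧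
      auxVal σ (x • u) t ≤ (auxLimit σ α D x + η * (2 * σ + 2 * x)) * √n := by
  obtain ⟨u, hu, hu1, hut⟩ := ht.exists_dir
  refine ⟨u, hu, hu1, ?_⟩
  have h1 := mul_le_mul_of_nonneg_left ht.g_upper (Real.sqrt_nonneg (σ ^ 2 + x ^ 2))
  have h2 := mul_le_mul_of_nonneg_left hut hx
  have h4 := mul_le_mul_of_nonneg_left ((neg_abs_le _).trans' (neg_le_neg ht.h₀_le)) hσ
  have h5 := sqrt_add_le hσ hx
  have hn := Real.sqrt_nonneg (n : ℝ)
  have h6 : η * (√(σ ^ 2 + x ^ 2) + x + σ) * √n ≤ η * (2 * σ + 2 * x) * √n :=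
    mul_le_mul_of_nonneg_right (mul_le_mul_of_nonneg_left (by linarith) hη) hn
  unfold auxVal auxLimit
  rw [l2norm_smul, hu1, mul_one, abs_of_nonneg hx, smul_dotProduct, smul_eq_mul]
  linarith

/-- Shrinking `w` radially scales `wᵀh` and leaves the `h₀` term unchanged. Only the lower bound for
`wᵀh` is used, so the estimate applies to every cone vector on the sphere, whether or not the
auxiliary problem is nearly minimal there. -/
lemma Typical.auxVal_scale {m n k : ℕ} {σ α D η : ℝ} {t : (Fin m → ℝ) × (Fin n → ℝ) × ℝ}
    (ht : Typical k α D η t) (hσ : 0 ≤ σ) (hη : 0 ≤ η) {ρ ρ' : ℝ}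
    (hρ' : 0 ≤ ρ') (hρ : ρ' < ρ) {w : Fin n → ℝ} (hw : w ∈ errCone n k) (hwρ : l2norm w = ρ) :
    auxVal σ ((ρ' / ρ) • w) t
        + (auxLimit σ α D ρ - auxLimit σ α D ρ' - η * (2 * σ + 2 * ρ)) * √n ≤ auxVal σ w t := by
  have hρ0 : 0 < ρ := hρ'.trans_lt hρ
  have hn := Real.sqrt_nonneg (n : ℝ)
  have hmono : √(σ ^ 2 + ρ' ^ 2) ≤ √(σ ^ 2 + ρ ^ 2) := by gcongr
  have h1 := mul_le_mul_of_nonneg_left ht.g_lower (sub_nonneg.2 hmono)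
  have h2 := neg_xiGen_mul_le t.2.1 hw
  rw [hwρ] at h2
  have h3 := mul_le_mul_of_nonneg_right ht.xi_upper hρ0.le
  have hs : 0 ≤ 1 - ρ' / ρ := by rw [sub_nonneg, div_le_one hρ0]; exact hρ.le
  have h4 : (1 - ρ' / ρ) * -((√D + η) * √n * ρ) ≤ (1 - ρ' / ρ) * (w ⬝ᵥ t.2.1) :=
    mul_le_mul_of_nonneg_left (by linarith) hs
  have h4' : (1 - ρ' / ρ) * -((√D + η) * √n * ρ) = -((ρ - ρ') * (√D + η) * √n) := by
    field_simp
  have h5 := sqrt_add_le hσ hρ0.le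
  have h6 : η * (√(σ ^ 2 + ρ ^ 2) - √(σ ^ 2 + ρ' ^ 2) + (ρ - ρ')) * √n ≤ η * (2 * σ + 2 * ρ) * √n := by
    have := Real.sqrt_nonneg (σ ^ 2 + ρ' ^ 2)
    exact mul_le_mul_of_nonneg_right (mul_le_mul_of_nonneg_left (by linarith) hη) hn
  have h7 : l2norm ((ρ' / ρ) • w) = ρ' := by
    rw [l2norm_smul, hwρ, abs_of_nonneg (by positivity)]
    field_simp
  unfold auxVal auxLimit
  rw [h7, hwρ, smul_dotProduct, smul_eq_mul]
  linarith

/-- An approximate quartile: a point just above the infimum of the levels reached with probability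
at least `1 / 4`. -/
lemma exists_level {Ω : Type*} [MeasurableSpace Ω] {μ : Measure Ω} {A : ℝ → Set Ω} {b : ℝ}
    (hb : 0 ≤ b) (hA : (4 : ENNReal)⁻¹ ≤ μ (A b)) (hneg : ∀ b < 0, μ (A b) ≤ 4⁻¹) {τ : ℝ}
    (hτ : 0 < τ) : ∃ b₁ : ℝ, 0 ≤ b₁ ∧ 4⁻¹ ≤ μ (A b₁) ∧ μ (A (b₁ - τ)) ≤ 4⁻¹ := by
  set I := {b : ℝ | 0 ≤ b ∧ (4 : ENNReal)⁻¹ ≤ μ (A b)} with hI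
  obtain ⟨b₁, ⟨h1, h2⟩, h3⟩ := exists_lt_of_csInf_lt (s := I) ⟨b, hb, hA⟩
    (lt_add_of_pos_right (sInf I) hτ)
  refine ⟨b₁, h1, h2, ?_⟩
  rcases lt_or_ge (b₁ - τ) 0 with h | h
  · exact hneg _ h
  · by_contra hcon
    push Not at hcon
    have : sInf I ≤ b₁ - τ := csInf_le ⟨0, fun x hx => hx.1⟩ ⟨h, hcon.le⟩
    linarith

lemma inv_four_eq : (4 : ENNReal)⁻¹ = ENNReal.ofReal (1 / 4) := by
  rw [one_div, ENNReal.ofReal_inv_of_pos (by norm_num)]; norm_num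

lemma inv_four_le_inv_two : (4 : ENNReal)⁻¹ ≤ 2⁻¹ :=
  ENNReal.inv_le_inv.2 (by norm_num)

/-- A level at which the auxiliary problem separates a sphere from a concentric smaller ball. -/
lemma exists_separating_level {m n k : ℕ} {α D σ η ρ ρ' κ : ℝ} (hn : 0 < n) (hσ : 0 < σ)
    (hη : 0 ≤ η) (hρ' : 0 ≤ ρ') (hρ : ρ' < ρ) (hκ : 0 < κ) (hDα : D ≤ α)
    (hη1 : η * (2 * σ + 2 * ρ) ≤ (√α - √D) * σ)
    (hη2 : κ + η * (2 * σ + 2 * ρ) ≤ auxLimit σ α D ρ - auxLimit σ α D ρ')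
    (hT : ghzLaw m n {t | ¬ Typical k α D η t} ≤ 4⁻¹)
    {xt : Fin n → ℝ} (hxt : IsSparsePos k xt) :
    ∃ b : ℝ, 0 ≤ b ∧
      4⁻¹ ≤ ghzLaw m n {t | ∃ w ∈ errSet xt ∩ {w | l2norm w ≤ ρ'}, auxVal σ w t < b} ∧
      4⁻¹ ≤ ghzLaw m n {t | ∀ w ∈ errSet xt ∩ {w | l2norm w = ρ},
        b + κ / 2 * √n ≤ auxVal σ w t} := by
  have hn0 : (0 : ℝ) < n := by exact_mod_cast hn
  have hsn : 0 < √(n : ℝ) := Real.sqrt_pos.2 hn0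
  have hρ0 : 0 < ρ := hρ'.trans_lt hρ
  set A : ℝ → Set ((Fin m → ℝ) × (Fin n → ℝ) × ℝ) :=
    fun b => {t | ∃ w ∈ errSet xt ∩ {w | l2norm w ≤ ρ'}, auxVal σ w t < b} with hA
  have hbig : (4 : ENNReal)⁻¹ ≤ ghzLaw m n (A ((√α * σ + η * (2 * σ) + 1) * √n)) := by
    refine inv_four_le_inv_two.trans ((half_le_of_compl_le (S := {t | Typical k α D η t})
      (hT.trans ?_)).trans (measure_mono fun t ht => ?_))
    · rw [inv_four_eq]
      exact ENNReal.ofReal_le_ofReal (by norm_num)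
    · have ht' : Typical k α D η t := ht
      obtain ⟨u, -, -, hu⟩ := ht'.auxVal_dir_le hσ.le hη (le_refl (0 : ℝ))
      refine ⟨0, ⟨zero_mem_errSet hxt.nonneg, by change l2norm _ ≤ _; rwa [l2norm_zero]⟩, ?_⟩
      rw [zero_smul] at hu
      refine hu.trans_lt (mul_lt_mul_of_pos_right ?_ hsn)
      have : √(σ ^ 2 + 0 ^ 2) = σ := by
        rw [zero_pow two_ne_zero, add_zero, Real.sqrt_sq hσ.le]
      rw [auxLimit, this]
      linarith
  -- On the typical event the auxiliary objective is nonnegative on the ball, by `hη1`.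
  have hneg : ∀ b < 0, ghzLaw m n (A b) ≤ 4⁻¹ := by
    intro b hb
    refine (measure_mono ?_).trans hT
    rintro t ⟨w, ⟨hw, hwρ⟩, hwb⟩ ht
    have h1 := ht.auxVal_ge hσ.le hη (errSet_subset_errCone hxt hw) (le_trans hwρ hρ.le)
    have h2 := auxLimit_ge (σ := σ) (x := l2norm w) hDα
    have h3 : 0 ≤ (auxLimit σ α D (l2norm w) - η * (2 * σ + 2 * ρ)) * √n :=
      mul_nonneg (by linarith) hsn.le
    linarith
  -- The minimum of the auxiliary problem over the ball depends on `xt`, so the level is a quartile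
  -- of its law. With probability at least one half the ball stays above `b - κ / 2 * √n`; shrinking
  -- gains `κ * √n`, so the sphere stays above `b + κ / 2 * √n`.
  obtain ⟨b, hb0, hb1, hb2⟩ := exists_level (by positivity) hbig hneg
    (show 0 < κ / 2 * √n by positivity)
  refine ⟨b, hb0, hb1, inv_four_le_inv_two.trans (half_le_of_compl_le ?_)⟩
  refine (measure_mono (t := A (b - κ / 2 * √n) ∪ {t | ¬ Typical k α D η t}) ?_).trans
    ((measure_union_le _ _).trans ((add_le_add hb2 hT).trans ?_))
  · intro t ht
    by_contra hcon
    simp only [Set.mem_union, not_or] at hcon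
    obtain ⟨c1, c2⟩ := hcon
    have ht' : Typical k α D η t := not_not.1 c2
    refine ht fun w hw => ?_
    have hwρ : l2norm w = ρ := hw.2
    have hs : 0 ≤ ρ' / ρ := by positivity
    have hsw : (ρ' / ρ) • w ∈ errSet xt := by
      have := convex_errSet xt (zero_mem_errSet hxt.nonneg) hw.1 (a := 1 - ρ' / ρ) (b := ρ' / ρ)
        (by rw [sub_nonneg, div_le_one hρ0]; exact hρ.le) hs (by ring)
      simpa using this
    have h1 := ht'.auxVal_scale hσ.le hη hρ' hρ (errSet_subset_errCone hxt hw.1) hwρ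
    have h2 : b - κ / 2 * √n ≤ auxVal σ ((ρ' / ρ) • w) t := by
      by_contra hlt
      push Not at hlt
      refine c1 ⟨_, ⟨hsw, ?_⟩, hlt⟩
      change l2norm _ ≤ _
      rw [l2norm_smul, hwρ, abs_of_nonneg hs, div_mul_cancel₀ _ hρ0.ne']
    have h3 : κ * √n ≤ (auxLimit σ α D ρ - auxLimit σ α D ρ' - η * (2 * σ + 2 * ρ)) * √n :=
      mul_le_mul_of_nonneg_right (by linarith) hsn.le
    linarith
  · rw [inv_four_eq, ← ENNReal.ofReal_add (by norm_num) (by norm_num)]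
    exact ENNReal.ofReal_le_ofReal (by norm_num)

lemma exists_small {c d e : ℝ} (hd : 0 < d) (he : 0 < e) : ∃ η : ℝ, 0 < η ∧ η * c ≤ d ∧ η * c ≤ e := by
  refine ⟨min d e / (|c| + 1), by positivity, ?_⟩
  have h : min d e / (|c| + 1) * c ≤ min d e := by
    rw [div_mul_eq_mul_div, div_le_iff₀ (by positivity)]
    have : 0 < min d e := lt_min hd he
    nlinarith [le_abs_self c]
  exact ⟨h.trans (min_le_left _ _), h.trans (min_le_right _ _)⟩

/-! ### Upper and lower bounds for error vectors. -/

/-- Error vectors are unlikely to be much longer than the limit of `‖w_gen+‖₂`. -/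
theorem errorVector_upper {α β D ν σ ρ : ℝ} (hα1 : α ≤ 1) (hβ : 0 < β) (hβ1 : β ≤ 1) (hD : 0 < D)
    (hDα : D < α) (hν : 0 ≤ ν) (hσ : 0 < σ)
    (h₁ : (1 - β) * ∫ z, np ν z ∂(gaussianReal 0 1) = β * ν)
    (h₂ : (1 - β) * ∫ z, np ν z ^ 2 ∂(gaussianReal 0 1) + β * (1 + ν ^ 2) = D)
    (hρ : wLimit σ α D < ρ) :
    ∃ c : ℝ, 0 < c ∧ ∃ N : ℕ, ∀ n m k : ℕ, N ≤ n → (m : ℝ) = α * n → (k : ℝ) = β * n →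
      ∀ xt : Fin n → ℝ, IsSparsePos k xt →
        dataLaw m n σ {Av | ∃ w, IsErrorVector (Matrix.of Av.1) Av.2 xt w ∧ ρ < l2norm w}
          ≤ ENNReal.ofReal (16 * Real.exp (-(c * n))) := by
  have hα0 : 0 < α := hD.trans hDα
  have hr0 : 0 ≤ wLimit σ α D := by unfold wLimit; positivity
  -- The inner radius lies strictly above `wLimit`, where the limiting objective is increasing, so
  -- `ρ'` and `ρ` have a positive gap.
  set ρ' := (wLimit σ α D + ρ) / 2 with hρ'
  have hr' : wLimit σ α D < ρ' := by linarith
  have hρρ : ρ' < ρ := by linarith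
  have hgap : 0 < auxLimit σ α D ρ - auxLimit σ α D ρ' := by
    have h := auxLimit_grad (α := α) (D := D) hσ ρ' ρ
    have := mul_pos (sub_pos.2 hρρ) (slope_pos hσ hD.le hDα hr')
    linarith
  set κ := (auxLimit σ α D ρ - auxLimit σ α D ρ') / 2 with hκ
  have hκ0 : 0 < κ := half_pos hgap
  have hs : 0 < √α - √D := sub_pos.2 (Real.sqrt_lt_sqrt hD.le hDα)
  obtain ⟨η, hη, hη1, hη2⟩ := exists_small (c := 2 * σ + 2 * ρ) (mul_pos hs hσ) hκ0
  obtain ⟨N, hN⟩ := ghzLaw_not_typical_le hα0 hα1 hβ hβ1 hD hν h₁ h₂ hη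
    (show (0 : ℝ) < 1 / 4 by norm_num)
  refine ⟨(κ / 2) ^ 2 / (256 * (σ ^ 2 + ρ ^ 2)), by positivity, max N 1,
    fun n m k hn hm hk xt hxt => ?_⟩
  have hn1 : 0 < n := (le_max_right N 1).trans hn
  have hn0 : (0 : ℝ) < n := by exact_mod_cast hn1
  have hsn : 0 < √(n : ℝ) := Real.sqrt_pos.2 hn0
  have hm0 : NeZero m := ⟨by rintro rfl; rw [Nat.cast_zero] at hm; nlinarith [mul_pos hα0 hn0]⟩
  obtain ⟨b, hb0, hb1, hb2⟩ := exists_separating_level (m := m) hn1 hσ hη.le (hr0.trans hr'.le) hρρ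
    hκ0 hDα.le hη1 (by linarith) (by rw [inv_four_eq]; exact hN n m k ((le_max_left _ _).trans hn) hm hk) hxt
  have key := two_set_separation (R := ρ) hσ ((convex_errSet xt).inter (convex_l2norm_le ρ'))
    (isCompact_errSet_inter xt ρ') (fun w hw => le_trans hw.2 hρρ.le) (fun w hw => le_of_eq hw.2)
    hb0 (lt_add_of_pos_right b (by positivity : 0 < κ / 2 * √n)) hb1 hb2
  refine (measure_mono ?_).trans (key.trans (le_of_eq ?_))
  · rintro Av ⟨w, hw, hwρ⟩
    exact exists_sphere_of_errorVector hxt.nonneg (hr0.trans hr'.le) hρρ.le hw hwρ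
  · congr 3
    rw [add_sub_cancel_left, mul_pow, Real.sq_sqrt hn0.le]
    ring

/-- For a vector with large entries, error vectors are unlikely to be much shorter than the limit
of `‖w_gen+‖₂`. -/
theorem errorVector_lower {α β D ν σ ρ : ℝ} (hα1 : α ≤ 1) (hβ : 0 < β) (hβ1 : β ≤ 1) (hD : 0 < D)
    (hDα : D < α) (hν : 0 ≤ ν) (hσ : 0 < σ)
    (h₁ : (1 - β) * ∫ z, np ν z ∂(gaussianReal 0 1) = β * ν)
    (h₂ : (1 - β) * ∫ z, np ν z ^ 2 ∂(gaussianReal 0 1) + β * (1 + ν ^ 2) = D)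
    (hρ0 : 0 ≤ ρ) (hρ : ρ < wLimit σ α D) :
    ∃ c : ℝ, 0 < c ∧ ∃ N : ℕ, ∀ n m k : ℕ, N ≤ n → (m : ℝ) = α * n → (k : ℝ) = β * n →
      ∃ xt : Fin n → ℝ, IsSparsePos k xt ∧
        dataLaw m n σ {Av | ∃ w, IsErrorVector (Matrix.of Av.1) Av.2 xt w ∧ l2norm w ≤ ρ}
          ≤ ENNReal.ofReal (16 * Real.exp (-(c * n))) := by
  have hα0 : 0 < α := hD.trans hDα
  set x := (wLimit σ α D + ρ) / 2 with hx
  have hxr : x < wLimit σ α D := by linarith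
  have hρx : ρ < x := by linarith
  have hx0 : 0 ≤ x := hρ0.trans hρx.le
  have hslope := slope_neg hσ hD.le hDα hx0 hxr
  -- A product of two negative factors: the tangent at `x < wLimit` slopes downwards, so every norm
  -- up to `ρ < x` costs at least `κ` more.
  set κ := (ρ - x) * (√α * (x / √(σ ^ 2 + x ^ 2)) - √D) with hκ
  have hκ0 : 0 < κ := mul_pos_of_neg_of_neg (by linarith) hslope
  have hφ : ∀ y ≤ ρ, auxLimit σ α D x + κ ≤ auxLimit σ α D y := by
    intro y hy
    have h := auxLimit_grad (α := α) (D := D) hσ x y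
    nlinarith
  have hφ0 : 0 ≤ auxLimit σ α D x :=
    (mul_nonneg (sub_nonneg.2 (Real.sqrt_le_sqrt hDα.le)) hσ.le).trans (auxLimit_ge hDα.le)
  obtain ⟨η, hη, hη1, -⟩ := exists_small (c := 2 * σ + 2 * x) (show 0 < κ / 4 by positivity) hκ0
  obtain ⟨N, hN⟩ := ghzLaw_not_typical_le hα0 hα1 hβ hβ1 hD hν h₁ h₂ hη
    (show (0 : ℝ) < 1 / 2 by norm_num)
  refine ⟨(κ / 4) ^ 2 / (256 * (σ ^ 2 + x ^ 2)), by positivity, max N 1,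
    fun n m k hn hm hk => ?_⟩
  have hn1 : 0 < n := (le_max_right N 1).trans hn
  have hn0 : (0 : ℝ) < n := by exact_mod_cast hn1
  have hsn : 0 < √(n : ℝ) := Real.sqrt_pos.2 hn0
  have hm0 : NeZero m := ⟨by rintro rfl; rw [Nat.cast_zero] at hm; nlinarith [mul_pos hα0 hn0]⟩
  have hT := half_le_of_compl_le (S := {t | Typical k α D η t})
    (hN n m k ((le_max_left _ _).trans hn) hm hk)
  -- Coordinates of a unit vector are at least `-1`, so entries equal to `x` keep `xt + x • u`
  -- nonnegative on the last coordinates for every unit `u` in the cone.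
  set xt : Fin n → ℝ := fun i => if (i : ℕ) < n - k then 0 else x with hxtdef
  have hxt : IsSparsePos k xt := fun i =>
    ⟨fun hi => if_pos hi, fun hi => by rw [hxtdef]; simp only [if_neg (not_lt.2 hi)]; exact hx0⟩
  have hmem : ∀ u ∈ errCone n k, l2norm u = 1 → x • u ∈ errSet xt := by
    intro u hu hu1
    refine ⟨fun i => ?_, ?_⟩
    · rw [Pi.smul_apply, smul_eq_mul, hxtdef]
      dsimp only
      split_ifs with hi
      · rw [zero_add]; exact mul_nonneg hx0 (hu.1 i hi)
      · have h := (abs_le.1 ((abs_apply_le_l2norm u i).trans_eq hu1)).1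
        nlinarith
    · simp only [Pi.smul_apply, smul_eq_mul, ← Finset.mul_sum]
      exact mul_nonpos_of_nonneg_of_nonpos hx0 hu.2
  refine ⟨xt, hxt, ?_⟩
  have key := two_set_separation (m := m) (R := x) (b₁ := (auxLimit σ α D x + κ / 2) * √n)
    (b₂ := (auxLimit σ α D x + 3 / 4 * κ) * √n) hσ
    ((convex_errSet xt).inter (convex_l2norm_le x))
    (isCompact_errSet_inter xt x) (fun w hw => hw.2)
    (S := errSet xt ∩ {w | l2norm w ≤ ρ}) (fun w hw => le_trans hw.2 hρx.le)
    (by positivity) (by gcongr; linarith)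
    (inv_four_le_inv_two.trans (hT.trans (measure_mono fun t ht => by
      have ht' : Typical k α D η t := ht
      obtain ⟨u, hu, hu1, hut⟩ := ht'.auxVal_dir_le hσ.le hη.le hx0
      refine ⟨x • u, ⟨hmem u hu hu1, ?_⟩, hut.trans_lt (mul_lt_mul_of_pos_right (by linarith) hsn)⟩
      change l2norm _ ≤ _
      rw [l2norm_smul, hu1, abs_of_nonneg hx0, mul_one])))
    (inv_four_le_inv_two.trans (hT.trans (measure_mono fun t ht w hw => by
      have ht' : Typical k α D η t := ht
      refine le_trans ?_ (ht'.auxVal_ge hσ.le hη.le (errSet_subset_errCone hxt hw.1)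
        (le_trans hw.2 hρx.le))
      have := hφ _ hw.2
      exact mul_le_mul_of_nonneg_right (by linarith) hsn.le)))
  refine (measure_mono ?_).trans (key.trans (le_of_eq ?_))
  · rintro Av ⟨w, hw, hwρ⟩
    obtain ⟨h1, h2⟩ := (isErrorVector_iff hxt.nonneg).1 hw
    exact ⟨w, ⟨h1, hwρ⟩, fun w' hw' => h2 w' hw'.1⟩
  · congr 3
    rw [show (auxLimit σ α D x + 3 / 4 * κ) * √n - (auxLimit σ α D x + κ / 2) * √n
      = κ / 4 * √n by ring, mul_pow, Real.sq_sqrt hn0.le]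
    ring

/-! ### Assembly of the theorem. -/

lemma exists_exp_absorb {c C : ℝ} (hc : 0 < c) (hC : 0 < C) :
    ∃ N : ℕ, ∀ n : ℕ, N ≤ n → C * Real.exp (-(c * n)) ≤ Real.exp (-(c / 2) * n) := by
  obtain ⟨N, hN⟩ := exists_nat_gt (Real.log C / (c / 2))
  refine ⟨N, fun n hn => ?_⟩
  rw [div_lt_iff₀ (by positivity)] at hN
  have hn' : (N : ℝ) ≤ n := by exact_mod_cast hn
  rw [← Real.exp_log hC, ← Real.exp_add]
  refine Real.exp_le_exp.2 ?_
  nlinarith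

end SignedLasso

/-- The probability bounds are stated for the complementary events: an event holds with
probability at least `1 - exp (-c n)` when its complement has (outer) measure at most
`exp (-c n)`. -/
theorem mainTheorem6 (α β σ ε : ℝ) (hβ : 0 < β) (hα : α < 1)
    (hcurve : SignedLasso.BelowSignedCurve α β) (hσ : 0 < σ) (hε : 0 < ε) :
    ∃ c₂ : ℝ, 0 < c₂ ∧ ∃ c₃ : ℝ, 0 < c₃ ∧ ∃ N : ℕ, ∀ n m k : ℕ, N ≤ n →
      (m : ℝ) = α * n → (k : ℝ) = β * n →
      Integrable (fun gh : (Fin m → ℝ) × (Fin n → ℝ) => SignedLasso.wGenNorm k σ gh.1 gh.2)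
        (SignedLasso.ghLaw m n) ∧
      (∃ xt : Fin n → ℝ, SignedLasso.IsSparsePos k xt ∧
        SignedLasso.dataLaw m n σ
          {Av | ¬ ∃ w : Fin n → ℝ, SignedLasso.IsErrorVector (Matrix.of Av.1) Av.2 xt w ∧
            SignedLasso.l2norm w ∈ Set.Ioo ((1 - ε) * SignedLasso.meanWGen m n k σ)
              ((1 + ε) * SignedLasso.meanWGen m n k σ)}
          ≤ ENNReal.ofReal (Real.exp (-c₂ * n))) ∧
      (∀ xt : Fin n → ℝ, SignedLasso.IsSparsePos k xt →
        SignedLasso.dataLaw m n σ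
          {Av | ¬ ∀ w : Fin n → ℝ, SignedLasso.IsErrorVector (Matrix.of Av.1) Av.2 xt w →
            SignedLasso.l2norm w ≤ (1 + ε) * SignedLasso.meanWGen m n k σ}
          ≤ ENNReal.ofReal (Real.exp (-c₃ * n))) := by
  open SignedLasso in
  obtain ⟨D, ν, hβD, hD1, hDα, hν, h₁, h₂⟩ := exists_threshold hβ hcurve
  have hD : 0 < D := hβ.trans hβD
  have hβ1 : β ≤ 1 := (hβD.trans hD1).le
  set r := wLimit σ α D with hr
  have hr0 : 0 < r := by
    have h1 : 0 < α - D := by linarith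
    rw [hr, wLimit]; positivity
  -- The lower radius `(1 - ε' / 2) * r` must be nonnegative, while `ε` may exceed one.
  set ε' := min ε 1 with hε'
  have hε0 : 0 < ε' := by positivity
  have hεε : ε' ≤ ε := min_le_left _ _
  have hε1 : ε' ≤ 1 := min_le_right _ _
  -- Precise enough that replacing `r` by the mean costs at most `ε' r / 4` after multiplication by
  -- `1 + ε`, less than the margin `ε r / 2` between the radii.
  set ζ := ε' * r / (4 * (1 + ε)) with hζ
  have hζ0 : 0 < ζ := by positivity
  have hζe : (1 + ε) * ζ = ε' * r / 4 := by rw [hζ]; field_simp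
  have hζr : ζ ≤ ε' * r / 4 := by nlinarith
  have hεr : ε' * r ≤ ε * r := mul_le_mul_of_nonneg_right hεε hr0.le
  have hεr0 : 0 < ε' * r := mul_pos hε0 hr0
  obtain ⟨N₀, hN₀⟩ := meanWGen_approx hα.le hβ hβ1 hD hDα hν hσ.le h₁ h₂ hζ0
  obtain ⟨c, hc, N₁, hN₁⟩ := errorVector_upper (ρ := (1 + ε / 2) * r) hα.le hβ hβ1 hD hDα hν hσ
    h₁ h₂ (by nlinarith)
  obtain ⟨c', hc', N₂, hN₂⟩ := errorVector_lower (ρ := (1 - ε' / 2) * r) hα.le hβ hβ1 hD hDα hν hσ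
    h₁ h₂ (mul_nonneg (by linarith) hr0.le) (by nlinarith)
  obtain ⟨N₃, hN₃⟩ := exists_exp_absorb hc (C := 16) (by norm_num)
  obtain ⟨N₄, hN₄⟩ := exists_exp_absorb (lt_min hc hc') (C := 32) (by norm_num)
  refine ⟨min c c' / 2, by positivity, c / 2, by positivity,
    max (max N₀ N₁) (max N₂ (max N₃ N₄)), fun n m k hn hm hk => ?_⟩
  simp only [max_le_iff] at hn
  obtain ⟨⟨n0, n1⟩, n2, n3, n4⟩ := hn
  obtain ⟨hint, hmean⟩ := hN₀ n m k n0 hm hk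
  obtain ⟨hml, hmu⟩ := abs_le.1 hmean
  set M := meanWGen m n k σ with hM
  have hup : (1 + ε / 2) * r < (1 + ε) * M := by nlinarith
  have hM0 : 0 ≤ M := by nlinarith
  have hlow : (1 - ε) * M ≤ (1 - ε' / 2) * r := by
    have h1 : (1 - ε) * M ≤ (1 - ε') * M := mul_le_mul_of_nonneg_right (by linarith) hM0
    have h2 : (1 - ε') * M ≤ (1 - ε') * (r + ζ) :=
      mul_le_mul_of_nonneg_left (by linarith) (by linarith)
    have h3 : (1 - ε') * ζ ≤ ζ := mul_le_of_le_one_left hζ0.le (by linarith)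
    nlinarith
  refine ⟨hint, ?_, fun xt hxt => ?_⟩
  · obtain ⟨xt, hxt, hprob⟩ := hN₂ n m k n2 hm hk
    refine ⟨xt, hxt, ?_⟩
    -- An error vector always exists by compactness. The event can therefore fail only if some error
    -- vector is too long or too short.
    refine le_trans (measure_mono (t :=
      {Av | ∃ w, IsErrorVector (Matrix.of Av.1) Av.2 xt w ∧ (1 + ε / 2) * r < l2norm w} ∪
      {Av | ∃ w, IsErrorVector (Matrix.of Av.1) Av.2 xt w ∧ l2norm w ≤ (1 - ε' / 2) * r}) ?_) ?_
    · intro Av hAv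
      by_contra hcon
      simp only [Set.mem_union, not_or] at hcon
      obtain ⟨w, hw⟩ := exists_isErrorVector (Matrix.of Av.1) Av.2 hxt.nonneg
      refine hAv ⟨w, hw, ?_, ?_⟩
      · exact hlow.trans_lt (not_le.1 fun h => hcon.2 ⟨w, hw, h⟩)
      · exact (not_lt.1 fun h => hcon.1 ⟨w, hw, h⟩).trans_lt hup
    · refine (measure_union_le _ _).trans ((add_le_add (hN₁ n m k n1 hm hk xt hxt) hprob).trans ?_)
      rw [← ENNReal.ofReal_add (by positivity) (by positivity)]
      refine ENNReal.ofReal_le_ofReal (le_trans ?_ (hN₄ n n4))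
      have e1 : Real.exp (-(c * n)) ≤ Real.exp (-(min c c' * n)) := by
        gcongr; exact min_le_left _ _
      have e2 : Real.exp (-(c' * n)) ≤ Real.exp (-(min c c' * n)) := by
        gcongr; exact min_le_right _ _
      linarith
  · refine le_trans (measure_mono ?_) ((hN₁ n m k n1 hm hk xt hxt).trans
      (ENNReal.ofReal_le_ofReal (hN₃ n n3)))
    intro Av hAv
    have h : ¬ ∀ w, _ := hAv
    push Not at h
    obtain ⟨w, hw, hwM⟩ := h
    exact ⟨w, hw, hup.trans hwM⟩
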